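/- Setting. Let $d\ge 1$. The $d$-dimensional simplicial lattice is $\{n\in\mathbb Z^{d+1}: n_1+\dots+n_{d+1}=0\}$; nearest neighbours differ by $e_p-e_r$ with $p\ne r$, and $\mathsf d(x,y)=\sum_p\max(y_p-x_p,0)$ is the resulting Manhattan distance. A simplex (of the fixed orientation) is a set of lattice points of the form $\{n: n_p\ge a_p \text{ for all } p\}$ with $a\in\mathbb Z^{d+1}$ and $\sum_p a_p<0$, and $\mathrm{diam}\,S=\max_{x,y\in S}\mathsf d(x,y)$. The finite lattice $\Lambda$ is itself such a simplex (of arbitrary size), and each site $i\in\Lambda$ carries a qudit $\mathbb C^{q_i}$ with arbitrary $q_i\ge1$; operators act on $\bigotimes_{i\in\Lambda}\mathbb C^{q_i}$ and $\|\cdot\|$ is the operator norm (largest singular value). For $\alpha\in(0,1)$ and $\kappa\ge 0$ put $$\|O\|_\kappa=\|O\|_{\alpha,\kappa}=\inf_{\{O_S\}}\ \max_{i\in\Lambda}\ \sum_{S\ni i} e^{\kappa(\mathrm{diam}\,S)^\alpha}\|O_S\|,$$ the infimum being over all decompositions $O=\sum_S O_S$ over simplices $S\subseteq\Lambda$ with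 $O_S$ supported inside $S$ (that is, acting as the identity on the sites outside $S$). Proposition. For every $d\ge1$, $\alpha\in(0,1)$ and $\kappa_1>0$ there is a constant $0<c_-<\infty$, depending only on $d,\alpha,\kappa_1$, such that the following holds for every such $\Lambda$ and $(q_i)_{i\in\Lambda}$. Let $0\le\kappa'<\kappa\le\kappa_1$ and $\delta\kappa=\kappa-\kappa'$. Let $H$ be a Hermitian operator (Hamiltonian), $\mathcal L=i[H,\cdot]$, and let $t\in\mathbb R$ satisfy $$|t|\,\|H\|_\kappa\le(\delta\kappa)^{(3d+1)/\alpha}.$$ Then for every operator $O$, $$\|e^{t\mathcal L}O-O\|_{\kappa'}\le c_-\,(\delta\kappa)^{-(2d-1)/\alpha}\,|t|\,\|H\|_\kappa\,\|O\|_\kappa .$$ -/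

import Mathlib

open scoped Matrix.Norms.L2Operator

/-- The `d`-dimensional simplicial lattice: the integer points of the hyperplane
`n₁ + ⋯ + n_{d+1} = 0` in `ℤ^{d+1}`. Nearest neighbours differ by `e_p - e_r` with `p ≠ r`. -/
abbrev SimplicialLattice (d : ℕ) : Type :=
  {n : Fin (d + 1) → ℤ // ∑ p, n p = 0}

/-- The Manhattan distance on the simplicial lattice: the least number of nearest-neighbour steps
`e_p - e_r` leading from `x` to `y`. Each step raises one coordinate by one and lowers another one
by one, so this number is the total of the positive parts of the coordinates of `y - x` (equivalently
half of the `ℓ¹` distance). -/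
def manhattanDist {d : ℕ} (x y : SimplicialLattice d) : ℕ :=
  ∑ p, (y.1 p - x.1 p).toNat

/-- The diameter of a finite set of sites, in the Manhattan distance. -/
def latticeDiam {d : ℕ} (S : Finset (SimplicialLattice d)) : ℕ :=
  S.sup fun x => S.sup fun y => manhattanDist x y

/-- `S` is a simplex of the fixed orientation: the set of all lattice points of the regular
`d`-dimensional simplex cut out of the hyperplane by `n_p ≥ a_p`, `p = 1, …, d+1`. Its vertices are
the `d + 1` lattice points `a + m e_p` with `m = -(a_1 + ⋯ + a_{d+1})` its side length, and it is
nondegenerate exactly when `m > 0`. -/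
def IsSimplex {d : ℕ} (S : Finset (SimplicialLattice d)) : Prop :=
  ∃ a : Fin (d + 1) → ℤ, ∑ p, a p < 0 ∧ ∀ x : SimplicialLattice d, x ∈ S ↔ ∀ p, a p ≤ x.1 p

/-- The finite collection of all simplices contained in the finite lattice `Λ`. -/
noncomputable def simplices {d : ℕ} (Λ : Finset (SimplicialLattice d)) :
    Finset (Finset (SimplicialLattice d)) :=
  open Classical in Λ.powerset.filter IsSimplex

/-- Labels of the product basis of the Hilbert space `⨂_{i ∈ Λ} ℂ^{q i}`. -/
abbrev Config {d : ℕ} (Λ : Finset (SimplicialLattice d)) (q : Λ → ℕ) : Type :=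
  ∀ i : Λ, Fin (q i)

/-- Operators on `⨂_{i ∈ Λ} ℂ^{q i}`, as matrices in the product basis. The norm in force on them
is the operator norm for the Hilbert space norm, that is, the largest singular value. -/
abbrev LatticeOp {d : ℕ} (Λ : Finset (SimplicialLattice d)) (q : Λ → ℕ) : Type :=
  Matrix (Config Λ q) (Config Λ q) ℂ

/-- `A` is supported inside `S`: it has the form `B ⊗ 1`, with `B` an operator on the tensor factors
of the sites in `S` and `1` the identity on those of the sites outside `S`. -/
def SupportedIn {d : ℕ} {Λ : Finset (SimplicialLattice d)} {q : Λ → ℕ}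
    (S : Finset (SimplicialLattice d)) (A : LatticeOp Λ q) : Prop :=
  open Classical in
  ∃ B : Matrix (∀ i : {i : Λ // i.1 ∈ S}, Fin (q i.1)) (∀ i : {i : Λ // i.1 ∈ S}, Fin (q i.1)) ℂ,
    ∀ x y : Config Λ q,
      A x y = if ∀ i : Λ, i.1 ∉ S → x i = y i then B (fun i => x i.1) (fun i => y i.1) else 0

/-- `f` is a local decomposition `A = ∑_S f S` over the simplices `S ⊆ Λ`, with `f S` supported
inside `S`. -/
def IsLocalDecomposition {d : ℕ} {Λ : Finset (SimplicialLattice d)} {q : Λ → ℕ}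
    (A : LatticeOp Λ q) (f : Finset (SimplicialLattice d) → LatticeOp Λ q) : Prop :=
  (∀ S ∈ simplices Λ, SupportedIn S (f S)) ∧ ∑ S ∈ simplices Λ, f S = A

/-- `max_{i ∈ Λ} ∑_{S ∋ i} exp(κ (diam S)^α) ‖f S‖`, the sum being over the simplices `S ⊆ Λ`. -/
noncomputable def decompositionNorm {d : ℕ} {Λ : Finset (SimplicialLattice d)} {q : Λ → ℕ}
    (α κ : ℝ) (f : Finset (SimplicialLattice d) → LatticeOp Λ q) : ℝ :=
  ⨆ i : Λ, ∑ S ∈ (simplices Λ).filter (fun S => i.1 ∈ S),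
    Real.exp (κ * (latticeDiam S : ℝ) ^ α) * ‖f S‖

/-- The `(α, κ)`-norm of an operator: the infimum of
`max_{i ∈ Λ} ∑_{S ∋ i} exp(κ (diam S)^α) ‖A_S‖` over all local decompositions `A = ∑_S A_S`. -/
noncomputable def kappaNorm {d : ℕ} {Λ : Finset (SimplicialLattice d)} {q : Λ → ℕ}
    (α κ : ℝ) (A : LatticeOp Λ q) : ℝ :=
  sInf {r : ℝ | ∃ f : Finset (SimplicialLattice d) → LatticeOp Λ q,
    IsLocalDecomposition A f ∧ r = decompositionNorm α κ f}

/-- The infimum defining the `(α, κ)`-norm is over a nonempty set when `Λ` is itself a simplex. -/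
theorem exists_isLocalDecomposition {d : ℕ} {Λ : Finset (SimplicialLattice d)} (hΛ : IsSimplex Λ)
    {q : Λ → ℕ} (A : LatticeOp Λ q) :
    ∃ f : Finset (SimplicialLattice d) → LatticeOp Λ q, IsLocalDecomposition A f := by
  classical
  have hmem : Λ ∈ simplices Λ := by simp [simplices, hΛ]
  refine ⟨fun S => if S = Λ then A else 0, ?_, ?_⟩
  · intro S _
    by_cases h : S = Λ
    · subst h
      refine ⟨fun u v => A (fun i => u ⟨i, i.2⟩) (fun i => v ⟨i, i.2⟩), fun x y => ?_⟩
      simp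
    · exact ⟨0, fun x y => by simp [h]⟩
  · simp [hmem]

/-- The infimum defining the `(α, κ)`-norm is over a set bounded below by zero. -/
theorem decompositionNorm_nonneg {d : ℕ} {Λ : Finset (SimplicialLattice d)} {q : Λ → ℕ}
    (α κ : ℝ) (f : Finset (SimplicialLattice d) → LatticeOp Λ q) :
    0 ≤ decompositionNorm α κ f :=
  Real.iSup_nonneg fun _ => Finset.sum_nonneg fun _ _ => by positivity

/-- The Liouvillian `𝓛 = i [H, ·]`, a linear map on operators. -/
noncomputable def liouvillian {d : ℕ} {Λ : Finset (SimplicialLattice d)} {q : Λ → ℕ}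
    (H : LatticeOp Λ q) : LatticeOp Λ q →L[ℂ] LatticeOp Λ q :=
  Complex.I • (ContinuousLinearMap.mul ℂ (LatticeOp Λ q) H
    - (ContinuousLinearMap.mul ℂ (LatticeOp Λ q)).flip H)

theorem liouvillian_apply {d : ℕ} {Λ : Finset (SimplicialLattice d)} {q : Λ → ℕ}
    (H A : LatticeOp Λ q) : liouvillian H A = Complex.I • (H * A - A * H) := rfl

/-- `e^{t 𝓛} A`, with `e^{t 𝓛} = ∑ₙ tⁿ 𝓛ⁿ / n!` the exponential of the linear map `t 𝓛`,
`𝓛 = i [H, ·]`. -/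
noncomputable def heisenberg {d : ℕ} {Λ : Finset (SimplicialLattice d)} {q : Λ → ℕ}
    (H : LatticeOp Λ q) (t : ℝ) (A : LatticeOp Λ q) : LatticeOp Λ q :=
  NormedSpace.exp ((t : ℂ) • liouvillian H) A

/-! ### Inner derivations and unitary evolution in a C*-algebra. -/

section Dynamics

variable {𝔄 : Type*} [CStarAlgebra 𝔄]

/-! Write `tH = ∑ G_T` and `O = ∑ O_S` in nearly optimal decompositions with every `G_T` Hermitian.
Each evolved `O_S` must be cut into pieces supported in simplices `R ⊇ S`. Such `R` correspond to
the lower bounds `b ≤ corner S` in a box of `ℤ^{d+1}`. To each `b` attach the evolution of `O_S`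
generated only by the terms inside the simplex at `b`. The piece at `R` is the mixed difference of
this function in the directions in which `R` exceeds `S`, and these pieces telescope to the full
evolution (`sum_boxDiff`, `sum_targetDiff_growthFaces`). Moving a face inwards by one step removes
exactly the terms that meet it (`avoiding_simplexFace`). The mixed difference is therefore an
inclusion-exclusion that keeps only the processes reaching all the outer faces of `R`, the targets.

The Lieb–Robinson bound `norm_targetDiff_truncatedEvolution_le` estimates such a difference. In its
time derivative, the commutator with the whole generator preserves norms. The source contains only
terms `G_T` whose `T` meets a target; `T` uses up that target and becomes a new one unless it meets
`S`. Iteration gives sums over `n`-step histories with weight `1/n!`. The remainder vanishes on a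
finite lattice.

Intersecting simplices have a join of subadditive diameter, and `x ^ α` is subadditive. The weight
`exp (κ (diam R)^α)` is thus shared out among `S` and the members of the history
(`exp_mul_historySum_le`). Lowering `κ` by `δκ` leaves stretched exponentials of length scale `E ~
δκ^(-1/α)`, which pay for cardinalities and for sums over positions in powers of `E`.

Let `τ` stand for `|t| ‖H‖_κ`. Evolution inside `S` costs `τ E^d`. In a one-step history `T` crosses
the boundary of `S` and `R` is the join of `S` and `T`, so the cost is `E^(d-1)` for the boundary
times `E^d` for the position (`sum_historySum_one_le`). For `n ≥ 2` steps the cruder bound `τ^n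
E^((2d-1)n+d+1)` suffices, because `τ E^(3d+1)` is bounded by hypothesis
(`pow_mul_pow_le_of_mul_pow_le`). The sum over `n` is then an exponential series. -/

/-- The derivation `X ↦ i [G, X]`. -/
noncomputable def adjointAction (G X : 𝔄) : 𝔄 := Complex.I • (G * X - X * G)

/-- The Heisenberg evolution `e^{isG} X e^{-isG}`. -/
noncomputable def evolve (G : 𝔄) (s : ℝ) (X : 𝔄) : 𝔄 :=
  NormedSpace.exp (s • (Complex.I • G)) * X * NormedSpace.exp ((-s) • (Complex.I • G))

theorem adjointAction_sum {ι : Type*} (A : Finset ι) (G : ι → 𝔄) (X : 𝔄) :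
    adjointAction (∑ T ∈ A, G T) X = ∑ T ∈ A, adjointAction (G T) X := by
  simp only [adjointAction, Finset.sum_mul, Finset.mul_sum, ← Finset.sum_sub_distrib,
    Finset.smul_sum]

theorem adjointAction_sub (G X Y : 𝔄) :
    adjointAction G (X - Y) = adjointAction G X - adjointAction G Y := by
  simp only [adjointAction, mul_sub, sub_mul, ← smul_sub]
  congr 1; abel

theorem adjointAction_eq_zero {G X : 𝔄} (h : Commute G X) : adjointAction G X = 0 := by
  simp [adjointAction, h.eq]

theorem norm_adjointAction_le (G X : 𝔄) : ‖adjointAction G X‖ ≤ 2 * ‖G‖ * ‖X‖ := by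
  rw [adjointAction, norm_smul, Complex.norm_I, one_mul]
  calc _ ≤ ‖G * X‖ + ‖X * G‖ := norm_sub_le _ _
    _ ≤ ‖G‖ * ‖X‖ + ‖X‖ * ‖G‖ := add_le_add (norm_mul_le _ _) (norm_mul_le _ _)
    _ = _ := by ring

@[simp] theorem evolve_zero (G X : 𝔄) : evolve G 0 X = X := by simp [evolve]

theorem exp_smul_I_mem_unitary {G : 𝔄} (hG : IsSelfAdjoint G) (s : ℝ) :
    NormedSpace.exp (s • (Complex.I • G)) ∈ unitary 𝔄 := by
  have h := (selfAdjoint.expUnitary (⟨s • G, IsSelfAdjoint.smul (IsSelfAdjoint.all s) hG⟩ : selfAdjoint 𝔄)).2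
  rw [selfAdjoint.expUnitary_coe] at h
  rwa [smul_comm] at h

theorem norm_evolve {G : 𝔄} (hG : IsSelfAdjoint G) (s : ℝ) (X : 𝔄) : ‖evolve G s X‖ = ‖X‖ := by
  rw [evolve, CStarRing.norm_mul_mem_unitary _ (exp_smul_I_mem_unitary hG (-s)),
    CStarRing.norm_mem_unitary_mul _ (exp_smul_I_mem_unitary hG s)]

theorem commute_evolve {K G X : 𝔄} (hG : Commute K G) (hX : Commute K X) (s : ℝ) :
    Commute K (evolve G s X) := by
  let +nondep : NormedAlgebra ℚ 𝔄 := .restrictScalars ℚ ℂ 𝔄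
  have h (r : ℝ) : Commute K (NormedSpace.exp (r • (Complex.I • G))) :=
    ((hG.smul_right _).smul_right _).exp_right
  exact ((h s).mul_right hX).mul_right (h (-s))

theorem hasDerivAt_evolve_comp (G : 𝔄) {X : ℝ → 𝔄} {X' : 𝔄} {s : ℝ} (hX : HasDerivAt X X' s) :
    HasDerivAt (fun r => evolve G r (X r)) (adjointAction G (evolve G s (X s)) + evolve G s X') s := by
  have h1 := hasDerivAt_exp_smul_const' (𝕂 := ℝ) (Complex.I • G) s
  have h2 := (hasDerivAt_exp_smul_const (𝕂 := ℝ) (Complex.I • G) (-s)).scomp s (hasDerivAt_neg s)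
  have h := (h1.mul hX).mul h2
  refine h.congr_deriv ?_
  simp only [evolve, adjointAction, Function.comp_def, Pi.mul_apply]
  simp only [neg_smul, one_smul, add_mul, mul_neg, mul_smul_comm, smul_mul_assoc, smul_sub, mul_assoc]
  abel

theorem adjointAction_evolve_neg (G X : 𝔄) (s : ℝ) :
    adjointAction (-G) (evolve (-G) s X) + evolve (-G) s (adjointAction G X) = 0 := by
  have hc (r : ℝ) : Commute G (NormedSpace.exp (r • (Complex.I • -G))) := by
    let +nondep : NormedAlgebra ℚ 𝔄 := .restrictScalars ℚ ℂ 𝔄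
    exact ((((Commute.refl G).neg_right).smul_right _).smul_right _).exp_right
  simp only [evolve, adjointAction]
  have h1 := hc s
  have h2 := hc (-s)
  generalize NormedSpace.exp (s • (Complex.I • -G)) = U at *
  generalize NormedSpace.exp ((-s) • (Complex.I • -G)) = W at *
  simp only [mul_smul_comm, smul_mul_assoc, ← smul_add, mul_sub, sub_mul, neg_mul, mul_neg]
  have e1 : U * (G * X) * W = G * (U * X * W) := by
    rw [← mul_assoc, ← h1.eq]; simp only [mul_assoc]
  have e2 : U * (X * G) * W = U * X * W * G := by
    simp only [mul_assoc]; rw [h2.eq]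
  rw [e1, e2]
  simp

theorem hasDerivAt_evolve (G X : 𝔄) (s : ℝ) :
    HasDerivAt (fun r => evolve G r X) (adjointAction G (evolve G s X)) s := by
  have h := hasDerivAt_evolve_comp G (hasDerivAt_const s X)
  simpa [evolve] using h

/-- Duhamel estimate: the evolution by `G` is isometric, so that only the source term `R` makes
the norm of a solution of `X' = i [G, X] + R` grow. -/
theorem norm_le_of_hasDerivAt_adjointAction {G : 𝔄} (hG : IsSelfAdjoint G) {X R : ℝ → 𝔄}
    {B B' : ℝ → ℝ} (hX : ∀ s, HasDerivAt X (adjointAction G (X s) + R s) s)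
    (h0 : ‖X 0‖ ≤ B 0) (hB : ∀ s, HasDerivAt B (B' s) s)
    (hR : ∀ s, 0 ≤ s → ‖R s‖ ≤ B' s) {s : ℝ} (hs : 0 ≤ s) : ‖X s‖ ≤ B s := by
  -- In the interaction picture the drift cancels and only the rotated source remains.
  have hd (r : ℝ) : HasDerivAt (fun r => evolve (-G) r (X r)) (evolve (-G) r (R r)) r := by
    refine (hasDerivAt_evolve_comp (-G) (hX r)).congr_deriv ?_
    have : evolve (-G) r (adjointAction G (X r) + R r)
        = evolve (-G) r (adjointAction G (X r)) + evolve (-G) r (R r) := by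
      simp [evolve, mul_add, add_mul]
    rw [this, ← add_assoc, adjointAction_evolve_neg, zero_add]
  have key := image_norm_le_of_norm_deriv_right_le_deriv_boundary (a := 0) (b := s)
    (f := fun r => evolve (-G) r (X r)) (f' := fun r => evolve (-G) r (R r)) (B := B) (B' := B')
    (fun r _ => (hd r).continuousAt.continuousWithinAt) (fun r _ => (hd r).hasDerivWithinAt)
    (by simpa using h0) hB
    (fun r hr => by rw [norm_evolve hG.neg]; exact hR r hr.1)
  have := key (Set.right_mem_Icc.2 hs)
  rwa [norm_evolve hG.neg] at this

/-- The difference starts at `0` and solves the same equation with the constant source `i [G, X]`.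
-/
theorem norm_evolve_one_sub_le {G : 𝔄} (hG : IsSelfAdjoint G) (X : 𝔄) :
    ‖evolve G 1 X - X‖ ≤ ‖adjointAction G X‖ := by
  have h (s : ℝ) : HasDerivAt (fun r => evolve G r X - X)
      (adjointAction G (evolve G s X - X) + adjointAction G X) s := by
    refine ((hasDerivAt_evolve G X s).sub_const X).congr_deriv ?_
    rw [adjointAction_sub]; abel
  have := norm_le_of_hasDerivAt_adjointAction hG (B := fun s => s * ‖adjointAction G X‖)
    (B' := fun _ => ‖adjointAction G X‖) h (by simp)
    (fun s => by simpa using (hasDerivAt_id s).mul_const ‖adjointAction G X‖)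
    (fun _ _ => le_rfl) zero_le_one
  simpa using this

end Dynamics

/-! ### Inclusion-exclusion over target sets. -/

section Targets

variable {V : Type*} [DecidableEq V]

/-- The members of `A` that do not meet `X`. -/
def avoiding (X : Finset V) (A : Finset (Finset V)) : Finset (Finset V) :=
  A.filter fun T => Disjoint X T

theorem avoiding_comm (X Y : Finset V) (A : Finset (Finset V)) :
    avoiding X (avoiding Y A) = avoiding Y (avoiding X A) := by
  simp only [avoiding, Finset.filter_filter, and_comm]

theorem avoiding_subset (X : Finset V) (A : Finset (Finset V)) : avoiding X A ⊆ A :=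
  Finset.filter_subset _ _

variable {E : Type*} [AddCommGroup E]

/-- The iterated difference of `F` over the targets in the list `Q`: inclusion-exclusion for the
contributions to `F A` that use, for each target, a member of `A` meeting it. -/
def targetDiff : (Finset (Finset V) → E) → List (Finset V) → Finset (Finset V) → E
  | F, [], A => F A
  | F, X :: Q, A => targetDiff (fun B => F B - F (avoiding X B)) Q A

/-- The iterated difference over those targets in the list that `T` does not meet. -/
def targetDiffExcept (T : Finset V) :
    (Finset (Finset V) → E) → List (Finset V) → Finset (Finset V) → E
  | F, [], A => F A
  | F, X :: Q, A =>
    if Disjoint X T then targetDiffExcept T (fun B => F B - F (avoiding X B)) Q A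
    else targetDiffExcept T F Q A

/-- The lists of targets left over when `T` removes one target it meets and those it meets further
down the list. -/
def residuals (T : Finset V) : List (Finset V) → List (List (Finset V))
  | [] => []
  | X :: Q => if Disjoint X T then (residuals T Q).map (X :: ·) else Q :: residuals T Q

theorem targetDiff_sub (F F' : Finset (Finset V) → E) (Q : List (Finset V))
    (A : Finset (Finset V)) :
    targetDiff (fun B => F B - F' B) Q A = targetDiff F Q A - targetDiff F' Q A := by
  induction Q generalizing F F' with
  | nil => rfl
  | cons X Q ih =>
    simp only [targetDiff]
    rw [← ih]
    congr 1
    funext B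
    abel

theorem targetDiff_avoiding (F : Finset (Finset V) → E) (X : Finset V) (Q : List (Finset V))
    (A : Finset (Finset V)) :
    targetDiff (fun B => F (avoiding X B)) Q A = targetDiff F Q (avoiding X A) := by
  induction Q generalizing F with
  | nil => rfl
  | cons Y Q ih =>
    simp only [targetDiff]
    rw [← ih]
    congr 1
    funext B
    rw [avoiding_comm]

/-- The definition puts the difference inside the function. Since removals commute, it can be moved
to the argument `A`, the form needed to treat one target at a time. -/
theorem targetDiff_cons (F : Finset (Finset V) → E) (X : Finset V) (Q : List (Finset V))
    (A : Finset (Finset V)) :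
    targetDiff F (X :: Q) A = targetDiff F Q A - targetDiff F Q (avoiding X A) := by
  rw [targetDiff, targetDiff_sub, targetDiff_avoiding]

theorem targetDiff_map {E' : Type*} [AddCommGroup E'] (φ : E → E')
    (hφ : ∀ x y, φ (x - y) = φ x - φ y) (F : Finset (Finset V) → E) (Q : List (Finset V))
    (A : Finset (Finset V)) :
    targetDiff (fun B => φ (F B)) Q A = φ (targetDiff F Q A) := by
  induction Q generalizing F with
  | nil => rfl
  | cons X Q ih => simp only [targetDiff, ← hφ, ih (fun B => F B - F (avoiding X B))]

theorem targetDiffExcept_map {E' : Type*} [AddCommGroup E'] (φ : E → E')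
    (hφ : ∀ x y, φ (x - y) = φ x - φ y) (T : Finset V) (F : Finset (Finset V) → E)
    (Q : List (Finset V)) (A : Finset (Finset V)) :
    targetDiffExcept T (fun B => φ (F B)) Q A = φ (targetDiffExcept T F Q A) := by
  induction Q generalizing F with
  | nil => rfl
  | cons X Q ih =>
    simp only [targetDiffExcept, ← hφ, ih (fun B => F B - F (avoiding X B)), ih F]
    split_ifs <;> rfl

/-- An iterated difference is an integer combination of values of `F` at subsets of `A`. -/
theorem targetDiff_mem {S : Type*} [SetLike S E] [AddSubgroupClass S E] (s : S)
    (F : Finset (Finset V) → E) (Q : List (Finset V)) (A : Finset (Finset V))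
    (h : ∀ B ⊆ A, F B ∈ s) : targetDiff F Q A ∈ s := by
  induction Q generalizing F with
  | nil => exact h A subset_rfl
  | cons X Q ih =>
    exact ih _ fun B hB => sub_mem (h B hB) (h _ ((avoiding_subset X B).trans hB))

theorem targetDiff_eq_zero (F : Finset (Finset V) → E) (Q : List (Finset V))
    (A : Finset (Finset V)) (h : ∀ B ⊆ A, F B = 0) : targetDiff F Q A = 0 := by
  simpa using targetDiff_mem (⊥ : AddSubgroup E) F Q A (by simpa using h)

/-- A member `T` that meets `X` is absent from `avoiding X B`, so its summand has nothing to be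
subtracted from it: the difference over `X` acts only on the summands with `T` disjoint from `X`. -/
theorem targetDiff_sum (Φ : Finset V → Finset (Finset V) → E) (Q : List (Finset V))
    (A : Finset (Finset V)) :
    targetDiff (fun B => ∑ T ∈ B, Φ T B) Q A = ∑ T ∈ A, targetDiffExcept T (Φ T) Q A := by
  induction Q generalizing Φ with
  | nil => rfl
  | cons X Q ih =>
    simp only [targetDiff, targetDiffExcept]
    have h (B : Finset (Finset V)) : ∑ T ∈ B, Φ T B - ∑ T ∈ avoiding X B, Φ T (avoiding X B)
        = ∑ T ∈ B, if Disjoint X T then Φ T B - Φ T (avoiding X B) else Φ T B := by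
      rw [avoiding, Finset.sum_filter, ← Finset.sum_sub_distrib]
      refine Finset.sum_congr rfl fun T _ => ?_
      split_ifs <;> simp
    simp only [h]
    rw [ih fun T B => if Disjoint X T then Φ T B - Φ T (avoiding X B) else Φ T B]
    refine Finset.sum_congr rfl fun T _ => ?_
    split_ifs <;> rfl

theorem length_of_mem_residuals {T : Finset V} {Q R : List (Finset V)} (h : R ∈ residuals T Q) :
    R.length + 1 ≤ Q.length := by
  induction Q generalizing R with
  | nil => simp [residuals] at h
  | cons X Q ih =>
    simp only [residuals] at h
    split_ifs at h
    · obtain ⟨R', hR', rfl⟩ := List.mem_map.1 h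
      simpa using ih hR'
    · rcases List.mem_cons.1 h with rfl | h
      · simp
      · have := ih h
        simp; omega

theorem length_residuals_le (T : Finset V) (Q : List (Finset V)) :
    (residuals T Q).length ≤ Q.length := by
  induction Q with
  | nil => simp [residuals]
  | cons X Q ih => simp only [residuals]; split_ifs <;> simp <;> omega

theorem mem_of_mem_residuals {T : Finset V} {Q R : List (Finset V)} (h : R ∈ residuals T Q)
    {X : Finset V} (hX : X ∈ Q) (hd : Disjoint X T) : X ∈ R := by
  induction Q generalizing R with
  | nil => simp [residuals] at h
  | cons Y Q ih =>
    simp only [residuals] at h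
    rcases List.mem_cons.1 hX with rfl | hX
    · rw [if_pos hd] at h
      obtain ⟨R', hR', rfl⟩ := List.mem_map.1 h
      simp
    · split_ifs at h
      · obtain ⟨R', hR', rfl⟩ := List.mem_map.1 h
        exact List.mem_cons_of_mem _ (ih hR' hX)
      · rcases List.mem_cons.1 h with rfl | h
        · exact hX
        · exact ih h hX

end Targets

/-! ### Norms and derivatives of iterated differences. -/

section TargetNorm

variable {V : Type*} [DecidableEq V] {E : Type*} [NormedAddCommGroup E]

/-- Telescoping: the targets met by `T` are restored one at a time. Restoring `X` costs a difference
without `X`, evaluated on `avoiding X A`; hence the residual lists, and the bound uniform over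
subsets of `𝒜`. -/
theorem norm_targetDiffExcept_sub_le (T : Finset V) (F : Finset (Finset V) → E)
    (Q : List (Finset V)) (b : List (Finset V) → ℝ) (𝒜 A : Finset (Finset V)) (hA : A ⊆ 𝒜)
    (h : ∀ R ∈ residuals T Q, ∀ B ⊆ 𝒜, ‖targetDiff F R B‖ ≤ b R) :
    ‖targetDiffExcept T F Q A - targetDiff F Q A‖ ≤ ((residuals T Q).map b).sum := by
  induction Q generalizing F b with
  | nil => simp [targetDiff, targetDiffExcept, residuals]
  | cons X Q ih =>
    simp only [residuals] at h ⊢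
    split_ifs at h ⊢ with hd
    · simp only [targetDiff, targetDiffExcept, if_pos hd, List.map_map]
      exact ih _ (fun R => b (X :: R)) fun R hR B hB => h _ (List.mem_map.2 ⟨R, hR, rfl⟩) B hB
    · rw [targetDiff_cons]
      simp only [targetDiffExcept, if_neg hd, List.map_cons, List.sum_cons]
      have h1 := h Q (by simp) (avoiding X A) ((avoiding_subset X A).trans hA)
      have h2 := ih F b fun R hR B hB => h R (List.mem_cons_of_mem _ hR) B hB
      calc _ = ‖targetDiff F Q (avoiding X A) + (targetDiffExcept T F Q A - targetDiff F Q A)‖ := by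
            congr 1; abel
        _ ≤ _ := (norm_add_le _ _).trans (add_le_add h1 h2)

theorem norm_targetDiff_le (F : Finset (Finset V) → E) (Q : List (Finset V)) (c : ℝ)
    (h : ∀ B, ‖F B‖ ≤ c) (A : Finset (Finset V)) : ‖targetDiff F Q A‖ ≤ 2 ^ Q.length * c := by
  induction Q generalizing F c with
  | nil => simpa [targetDiff] using h A
  | cons X Q ih =>
    simp only [targetDiff, List.length_cons]
    refine (ih _ (2 * c) fun B => ?_).trans_eq (by ring)
    calc _ ≤ ‖F B‖ + ‖F (avoiding X B)‖ := norm_sub_le _ _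
      _ ≤ 2 * c := by linarith [h B, h (avoiding X B)]

theorem hasDerivAt_targetDiff [NormedSpace ℝ E] (F F' : ℝ → Finset (Finset V) → E) (s : ℝ)
    (h : ∀ B, HasDerivAt (fun r => F r B) (F' s B) s) (Q : List (Finset V))
    (A : Finset (Finset V)) :
    HasDerivAt (fun r => targetDiff (F r) Q A) (targetDiff (F' s) Q A) s := by
  induction Q generalizing F F' with
  | nil => exact h A
  | cons X Q ih =>
    exact ih (fun r B => F r B - F r (avoiding X B)) (fun r B => F' r B - F' r (avoiding X B))
      fun B => (h B).fun_sub (h _)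

end TargetNorm

/-! ### Histories connecting the targets to the initial support. -/

section Histories

variable {V : Type*} [DecidableEq V]

/-- The targets that remain after `T`: `T` becomes a target itself unless it meets `S`. -/
def nextTargets (T S : Finset V) (R : List (Finset V)) : List (Finset V) :=
  if Disjoint T S then T :: R else R

/-- The weighted count of `n`-step histories that connect the targets `Q` to the set `S`, each step
using a member `T` of `𝒜` with weight `w T`, and `w₀` weighing what is left at the end. -/
noncomputable def historySum (𝒜 : Finset (Finset V)) (w : Finset V → ℝ) (S : Finset V)
    (w₀ : List (Finset V) → ℝ) : ℕ → List (Finset V) → ℝ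
  | 0, Q => w₀ Q
  | n + 1, Q => ∑ T ∈ 𝒜, w T *
      ((residuals T Q).map fun R => historySum 𝒜 w S w₀ n (nextTargets T S R)).sum

theorem length_nextTargets_le {T S : Finset V} {Q R : List (Finset V)} (h : R ∈ residuals T Q) :
    (nextTargets T S R).length ≤ Q.length := by
  have := length_of_mem_residuals h
  unfold nextTargets
  split_ifs <;> simp <;> omega

theorem historySum_nonneg {𝒜 : Finset (Finset V)} {w : Finset V → ℝ} (hw : ∀ T, 0 ≤ w T)
    {S : Finset V} {w₀ : List (Finset V) → ℝ} (hw₀ : ∀ Q, 0 ≤ w₀ Q) (n : ℕ)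
    (Q : List (Finset V)) : 0 ≤ historySum 𝒜 w S w₀ n Q := by
  induction n generalizing Q with
  | zero => exact hw₀ Q
  | succ n ih =>
    refine Finset.sum_nonneg fun T _ => mul_nonneg (hw T) (List.sum_nonneg ?_)
    simp only [List.mem_map]
    rintro _ ⟨R, -, rfl⟩
    exact ih _

theorem list_sum_map_le_length_mul {β : Type*} (l : List β) (f : β → ℝ) (c : ℝ)
    (h : ∀ x ∈ l, f x ≤ c) : (l.map f).sum ≤ l.length * c := by
  have := List.sum_le_card_nsmul (l.map f) c (by simpa using h)
  simpa using this

/-- At every step there are at most `l` residuals, and the number of targets never grows. The bound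
depends on all of `𝒜`; it only has to make the remainder of the series tend to zero. -/
theorem historySum_le_pow {𝒜 : Finset (Finset V)} {w : Finset V → ℝ} (hw : ∀ T, 0 ≤ w T)
    {S : Finset V} {w₀ : List (Finset V) → ℝ} {c : ℝ} (hc : 0 ≤ c) {l : ℕ}
    (hw₀ : ∀ Q, Q.length ≤ l → w₀ Q ≤ c) (n : ℕ) (Q : List (Finset V)) (hQ : Q.length ≤ l) :
    historySum 𝒜 w S w₀ n Q ≤ (l * ∑ T ∈ 𝒜, w T) ^ n * c := by
  induction n generalizing Q with
  | zero => simpa [historySum] using hw₀ Q hQ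
  | succ n ih =>
    have hM : 0 ≤ (l * ∑ T ∈ 𝒜, w T) ^ n * c :=
      mul_nonneg (pow_nonneg (mul_nonneg l.cast_nonneg (Finset.sum_nonneg fun T _ => hw T)) _) hc
    calc historySum 𝒜 w S w₀ (n + 1) Q
        ≤ ∑ T ∈ 𝒜, w T * (l * ((l * ∑ T ∈ 𝒜, w T) ^ n * c)) := by
          refine Finset.sum_le_sum fun T _ => mul_le_mul_of_nonneg_left ?_ (hw T)
          refine (list_sum_map_le_length_mul _ _ _ fun R hR =>
            ih _ ((length_nextTargets_le hR).trans hQ)).trans ?_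
          have : ((residuals T Q).length : ℝ) ≤ l := by
            exact_mod_cast (length_residuals_le T Q).trans hQ
          gcongr
      _ = _ := by rw [← Finset.sum_mul]; ring

end Histories

/-! ### Lieb–Robinson bound for iterated differences. -/

section LiebRobinson

variable {V : Type*} [DecidableEq V] {𝔄 : Type*} [CStarAlgebra 𝔄]

/-- The evolution of `X` generated by the terms in `A`. -/
noncomputable def truncatedEvolution (G : Finset V → 𝔄) (X : 𝔄) (s : ℝ) (A : Finset (Finset V)) :
    𝔄 :=
  evolve (∑ T ∈ A, G T) s X

/-- Lieb–Robinson bound for iterated differences: the part of the evolved operator that reaches all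
the targets in `Q` is bounded by a sum over histories connecting the targets to the support `S`. -/
theorem norm_targetDiff_truncatedEvolution_le (G : Finset V → 𝔄) (hG : ∀ T, IsSelfAdjoint (G T))
    (𝒜 : Finset (Finset V)) (S : Finset V) (X : 𝔄)
    (hX : ∀ T ∈ 𝒜, Disjoint T S → Commute (G T) X)
    (hGG : ∀ T ∈ 𝒜, ∀ T' ∈ 𝒜, Disjoint T T' → Commute (G T) (G T'))
    (N : ℕ) (Q : List (Finset V)) (A : Finset (Finset V)) (hA : A ⊆ 𝒜) {s : ℝ} (hs : 0 ≤ s) :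
    ‖targetDiff (truncatedEvolution G X s) Q A‖ ≤
      (∑ n ∈ Finset.range N, s ^ n / n.factorial *
          historySum 𝒜 (fun T => 2 * ‖G T‖) S (fun Q => if Q = [] then 1 else 0) n Q +
        s ^ N / N.factorial *
          historySum 𝒜 (fun T => 2 * ‖G T‖) S (fun Q => 2 ^ Q.length) N Q) * ‖X‖ := by
  have hsum (A : Finset (Finset V)) : IsSelfAdjoint (∑ T ∈ A, G T) :=
    isSelfAdjoint_sum _ fun T _ => hG T
  have hF (B : Finset (Finset V)) (s : ℝ) : ‖truncatedEvolution G X s B‖ = ‖X‖ :=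
    norm_evolve (hsum B) s X
  induction N generalizing Q A s with
  | zero =>
    simpa [historySum] using norm_targetDiff_le (truncatedEvolution G X s) Q ‖X‖
      (fun B => (hF B s).le) A
  | succ N ih =>
    set W := historySum 𝒜 (fun T => 2 * ‖G T‖) S (fun Q => if Q = [] then 1 else 0) with hW
    set W' := historySum 𝒜 (fun T => 2 * ‖G T‖) S (fun Q => 2 ^ Q.length) with hW'
    -- The first summand is a commutator with the whole generator and does not change norms. In the
    -- second, the contribution of `T` vanishes unless `T` meets a target.
    have hderiv (s : ℝ) : HasDerivAt (fun r => targetDiff (truncatedEvolution G X r) Q A)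
        (adjointAction (∑ T ∈ A, G T) (targetDiff (truncatedEvolution G X s) Q A) +
          ∑ T ∈ A, adjointAction (G T) (targetDiffExcept T (truncatedEvolution G X s) Q A
            - targetDiff (truncatedEvolution G X s) Q A)) s := by
      refine (hasDerivAt_targetDiff (truncatedEvolution G X)
        (fun r B => ∑ T ∈ B, adjointAction (G T) (truncatedEvolution G X r B)) s (fun B => ?_)
        Q A).congr_deriv ?_
      · rw [← adjointAction_sum]
        exact hasDerivAt_evolve _ _ _
      · rw [targetDiff_sum fun T B => adjointAction (G T) (truncatedEvolution G X s B),
          adjointAction_sum, ← Finset.sum_add_distrib]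
        refine Finset.sum_congr rfl fun T _ => ?_
        rw [adjointAction_sub, targetDiffExcept_map _ (adjointAction_sub (G T))]
        abel
    have hres (s : ℝ) (hs : 0 ≤ s) (T : Finset V) (hT : T ∈ A) :
        ‖adjointAction (G T) (targetDiffExcept T (truncatedEvolution G X s) Q A
            - targetDiff (truncatedEvolution G X s) Q A)‖ ≤
          ((residuals T Q).map fun R => 2 * ‖G T‖ *
            ((∑ n ∈ Finset.range N, s ^ n / n.factorial * W n (nextTargets T S R) +
              s ^ N / N.factorial * W' N (nextTargets T S R)) * ‖X‖)).sum := by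
      rw [adjointAction_sub, ← targetDiffExcept_map _ (adjointAction_sub (G T)),
        ← targetDiff_map _ (adjointAction_sub (G T))]
      refine norm_targetDiffExcept_sub_le T _ Q _ 𝒜 A hA fun R _ B hB => ?_
      -- If `T` is disjoint from `S`, every evolution generated by terms avoiding `T` commutes with
      -- `G T`. The subtracted part of the difference over `T` is then killed by the commutator, so
      -- `T` becomes a target at no cost.
      have hcomm : targetDiff (fun B => adjointAction (G T) (truncatedEvolution G X s B)) R B =
          adjointAction (G T) (targetDiff (truncatedEvolution G X s) (nextTargets T S R) B) := by
        rw [nextTargets]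
        split_ifs with hd
        · rw [← targetDiff_map _ (adjointAction_sub (G T)), targetDiff_cons, eq_comm, sub_eq_self]
          refine targetDiff_eq_zero _ _ _ fun C hC => adjointAction_eq_zero ?_
          refine commute_evolve (Commute.sum_right _ _ _ fun T' hT' => ?_) (hX T (hA hT) hd) _
          have hT'' := Finset.mem_filter.1 (hC hT')
          exact hGG T (hA hT) T' (hB hT''.1) hT''.2
        · rw [targetDiff_map _ (adjointAction_sub (G T))]
      rw [hcomm]
      exact (norm_adjointAction_le _ _).trans (mul_le_mul_of_nonneg_left
        (ih _ B hB hs) (by positivity))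
    -- `B'` is the derivative of `B`: the step count is shifted by one, and the zero-step term,
    -- constant in `s`, drops out.
    let B : ℝ → ℝ := fun s => (∑ n ∈ Finset.range (N + 1), s ^ n / n.factorial * W n Q +
      s ^ (N + 1) / (N + 1).factorial * W' (N + 1) Q) * ‖X‖
    let B' : ℝ → ℝ := fun s => (∑ n ∈ Finset.range N, s ^ n / n.factorial * W (n + 1) Q +
      s ^ N / N.factorial * W' (N + 1) Q) * ‖X‖
    have hpow (n : ℕ) (c s : ℝ) :
        HasDerivAt (fun s : ℝ => s ^ (n + 1) / (n + 1).factorial * c) (s ^ n / n.factorial * c) s := by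
      refine (((hasDerivAt_pow (n + 1) s).div_const _).mul_const c).congr_deriv ?_
      have : (n.factorial : ℝ) ≠ 0 := by positivity
      rw [Nat.factorial_succ]
      push_cast
      field_simp
    have hB (s : ℝ) : HasDerivAt B (B' s) s := by
      refine HasDerivAt.mul_const ?_ _
      refine HasDerivAt.add ?_ (hpow N _ s)
      simp only [Finset.sum_range_succ']
      simpa using (HasDerivAt.fun_sum (u := Finset.range N) fun n _ => hpow n (W (n + 1) Q) s)
    refine norm_le_of_hasDerivAt_adjointAction (hsum A) hderiv (B := B) (B' := B') ?_ hB
      (fun s hs => ?_) hs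
    · have h0 : B 0 = W 0 Q * ‖X‖ := by
        simp [B, Finset.sum_range_succ']
      rw [h0]
      rcases Q with _ | ⟨Y, Q⟩
      · simp [targetDiff, hF, hW, historySum]
      · rw [targetDiff_cons]
        -- At time zero the evolution does not depend on the generating terms, so differences over a
        -- nonempty list vanish.
        have hev (Q : List (Finset V)) (A A' : Finset (Finset V)) :
            targetDiff (truncatedEvolution G X 0) Q A = targetDiff (truncatedEvolution G X 0) Q A' := by
          induction Q generalizing A A' with
          | nil => simp [targetDiff, truncatedEvolution]
          | cons Z Q ih => rw [targetDiff_cons, targetDiff_cons, ih A A', ih (avoiding Z A) (avoiding Z A')]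
        rw [hev Q A (avoiding Y A)]
        simp [hW, historySum]
    · calc _ ≤ ∑ T ∈ A, ‖adjointAction (G T) (targetDiffExcept T (truncatedEvolution G X s) Q A
            - targetDiff (truncatedEvolution G X s) Q A)‖ := norm_sum_le _ _
        _ ≤ ∑ T ∈ A, ((residuals T Q).map fun R => 2 * ‖G T‖ *
            ((∑ n ∈ Finset.range N, s ^ n / n.factorial * W n (nextTargets T S R) +
              s ^ N / N.factorial * W' N (nextTargets T S R)) * ‖X‖)).sum :=
            Finset.sum_le_sum fun T hT => hres s hs T hT
        _ ≤ ∑ T ∈ 𝒜, ((residuals T Q).map fun R => 2 * ‖G T‖ *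
            ((∑ n ∈ Finset.range N, s ^ n / n.factorial * W n (nextTargets T S R) +
              s ^ N / N.factorial * W' N (nextTargets T S R)) * ‖X‖)).sum := by
            refine Finset.sum_le_sum_of_subset_of_nonneg hA fun T _ _ => List.sum_nonneg ?_
            simp only [List.mem_map]
            rintro _ ⟨R, -, rfl⟩
            have hw (T : Finset V) : 0 ≤ 2 * ‖G T‖ := by positivity
            have h1 (n : ℕ) (Q : List (Finset V)) : 0 ≤ W n Q :=
              historySum_nonneg hw (fun Q => by split_ifs <;> norm_num) n Q
            have h2 (n : ℕ) (Q : List (Finset V)) : 0 ≤ W' n Q :=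
              historySum_nonneg hw (fun Q => by positivity) n Q
            have h3 := fun n => h1 n (nextTargets T S R)
            have h4 := h2 N (nextTargets T S R)
            have h5 : 0 ≤ ∑ n ∈ Finset.range N, s ^ n / n.factorial * W n (nextTargets T S R) :=
              Finset.sum_nonneg fun n _ => mul_nonneg (by positivity) (h3 n)
            positivity
        _ = B' s := by
            have hlist (T : Finset V) : ((residuals T Q).map fun R => 2 * ‖G T‖ *
                ((∑ n ∈ Finset.range N, s ^ n / n.factorial * W n (nextTargets T S R) +
                  s ^ N / N.factorial * W' N (nextTargets T S R)) * ‖X‖)).sum =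
                (∑ n ∈ Finset.range N, s ^ n / n.factorial * (2 * ‖G T‖ *
                  ((residuals T Q).map fun R => W n (nextTargets T S R)).sum) +
                 s ^ N / N.factorial * (2 * ‖G T‖ *
                  ((residuals T Q).map fun R => W' N (nextTargets T S R)).sum)) * ‖X‖ := by
              induction residuals T Q with
              | nil => simp
              | cons R l ihl =>
                simp only [List.map_cons, List.sum_cons, ihl, mul_add, Finset.sum_add_distrib]
                simp only [add_mul, mul_add, Finset.sum_mul, Finset.mul_sum]
                have e (n : ℕ) : 2 * ‖G T‖ * (s ^ n / n.factorial * W n (nextTargets T S R) * ‖X‖) =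
                    s ^ n / n.factorial * (2 * ‖G T‖ * W n (nextTargets T S R)) * ‖X‖ := by ring
                simp only [e]
                ring
            simp only [hlist, ← Finset.sum_mul, Finset.sum_add_distrib, B']
            rw [Finset.sum_comm]
            simp only [← Finset.mul_sum]
            rfl

end LiebRobinson

/-! ### Distributing the weight over a history, and summing over histories. -/

section HistoryBounds

variable {V : Type*} [DecidableEq V]

theorem add_rpow_le_rpow_add_rpow {α : ℝ} (hα0 : 0 < α) (hα1 : α ≤ 1) (m n : ℕ) :
    ((m + n : ℕ) : ℝ) ^ α ≤ (m : ℝ) ^ α + (n : ℝ) ^ α := by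
  have := NNReal.rpow_add_le_add_rpow (m : NNReal) (n : NNReal) hα0.le hα1
  have h2 : (((m : NNReal) + n) ^ α : NNReal) ≤ (m : NNReal) ^ α + (n : NNReal) ^ α := this
  have h3 := NNReal.coe_le_coe.2 h2
  push_cast at h3 ⊢
  exact h3

/-- The diameter that a history has to bridge is shared out among its members. -/
theorem exp_mul_historySum_le {P : Finset V → Prop} {diam : Finset V → ℕ}
    {𝒜 : Finset (Finset V)}
    (hjoin : ∀ J T, P J → T ∈ 𝒜 → ¬ Disjoint T J →
      ∃ J', P J' ∧ J ⊆ J' ∧ T ⊆ J' ∧ diam J' ≤ diam J + diam T)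
    {α κ : ℝ} (hα0 : 0 < α) (hα1 : α ≤ 1) (hκ : 0 ≤ κ) {w : Finset V → ℝ} (hw : ∀ T, 0 ≤ w T)
    {S : Finset V} (hS : P S) (n : ℕ) (Q : List (Finset V)) (M : ℕ)
    (hM : ∀ J, P J → S ⊆ J → (∀ X ∈ Q, ¬ Disjoint X J) → M ≤ diam J) :
    Real.exp (κ * (M : ℝ) ^ α) * historySum 𝒜 w S (fun Q => if Q = [] then 1 else 0) n Q ≤
      Real.exp (κ * (diam S : ℝ) ^ α) *
        historySum 𝒜 (fun T => w T * Real.exp (κ * (diam T : ℝ) ^ α)) S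
          (fun Q => if Q = [] then 1 else 0) n Q := by
  induction n generalizing Q M with
  | zero =>
    simp only [historySum]
    split_ifs with h
    · subst h
      have := hM S hS subset_rfl (by simp)
      gcongr
    · simp
  | succ n ih =>
    simp only [historySum, Finset.mul_sum]
    refine Finset.sum_le_sum fun T hT => ?_
    have key : ∀ R ∈ residuals T Q, Real.exp (κ * (M : ℝ) ^ α) *
        historySum 𝒜 w S (fun Q => if Q = [] then 1 else 0) n (nextTargets T S R) ≤
        Real.exp (κ * (diam T : ℝ) ^ α) * (Real.exp (κ * (diam S : ℝ) ^ α) *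
        historySum 𝒜 (fun T => w T * Real.exp (κ * (diam T : ℝ) ^ α)) S
          (fun Q => if Q = [] then 1 else 0) n (nextTargets T S R)) := by
      intro R hR
      -- A set `J` serving the new targets meets `T`, either as a target or through `S`. Its join
      -- with `T` serves the old targets at an extra cost of `diam T`. Truncated subtraction covers
      -- `M < diam T`.
      have h1 := ih (nextTargets T S R) (M - diam T) fun J hJ hSJ hJR => by
        have hTJ : ¬ Disjoint T J := by
          by_cases hd : Disjoint T S
          · exact hJR T (by simp [nextTargets, hd])
          · exact fun h => hd (h.mono_right hSJ)
        obtain ⟨J', hJ', hsub, hTJ', hdiam⟩ := hjoin J T hJ hT hTJ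
        have := hM J' hJ' (hSJ.trans hsub) fun X hX => by
          by_cases hd : Disjoint X T
          · have hXR := mem_of_mem_residuals hR hX hd
            have : X ∈ nextTargets T S R := by
              unfold nextTargets; split_ifs <;> simp [hXR]
            exact fun h => hJR X this (h.mono_right hsub)
          · exact fun h => hd (h.mono_right hTJ')
        omega
      -- The subadditivity of `x ^ α` enters here.
      have h2 : Real.exp (κ * (M : ℝ) ^ α) ≤
          Real.exp (κ * (diam T : ℝ) ^ α) * Real.exp (κ * ((M - diam T : ℕ) : ℝ) ^ α) := by
        rw [← Real.exp_add, ← mul_add]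
        have h3 := add_rpow_le_rpow_add_rpow hα0 hα1 (diam T) (M - diam T)
        have h4 : (M : ℝ) ≤ ((diam T + (M - diam T) : ℕ) : ℝ) := by exact_mod_cast (by omega)
        have h5 := Real.rpow_le_rpow (by positivity) h4 hα0.le
        gcongr
        exact h5.trans h3
      have h0 : 0 ≤ historySum 𝒜 w S (fun Q => if Q = [] then 1 else 0) n (nextTargets T S R) :=
        historySum_nonneg hw (fun Q => by split_ifs <;> norm_num) _ _
      calc _ ≤ Real.exp (κ * (diam T : ℝ) ^ α) * Real.exp (κ * ((M - diam T : ℕ) : ℝ) ^ α) *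
            historySum 𝒜 w S (fun Q => if Q = [] then 1 else 0) n (nextTargets T S R) := by gcongr
        _ ≤ _ := by rw [mul_assoc]; gcongr
    have hlist : Real.exp (κ * (M : ℝ) ^ α) * ((residuals T Q).map fun R =>
        historySum 𝒜 w S (fun Q => if Q = [] then 1 else 0) n (nextTargets T S R)).sum ≤
        Real.exp (κ * (diam T : ℝ) ^ α) * (Real.exp (κ * (diam S : ℝ) ^ α) *
        ((residuals T Q).map fun R =>
          historySum 𝒜 (fun T => w T * Real.exp (κ * (diam T : ℝ) ^ α)) S
          (fun Q => if Q = [] then 1 else 0) n (nextTargets T S R)).sum) := by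
      simp only [← List.sum_map_mul_left]
      exact List.sum_le_sum key
    calc _ = w T * (Real.exp (κ * (M : ℝ) ^ α) * ((residuals T Q).map fun R =>
        historySum 𝒜 w S (fun Q => if Q = [] then 1 else 0) n (nextTargets T S R)).sum) := by ring
      _ ≤ _ := mul_le_mul_of_nonneg_left hlist (hw T)
      _ = _ := by ring

/-- Union bound over the points of `X`. -/
theorem sum_not_disjoint_le (𝒜 : Finset (Finset V)) (v : Finset V → ℝ) (hv : ∀ T, 0 ≤ v T)
    (X : Finset V) (u : ℝ) (hu : ∀ x ∈ X, ∑ T ∈ 𝒜 with x ∈ T, v T ≤ u) :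
    ∑ T ∈ 𝒜 with ¬ Disjoint X T, v T ≤ X.card * u := by
  calc ∑ T ∈ 𝒜 with ¬ Disjoint X T, v T
      ≤ ∑ T ∈ 𝒜, ∑ x ∈ X, if x ∈ T then v T else 0 := by
        rw [Finset.sum_filter]
        refine Finset.sum_le_sum fun T _ => ?_
        have h0 (x : V) : 0 ≤ if x ∈ T then v T else 0 := by split_ifs; exacts [hv T, le_rfl]
        by_cases h : Disjoint X T
        · simpa [h] using Finset.sum_nonneg fun x (_ : x ∈ X) => h0 x
        · obtain ⟨x, hx, hxT⟩ := Finset.not_disjoint_iff.1 h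
          rw [if_pos h]
          refine le_trans ?_ (Finset.single_le_sum (f := fun x => if x ∈ T then v T else 0)
            (fun x _ => h0 x) hx)
          simp [hxT]
    _ = ∑ x ∈ X, ∑ T ∈ 𝒜 with x ∈ T, v T := by
        rw [Finset.sum_comm]; simp only [Finset.sum_filter]
    _ ≤ ∑ x ∈ X, u := Finset.sum_le_sum hu
    _ = _ := by simp

/-- Each residual drops a target `X` met by `T`. Summing `v` over such `T` costs at most `k * c X`,
which restores the factor missing from the product. Further dropped targets only help, as `c ≥ 1`.
-/
theorem sum_mul_residuals_le (𝒜 : Finset (Finset V)) (v c : Finset V → ℝ) (hv : ∀ T, 0 ≤ v T)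
    (hc : ∀ X, 1 ≤ c X) (k : ℝ)
    (hk : ∀ X, ∑ T ∈ 𝒜 with ¬ Disjoint X T, v T ≤ k * c X) (Q : List (Finset V)) :
    ∑ T ∈ 𝒜, v T * ((residuals T Q).map fun R => (R.map c).prod).sum ≤
      Q.length * k * (Q.map c).prod := by
  have hprod (Q : List (Finset V)) : 0 ≤ (Q.map c).prod := by
    refine List.prod_nonneg ?_
    simp only [List.mem_map]
    rintro _ ⟨X, -, rfl⟩
    linarith [hc X]
  have hsum (T : Finset V) (Q : List (Finset V)) :
      0 ≤ ((residuals T Q).map fun R => (R.map c).prod).sum := by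
    refine List.sum_nonneg ?_
    simp only [List.mem_map]
    rintro _ ⟨R, -, rfl⟩
    exact hprod R
  induction Q with
  | nil => simp [residuals]
  | cons X Q ih =>
    have hX : 0 ≤ c X := by linarith [hc X]
    calc _ ≤ ∑ T ∈ 𝒜, ((if ¬ Disjoint X T then v T else 0) * (Q.map c).prod +
          c X * (v T * ((residuals T Q).map fun R => (R.map c).prod).sum)) := by
          refine Finset.sum_le_sum fun T _ => ?_
          simp only [residuals]
          by_cases hd : Disjoint X T
          · simp only [hd, if_true, not_true, if_false, List.map_map, Function.comp_def,
              List.map_cons, List.prod_cons, List.sum_map_mul_left]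
            linarith
          · simp only [hd, if_false, not_false_iff, if_true, List.map_cons, List.sum_cons]
            have := mul_le_mul_of_nonneg_right (hc X) (mul_nonneg (hv T) (hsum T Q))
            linarith
      _ ≤ k * c X * (Q.map c).prod + c X * (Q.length * k * (Q.map c).prod) := by
          rw [Finset.sum_add_distrib, ← Finset.sum_mul, ← Finset.mul_sum, ← Finset.sum_filter]
          exact add_le_add (mul_le_mul_of_nonneg_right (hk X) (hprod Q))
            (mul_le_mul_of_nonneg_left ih hX)
      _ = _ := by simp; ring

/-- Bound for the total weight of all histories ending in some `S`, summed from the targets inwards.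
The parameter `F` decides whether a large target is paid for by the number of targets or by the
number of steps. -/
theorem sum_mul_historySum_le (𝒜 𝒮 : Finset (Finset V)) (w o : Finset V → ℝ)
    (hw : ∀ T, 0 ≤ w T) (ho : ∀ S, 0 ≤ o S) {F u b : ℝ} (hF : 1 ≤ F) (hb : 0 ≤ b)
    (hT : ∀ T ∈ 𝒜, T.Nonempty)
    (hu : ∀ x, ∑ T ∈ 𝒜 with x ∈ T, w T * T.card ≤ u) (hu0 : 0 ≤ u)
    (hob : ∀ x, ∑ S ∈ 𝒮 with x ∈ S, o S ≤ b) {l : ℕ} (n : ℕ) (Q : List (Finset V))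
    (hQ : Q.length ≤ l) :
    ∑ S ∈ 𝒮, o S * historySum 𝒜 w S (fun Q => if Q = [] then 1 else 0) (n + 1) Q ≤
      b * (2 * l * F * u) ^ (n + 1) * (Q.map fun X : Finset V => max 1 (X.card / F)).prod := by
  set c : Finset V → ℝ := fun X => max 1 (X.card / F) with hcdef
  have hc (X : Finset V) : 1 ≤ c X := le_max_left _ _
  have hprod1 (Q : List (Finset V)) : 1 ≤ (Q.map c).prod := by
    induction Q with
    | nil => simp
    | cons X Q ih => simpa using one_le_mul_of_one_le_of_one_le (hc X) ih
  have hk (X : Finset V) :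
      ∑ T ∈ 𝒜 with ¬ Disjoint X T, 2 * (w T * T.card) ≤ 2 * F * u * c X := by
    have h1 := sum_not_disjoint_le 𝒜 (fun T => w T * T.card)
      (fun T => mul_nonneg (hw T) (Nat.cast_nonneg _)) X u (fun x _ => hu x)
    have h2 : (X.card : ℝ) ≤ F * c X := by
      have := le_max_right (1 : ℝ) (X.card / F)
      rw [div_le_iff₀ (by linarith)] at this
      linarith
    rw [← Finset.mul_sum]
    nlinarith
  -- The price of a new target `T` is at most its cardinality, which explains the factor `T.card` in
  -- `u`.
  have hcard (T : Finset V) (h : T ∈ 𝒜) : c T ≤ T.card := by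
    have h1 : (1 : ℝ) ≤ T.card := by exact_mod_cast (hT T h).card_pos
    exact max_le h1 (div_le_self (by linarith) hF)
  have swap (n : ℕ) (Q : List (Finset V)) :
      ∑ S ∈ 𝒮, o S * historySum 𝒜 w S (fun Q => if Q = [] then 1 else 0) (n + 1) Q =
      ∑ T ∈ 𝒜, w T * ((residuals T Q).map fun R => ∑ S ∈ 𝒮, o S *
        historySum 𝒜 w S (fun Q => if Q = [] then 1 else 0) n (nextTargets T S R)).sum := by
    simp only [historySum, Finset.mul_sum]
    rw [Finset.sum_comm]
    refine Finset.sum_congr rfl fun T _ => ?_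
    induction residuals T Q with
    | nil => simp
    | cons R l ih =>
      simp only [List.map_cons, List.sum_cons, mul_add, Finset.sum_add_distrib, ih, Finset.mul_sum]
      congr 1
      exact Finset.sum_congr rfl fun S _ => by ring
  have finish (K : ℝ) (hK : 0 ≤ K) (n : ℕ) (Q : List (Finset V)) (hQ : Q.length ≤ l)
      (h : ∀ T ∈ 𝒜, ∀ R ∈ residuals T Q, ∑ S ∈ 𝒮, o S *
        historySum 𝒜 w S (fun Q => if Q = [] then 1 else 0) n (nextTargets T S R) ≤
          2 * T.card * (K * (R.map c).prod)) :
      ∑ S ∈ 𝒮, o S * historySum 𝒜 w S (fun Q => if Q = [] then 1 else 0) (n + 1) Q ≤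
        K * (2 * l * F * u) * (Q.map c).prod := by
    rw [swap]
    calc _ ≤ ∑ T ∈ 𝒜, w T * ((residuals T Q).map fun R => 2 * T.card * (K * (R.map c).prod)).sum :=
          Finset.sum_le_sum fun T hT => mul_le_mul_of_nonneg_left (List.sum_le_sum (h T hT)) (hw T)
      _ = K * ∑ T ∈ 𝒜, 2 * (w T * T.card) * ((residuals T Q).map fun R => (R.map c).prod).sum := by
          simp only [List.sum_map_mul_left, Finset.mul_sum]
          exact Finset.sum_congr rfl fun T _ => by ring
      _ ≤ K * (Q.length * (2 * F * u) * (Q.map c).prod) :=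
          mul_le_mul_of_nonneg_left (sum_mul_residuals_le 𝒜 _ c
            (fun T => mul_nonneg two_pos.le (mul_nonneg (hw T) (Nat.cast_nonneg _))) hc _ hk Q) hK
      _ ≤ K * (l * (2 * F * u) * (Q.map c).prod) := by
          have h1 : (Q.length : ℝ) ≤ l := by exact_mod_cast hQ
          have h2 := hprod1 Q
          gcongr
      _ = _ := by ring
  induction n generalizing Q with
  | zero =>
    rw [zero_add, pow_one]
    refine finish b hb 0 Q hQ fun T hT R hR => ?_
    have h1 : ∑ S ∈ 𝒮, o S *
        historySum 𝒜 w S (fun Q => if Q = [] then 1 else 0) 0 (nextTargets T S R) ≤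
        ∑ S ∈ 𝒮 with ¬ Disjoint T S, o S := by
      rw [Finset.sum_filter]
      refine Finset.sum_le_sum fun S _ => ?_
      simp only [historySum, nextTargets]
      by_cases hd : Disjoint T S
      · simp [hd]
      · simp only [hd, if_false, not_false_iff, if_true]
        split_ifs <;> simp [ho S]
    have h2 := sum_not_disjoint_le 𝒮 o ho T b (fun x _ => hob x)
    have h3 : 0 ≤ T.card * b := by positivity
    nlinarith [hprod1 R]
  | succ n ih =>
    rw [pow_succ, ← mul_assoc]
    have hK : 0 ≤ b * (2 * l * F * u) ^ (n + 1) := by positivity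
    refine finish _ hK (n + 1) Q hQ fun T hT R hR => ?_
    have hlen := length_of_mem_residuals hR
    -- Whether `T` becomes a target depends on the `S` being summed over, so both cases are added.
    -- Their prices satisfy `1 + T.card ≤ 2 * T.card`, which produces the `2` in the base of the
    -- power.
    have h1 := ih R (by omega)
    have h2 := ih (T :: R) (by simp; omega)
    calc _ ≤ ∑ S ∈ 𝒮, (o S * historySum 𝒜 w S (fun Q => if Q = [] then 1 else 0) (n + 1) R +
          o S * historySum 𝒜 w S (fun Q => if Q = [] then 1 else 0) (n + 1) (T :: R)) := by
          refine Finset.sum_le_sum fun S _ => ?_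
          have hn (Q : List (Finset V)) :
              0 ≤ o S * historySum 𝒜 w S (fun Q => if Q = [] then 1 else 0) (n + 1) Q :=
            mul_nonneg (ho S) (historySum_nonneg hw (fun Q => by split_ifs <;> norm_num) _ _)
          unfold nextTargets
          split_ifs
          · linarith [hn R]
          · linarith [hn (T :: R)]
      _ ≤ _ := by
          rw [Finset.sum_add_distrib]
          refine (add_le_add h1 h2).trans ?_
          rw [List.map_cons, List.prod_cons]
          have h3 := hcard T hT
          have h4 : (1 : ℝ) ≤ T.card := (hc T).trans h3
          have h5 : 0 ≤ b * (2 * l * F * u) ^ (n + 1) * (R.map c).prod :=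
            mul_nonneg hK (zero_le_one.trans (hprod1 R))
          nlinarith

/-- The residual obtained by dropping `X` keeps all later targets. The empty list can therefore
occur only for the last target, so at most once, and only if `T` meets all of them. -/
theorem historySum_one_le (𝒜 : Finset (Finset V)) (w : Finset V → ℝ) (hw : ∀ T, 0 ≤ w T)
    (S : Finset V) (Q : List (Finset V)) :
    historySum 𝒜 w S (fun Q => if Q = [] then 1 else 0) 1 Q ≤
      ∑ T ∈ 𝒜 with ¬ Disjoint T S ∧ ∀ X ∈ Q, ¬ Disjoint X T, w T := by
  have key (T : Finset V) (Q : List (Finset V)) :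
      ((residuals T Q).map fun R => if R = [] then (1 : ℝ) else 0).sum ≤
        if ∀ X ∈ Q, ¬ Disjoint X T then 1 else 0 := by
    induction Q with
    | nil => simp [residuals]
    | cons X Q ih =>
      simp only [residuals]
      by_cases hd : Disjoint X T
      · simp [hd, Function.comp_def]
      · rcases Q with _ | ⟨Y, Q⟩
        · simp [hd, residuals]
        · simpa [hd] using ih
  rw [Finset.sum_filter]
  simp only [historySum]
  refine Finset.sum_le_sum fun T _ => ?_
  by_cases hd : Disjoint T S
  · simp [nextTargets, hd]
  · simp only [nextTargets, hd, if_false, not_false_iff, true_and]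
    refine (mul_le_mul_of_nonneg_left (key T Q) (hw T)).trans ?_
    split_ifs <;> simp

end HistoryBounds

/-! ### Telescoping of mixed differences over a box in `ℤ ^ ι`. -/

section Mobius

variable {ι : Type*} [Fintype ι] [DecidableEq ι] {E : Type*} [AddCommGroup E]

/-- The iterated backward difference over the coordinates in the list, cut off at `a`. -/
def boxDiff (a : ι → ℤ) : List ι → ((ι → ℤ) → E) → (ι → ℤ) → E
  | [], f, b => f b
  | p :: ps, f, b =>
    boxDiff a ps f b - if b p < a p then boxDiff a ps f (b + Pi.single p 1) else 0

/-- Induction over the directions: the sum over `b p` telescopes to its value at `lo p`. The set `P`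
collects the coordinates already frozen at `lo`. -/
theorem sum_boxDiff_aux (lo a : ι → ℤ) (f : (ι → ℤ) → E) (ps : List ι)
    (hps : ps.Nodup) (P : Finset ι) (hP : ∀ p ∈ ps, p ∉ P) :
    ∑ b ∈ Finset.Icc lo a with ∀ q ∈ P, b q = lo q, boxDiff a ps f b =
      ∑ b ∈ Finset.Icc lo a with ∀ q, q ∈ P ∨ q ∈ ps → b q = lo q, f b := by
  induction ps generalizing P with
  | nil => simp [boxDiff]
  | cons p ps ih =>
    obtain ⟨hp, hps⟩ := List.nodup_cons.1 hps
    have hpP : p ∉ P := hP p (by simp)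
    have hshift : ∑ b ∈ (Finset.Icc lo a).filter (fun b => ∀ q ∈ P, b q = lo q) with b p < a p,
        boxDiff a ps f (b + Pi.single p 1) =
        ∑ b ∈ (Finset.Icc lo a).filter (fun b => ∀ q ∈ P, b q = lo q) with ¬ b p = lo p,
          boxDiff a ps f b := by
      refine Finset.sum_bij' (fun b _ => b + Pi.single p 1) (fun b _ => b - Pi.single p 1)
        ?_ ?_ (by simp) (by simp) (by simp)
      · intro b hb
        simp only [Finset.mem_filter, Finset.mem_Icc] at hb ⊢
        obtain ⟨⟨⟨h1, h2⟩, h3⟩, h4⟩ := hb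
        refine ⟨⟨⟨h1.trans (by simp [Pi.single_nonneg]), fun q => ?_⟩, fun q hq => ?_⟩, ?_⟩
        · by_cases hq : q = p
          · subst hq; simp; omega
          · simpa [hq] using h2 q
        · have : q ≠ p := fun h => hpP (h ▸ hq)
          simpa [this] using h3 q hq
        · have : lo p ≤ b p := h1 p
          simp; omega
      · intro b hb
        simp only [Finset.mem_filter, Finset.mem_Icc] at hb ⊢
        obtain ⟨⟨⟨h1, h2⟩, h3⟩, h4⟩ := hb
        refine ⟨⟨⟨fun q => ?_, (sub_le_self b (by simp [Pi.single_nonneg])).trans h2⟩,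
          fun q hq => ?_⟩, ?_⟩
        · by_cases hq : q = p
          · subst hq; have : lo q ≤ b q := h1 q; simp; omega
          · simpa [hq] using h1 q
        · have : q ≠ p := fun h => hpP (h ▸ hq)
          simpa [this] using h3 q hq
        · have := h2 p
          simp; omega
    have hsplit := Finset.sum_filter_add_sum_filter_not
      ((Finset.Icc lo a).filter (fun b => ∀ q ∈ P, b q = lo q)) (fun b => b p = lo p)
      (fun b => boxDiff a ps f b)
    simp only [boxDiff, Finset.sum_sub_distrib]
    rw [← Finset.sum_filter, hshift, ← hsplit, add_sub_cancel_right, Finset.filter_filter]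
    have := ih hps (insert p P) (fun r hr => by
      simp only [Finset.mem_insert, not_or]
      exact ⟨fun h => hp (h ▸ hr), hP r (by simp [hr])⟩)
    rw [Finset.filter_congr (q := fun b => ∀ q ∈ insert p P, b q = lo q)
      (fun b _ => by rw [Finset.forall_mem_insert, and_comm]), this]
    refine Finset.sum_congr (Finset.filter_congr fun b _ => forall_congr' fun q => ?_) fun _ _ => rfl
    simp only [Finset.mem_insert, List.mem_cons]
    tauto

theorem sum_boxDiff (lo a : ι → ℤ) (hlo : lo ≤ a) (f : (ι → ℤ) → E) (ps : List ι)
    (hps : ps.Nodup) (hmem : ∀ p, p ∈ ps) :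
    ∑ b ∈ Finset.Icc lo a, boxDiff a ps f b = f lo := by
  have h := sum_boxDiff_aux lo a f ps hps ∅ (by simp)
  simp only [Finset.notMem_empty, false_or, false_implies, implies_true, Finset.filter_true,
    hmem, true_implies] at h
  rw [h, Finset.sum_eq_single lo]
  · intro b hb hne
    exact absurd (funext (Finset.mem_filter.1 hb).2) hne
  · simp [hlo]

end Mobius

/-! ### Simplices, their corners, faces and joins. -/

section Geometry

variable {d : ℕ}

/-- The lower bounds `a` of a simplex `{n | ∀ p, a p ≤ n p}`. -/
noncomputable def corner (S : Finset (SimplicialLattice d)) : Fin (d + 1) → ℤ :=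
  open Classical in if h : IsSimplex S then h.choose else 0

theorem sum_corner_neg {S : Finset (SimplicialLattice d)} (h : IsSimplex S) :
    ∑ p, corner S p < 0 := by
  rw [corner, dif_pos h]; exact h.choose_spec.1

theorem mem_iff_corner_le {S : Finset (SimplicialLattice d)} (h : IsSimplex S)
    {x : SimplicialLattice d} : x ∈ S ↔ ∀ p, corner S p ≤ x.1 p := by
  rw [corner, dif_pos h]; exact h.choose_spec.2 x

theorem exists_apply_eq_add (a : Fin (d + 1) → ℤ) (r : Fin (d + 1)) :
    ∃ x : SimplicialLattice d, ∀ p, x.1 p = a p + if p = r then - ∑ q, a q else 0 :=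
  ⟨⟨fun p => a p + if p = r then - ∑ q, a q else 0, by simp [Finset.sum_add_distrib]⟩,
    fun _ => rfl⟩

theorem exists_lattice_point_apply_eq (hd : 1 ≤ d) (a : Fin (d + 1) → ℤ) (ha : ∑ q, a q ≤ 0) (p : Fin (d + 1)) :
    ∃ x : SimplicialLattice d, (∀ q, a q ≤ x.1 q) ∧ x.1 p = a p := by
  have : Nontrivial (Fin (d + 1)) := Fin.nontrivial_iff_two_le.2 (by omega)
  obtain ⟨r, hr⟩ := exists_ne p
  obtain ⟨x, hx⟩ := exists_apply_eq_add a r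
  refine ⟨x, fun q => ?_, by simp [hx, hr.symm]⟩
  rw [hx]; split_ifs <;> omega

/-- Every lower bound of a nonempty simplex is attained, so inclusions can be read off from the
bounds. This needs `d ≥ 1`: for `d = 0` all nonpositive bounds describe the same single point. -/
theorem le_of_forall_le_imp (hd : 1 ≤ d) {a a' : Fin (d + 1) → ℤ} (ha : ∑ q, a q ≤ 0)
    (h : ∀ x : SimplicialLattice d, (∀ q, a q ≤ x.1 q) → ∀ q, a' q ≤ x.1 q) : a' ≤ a := by
  intro p
  obtain ⟨x, hx, hxp⟩ := exists_lattice_point_apply_eq hd a ha p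
  exact hxp ▸ h x hx p

theorem corner_le_corner (hd : 1 ≤ d) {S T : Finset (SimplicialLattice d)} (hS : IsSimplex S)
    (hT : IsSimplex T) (h : T ⊆ S) : corner S ≤ corner T :=
  le_of_forall_le_imp hd (sum_corner_neg hT).le fun _ hx =>
    (mem_iff_corner_le hS).1 (h ((mem_iff_corner_le hT).2 hx))

theorem corner_eq (hd : 1 ≤ d) {S : Finset (SimplicialLattice d)} {a : Fin (d + 1) → ℤ}
    (ha : ∑ p, a p < 0) (h : ∀ x : SimplicialLattice d, x ∈ S ↔ ∀ p, a p ≤ x.1 p) :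
    corner S = a := by
  have hS : IsSimplex S := ⟨a, ha, h⟩
  refine le_antisymm (le_of_forall_le_imp hd ha.le fun x hx => ?_)
    (le_of_forall_le_imp hd (sum_corner_neg hS).le fun x hx => ?_)
  · exact (mem_iff_corner_le hS).1 ((h x).2 hx)
  · exact (h x).1 ((mem_iff_corner_le hS).2 hx)

theorem subset_iff_corner_le (hd : 1 ≤ d) {S T : Finset (SimplicialLattice d)} (hS : IsSimplex S)
    (hT : IsSimplex T) : T ⊆ S ↔ corner S ≤ corner T :=
  ⟨corner_le_corner hd hS hT, fun h _ hx => (mem_iff_corner_le hS).2 fun p =>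
    (h p).trans ((mem_iff_corner_le hT).1 hx p)⟩

theorem IsSimplex.nonempty {S : Finset (SimplicialLattice d)} (hS : IsSimplex S) : S.Nonempty := by
  obtain ⟨x, hx⟩ := exists_apply_eq_add (corner S) 0
  refine ⟨x, (mem_iff_corner_le hS).2 fun p => ?_⟩
  have := sum_corner_neg hS
  rw [hx]; split_ifs <;> omega

/-- The positive part of `y p - x p` is at most `y p - corner S p`, and these sum to the side
length. Two distinct vertices attain it. -/
theorem latticeDiam_eq (hd : 1 ≤ d) {S : Finset (SimplicialLattice d)} (hS : IsSimplex S) :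
    (latticeDiam S : ℤ) = - ∑ p, corner S p := by
  have hneg := sum_corner_neg hS
  apply le_antisymm
  · have h0 : latticeDiam S ≤ (- ∑ p, corner S p).toNat := by
      refine Finset.sup_le fun x hx => Finset.sup_le fun y hy => ?_
      rw [Int.le_toNat (by omega), manhattanDist]
      push_cast
      calc _ ≤ ∑ p, (y.1 p - corner S p) := by
            refine Finset.sum_le_sum fun p _ => ?_
            have h1 := (mem_iff_corner_le hS).1 hx p
            have h2 := (mem_iff_corner_le hS).1 hy p
            omega
        _ = _ := by rw [Finset.sum_sub_distrib, y.2, zero_sub]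
    omega
  · have : Nontrivial (Fin (d + 1)) := Fin.nontrivial_iff_two_le.2 (by omega)
    obtain ⟨r, s, hrs⟩ := exists_pair_ne (Fin (d + 1))
    obtain ⟨x, hx⟩ := exists_apply_eq_add (corner S) r
    obtain ⟨y, hy⟩ := exists_apply_eq_add (corner S) s
    have hxS : x ∈ S := (mem_iff_corner_le hS).2 fun p => by rw [hx]; split_ifs <;> omega
    have hyS : y ∈ S := (mem_iff_corner_le hS).2 fun p => by rw [hy]; split_ifs <;> omega
    have h1 : manhattanDist x y ≤ latticeDiam S :=
      (Finset.le_sup (f := fun y => manhattanDist x y) hyS).trans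
        (Finset.le_sup (f := fun x => S.sup fun y => manhattanDist x y) hxS)
    have h2 : (y.1 s - x.1 s).toNat ≤ manhattanDist x y :=
      Finset.single_le_sum (f := fun p => (y.1 p - x.1 p).toNat) (by simp) (Finset.mem_univ s)
    rw [hx, hy, if_pos rfl, if_neg hrs.symm] at h2
    omega

theorem apply_le_corner_add (hd : 1 ≤ d) {S : Finset (SimplicialLattice d)} (hS : IsSimplex S)
    {x : SimplicialLattice d} (hx : x ∈ S) (p : Fin (d + 1)) :
    x.1 p ≤ corner S p + latticeDiam S := by
  have h1 : x.1 p - corner S p ≤ ∑ q, (x.1 q - corner S q) :=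
    Finset.single_le_sum (f := fun q => x.1 q - corner S q)
      (fun q _ => sub_nonneg.2 ((mem_iff_corner_le hS).1 hx q)) (Finset.mem_univ p)
  rw [Finset.sum_sub_distrib, x.2] at h1
  have := latticeDiam_eq hd hS
  omega

theorem apply_sub_le (hd : 1 ≤ d) {S : Finset (SimplicialLattice d)} (hS : IsSimplex S)
    {x y : SimplicialLattice d} (hx : x ∈ S) (hy : y ∈ S) (p : Fin (d + 1)) :
    |x.1 p - y.1 p| ≤ latticeDiam S := by
  have h1 := apply_le_corner_add hd hS hx p
  have h2 := apply_le_corner_add hd hS hy p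
  have h3 := (mem_iff_corner_le hS).1 hx p
  have h4 := (mem_iff_corner_le hS).1 hy p
  rw [abs_le]; omega

theorem latticeDiam_mono (hd : 1 ≤ d) {S T : Finset (SimplicialLattice d)} (hS : IsSimplex S)
    (hT : IsSimplex T) (h : T ⊆ S) : latticeDiam T ≤ latticeDiam S := by
  have h1 := latticeDiam_eq hd hS
  have h2 := latticeDiam_eq hd hT
  have h3 := Finset.sum_le_sum fun p (_ : p ∈ Finset.univ) => corner_le_corner hd hS hT h p
  omega

/-- Each coordinate takes at most `latticeDiam S + 1` values on `S`. With `J` separating the points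
of `X`, this gives the power `d` for a simplex and `d - 1` for a face. -/
theorem card_le_of_coordinates (hd : 1 ≤ d) {S : Finset (SimplicialLattice d)} (hS : IsSimplex S)
    {X : Finset (SimplicialLattice d)} (hX : X ⊆ S) (J : Finset (Fin (d + 1)))
    (hJ : ∀ x ∈ X, ∀ y ∈ X, (∀ p ∈ J, x.1 p = y.1 p) → x = y) :
    X.card ≤ (latticeDiam S + 1) ^ J.card := by
  have h := Finset.card_le_card_of_injOn (s := X)
    (t := Finset.Icc (fun p : J => corner S p) (fun p : J => corner S p + latticeDiam S))
    (fun x p => x.1 p) (fun x hx => by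
      simp only [Finset.coe_Icc, Set.mem_Icc]
      exact ⟨fun p => (mem_iff_corner_le hS).1 (hX hx) p,
        fun p => apply_le_corner_add hd hS (hX hx) p⟩)
    (fun x hx y hy hxy => hJ x hx y hy fun p hp => congrFun hxy ⟨p, hp⟩)
  refine h.trans_eq ?_
  rw [Pi.card_Icc]
  have (a : ℤ) (m : ℕ) : (a + m + 1 - a).toNat = m + 1 := by omega
  simp [this]

theorem eq_of_apply_eq_of_ne {x y : SimplicialLattice d} (r : Fin (d + 1))
    (h : ∀ p, p ≠ r → x.1 p = y.1 p) : x = y := by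
  have h1 := Finset.add_sum_erase Finset.univ x.1 (Finset.mem_univ r)
  have h2 := Finset.add_sum_erase Finset.univ y.1 (Finset.mem_univ r)
  have h3 : ∑ p ∈ Finset.univ.erase r, x.1 p = ∑ p ∈ Finset.univ.erase r, y.1 p :=
    Finset.sum_congr rfl fun p hp => h p (Finset.ne_of_mem_erase hp)
  have h4 := x.2
  have h5 := y.2
  refine Subtype.ext (funext fun p => ?_)
  by_cases hp : p = r
  · subst hp; omega
  · exact h p hp

theorem card_simplex_le (hd : 1 ≤ d) {S : Finset (SimplicialLattice d)} (hS : IsSimplex S) :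
    S.card ≤ (latticeDiam S + 1) ^ d := by
  have := card_le_of_coordinates hd hS subset_rfl (Finset.univ.erase 0) fun x _ y _ h =>
    eq_of_apply_eq_of_ne 0 fun p hp => h p (by simp [hp])
  simpa using this

/-- The face of a simplex on which the coordinate `p` is minimal. -/
noncomputable def simplexFace (S : Finset (SimplicialLattice d)) (p : Fin (d + 1)) :
    Finset (SimplicialLattice d) :=
  S.filter fun x => x.1 p = corner S p

theorem card_simplexFace_le (hd : 1 ≤ d) {S : Finset (SimplicialLattice d)} (hS : IsSimplex S)
    (p : Fin (d + 1)) : (simplexFace S p).card ≤ (latticeDiam S + 1) ^ (d - 1) := by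
  have : Nontrivial (Fin (d + 1)) := Fin.nontrivial_iff_two_le.2 (by omega)
  obtain ⟨r, hr⟩ := exists_ne p
  have := card_le_of_coordinates hd hS (Finset.filter_subset (fun x => x.1 p = corner S p) S)
    ((Finset.univ.erase r).erase p) fun x hx y hy h => eq_of_apply_eq_of_ne r fun q hq => by
      by_cases hqp : q = p
      · subst hqp
        rw [(Finset.mem_filter.1 hx).2, (Finset.mem_filter.1 hy).2]
      · exact h q (by simp [hq, hqp])
  rwa [Finset.card_erase_of_mem (by simp [hr.symm]), Finset.card_erase_of_mem (by simp),
    Finset.card_univ, Fintype.card_fin, Nat.add_sub_cancel] at this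

variable {Λ : Finset (SimplicialLattice d)}

theorem mem_simplices {S : Finset (SimplicialLattice d)} :
    S ∈ simplices Λ ↔ S ⊆ Λ ∧ IsSimplex S := by
  simp [simplices]

/-- The part of `Λ` with coordinates at least `b`. -/
def simplexFrom (Λ : Finset (SimplicialLattice d)) (b : Fin (d + 1) → ℤ) :
    Finset (SimplicialLattice d) :=
  Λ.filter fun x => ∀ p, b p ≤ x.1 p

theorem mem_simplexFrom_iff (hΛ : IsSimplex Λ) {b : Fin (d + 1) → ℤ} (hb : corner Λ ≤ b)
    (x : SimplicialLattice d) : x ∈ simplexFrom Λ b ↔ ∀ p, b p ≤ x.1 p := by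
  rw [simplexFrom, Finset.mem_filter, and_iff_right_iff_imp]
  exact fun h => (mem_iff_corner_le hΛ).2 fun p => (hb p).trans (h p)

theorem simplexFrom_mem_simplices (hΛ : IsSimplex Λ) {b : Fin (d + 1) → ℤ} (hb : corner Λ ≤ b)
    (hneg : ∑ p, b p < 0) : simplexFrom Λ b ∈ simplices Λ :=
  mem_simplices.2 ⟨Finset.filter_subset _ _, b, hneg, mem_simplexFrom_iff hΛ hb⟩

theorem corner_simplexFrom (hd : 1 ≤ d) (hΛ : IsSimplex Λ) {b : Fin (d + 1) → ℤ}
    (hb : corner Λ ≤ b) (hneg : ∑ p, b p < 0) : corner (simplexFrom Λ b) = b :=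
  corner_eq hd hneg (mem_simplexFrom_iff hΛ hb)

theorem simplexFrom_corner {S : Finset (SimplicialLattice d)} (hS : S ∈ simplices Λ) :
    simplexFrom Λ (corner S) = S := by
  obtain ⟨hSΛ, hS⟩ := mem_simplices.1 hS
  ext x
  rw [simplexFrom, Finset.mem_filter, ← mem_iff_corner_le hS, and_iff_right_iff_imp]
  exact fun h => hSΛ h

/-- Two intersecting simplices lie in a common one, with subadditive diameter. -/
theorem exists_join (hd : 1 ≤ d) (hΛ : IsSimplex Λ) {S T : Finset (SimplicialLattice d)}
    (hS : S ∈ simplices Λ) (hT : T ∈ simplices Λ) (h : ¬ Disjoint S T) :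
    simplexFrom Λ (corner S ⊓ corner T) ∈ simplices Λ ∧
      S ⊆ simplexFrom Λ (corner S ⊓ corner T) ∧ T ⊆ simplexFrom Λ (corner S ⊓ corner T) ∧
      latticeDiam (simplexFrom Λ (corner S ⊓ corner T)) ≤ latticeDiam S + latticeDiam T := by
  obtain ⟨hSΛ, hS⟩ := mem_simplices.1 hS
  obtain ⟨hTΛ, hT⟩ := mem_simplices.1 hT
  have hle : corner Λ ≤ corner S ⊓ corner T :=
    le_inf (corner_le_corner hd hΛ hS hSΛ) (corner_le_corner hd hΛ hT hTΛ)
  have hneg : ∑ p, (corner S ⊓ corner T) p < 0 :=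
    (Finset.sum_le_sum fun p _ => (inf_le_left : corner S ⊓ corner T ≤ corner S) p).trans_lt
      (sum_corner_neg hS)
  have hmem := simplexFrom_mem_simplices hΛ hle hneg
  refine ⟨hmem, fun x hx => ?_, fun x hx => ?_, ?_⟩
  · exact (mem_simplexFrom_iff hΛ hle x).2 fun p =>
      (min_le_left _ _).trans ((mem_iff_corner_le hS).1 hx p)
  · exact (mem_simplexFrom_iff hΛ hle x).2 fun p =>
      (min_le_right _ _).trans ((mem_iff_corner_le hT).1 hx p)
  · have h1 := latticeDiam_eq hd (mem_simplices.1 hmem).2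
    have h2 := latticeDiam_eq hd hS
    have h3 := latticeDiam_eq hd hT
    rw [corner_simplexFrom hd hΛ hle hneg] at h1
    obtain ⟨x, hxS, hxT⟩ := Finset.not_disjoint_iff.1 h
    -- The summand is the maximum of the two lower bounds, hence at most the coordinate of the
    -- common point, and those coordinates sum to zero.
    have h4 : ∑ p, (corner S p + corner T p - (corner S ⊓ corner T) p) ≤ ∑ p, x.1 p := by
      refine Finset.sum_le_sum fun p _ => ?_
      have h5 := (mem_iff_corner_le hS).1 hxS p
      have h6 := (mem_iff_corner_le hT).1 hxT p
      simp only [Pi.inf_apply]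
      omega
    rw [x.2, Finset.sum_sub_distrib, Finset.sum_add_distrib] at h4
    omega

/-- A simplex that meets `S` without lying inside it meets a face of `S`. -/
theorem exists_mem_simplexFace (hd : 1 ≤ d) {S T : Finset (SimplicialLattice d)} (hS : IsSimplex S)
    (hT : IsSimplex T) (h : ¬ Disjoint S T) (hTS : ¬ T ⊆ S) :
    ¬ Disjoint (Finset.univ.biUnion (simplexFace S)) T := by
  rw [subset_iff_corner_le hd hS hT, Pi.le_def] at hTS
  push Not at hTS
  obtain ⟨p, hp⟩ := hTS
  obtain ⟨x, hxS, hxT⟩ := Finset.not_disjoint_iff.1 h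
  -- The intersection has the maxima as lower bounds and contains `x`. In direction `p` the maximum
  -- is `corner S p`, so a point attaining it lies on a face of `S`.
  have h1 : ∑ q, (corner S ⊔ corner T) q ≤ 0 := by
    rw [← x.2]
    exact Finset.sum_le_sum fun q _ => sup_le ((mem_iff_corner_le hS).1 hxS q)
      ((mem_iff_corner_le hT).1 hxT q)
  obtain ⟨y, hy, hyp⟩ := exists_lattice_point_apply_eq hd _ h1 p
  refine Finset.not_disjoint_iff.2 ⟨y, ?_, ?_⟩
  · rw [Finset.mem_biUnion]
    refine ⟨p, Finset.mem_univ p, Finset.mem_filter.2 ⟨?_, ?_⟩⟩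
    · exact (mem_iff_corner_le hS).2 fun q => (le_sup_left).trans (hy q)
    · rw [hyp, Pi.sup_apply, sup_eq_left]; exact hp.le
  · exact (mem_iff_corner_le hT).2 fun q => (le_sup_right).trans (hy q)

theorem card_boundary_le (hd : 1 ≤ d) {S : Finset (SimplicialLattice d)} (hS : IsSimplex S) :
    (Finset.univ.biUnion (simplexFace S)).card ≤ (d + 1) * (latticeDiam S + 1) ^ (d - 1) := by
  refine Finset.card_biUnion_le.trans ?_
  refine (Finset.sum_le_sum fun p _ => card_simplexFace_le hd hS p).trans_eq ?_
  simp

/-- The simplices inside the part of `Λ` with coordinates at least `b`. -/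
noncomputable def simplicesFrom (Λ : Finset (SimplicialLattice d)) (b : Fin (d + 1) → ℤ) :
    Finset (Finset (SimplicialLattice d)) :=
  (simplices Λ).filter fun T => T ⊆ simplexFrom Λ b

/-- The faces of the simplex at `b` through which it extends beyond the one at `a`. -/
noncomputable def outerFaces (Λ : Finset (SimplicialLattice d)) (a b : Fin (d + 1) → ℤ) :
    List (Finset (SimplicialLattice d)) :=
  ((List.finRange (d + 1)).filter fun p => b p < a p).map (simplexFace (simplexFrom Λ b))

/-- In the region with lower bounds `c`, where `c p = b p`, missing the face at `b p` means having
coordinate `p` at least `b p + 1`. Removing a target thus becomes a unit shift of one lower bound,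
which turns inclusion-exclusion into a mixed difference. -/
theorem avoiding_simplexFace (hd : 1 ≤ d) (hΛ : IsSimplex Λ) {b c : Fin (d + 1) → ℤ}
    (hb : corner Λ ≤ b) (hneg : ∑ p, b p < 0) (hbc : b ≤ c) {p : Fin (d + 1)} (hp : c p = b p) :
    avoiding (simplexFace (simplexFrom Λ b) p) (simplicesFrom Λ c) =
      simplicesFrom Λ (c + Pi.single p 1) := by
  ext T
  simp only [avoiding, simplicesFrom, Finset.mem_filter, and_assoc, and_congr_right_iff]
  intro hT
  have hcΛ := hb.trans hbc
  have hc'Λ : corner Λ ≤ c + Pi.single p 1 := hcΛ.trans (by simp [Pi.single_nonneg])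
  simp only [Finset.subset_iff, mem_simplexFrom_iff hΛ hcΛ, mem_simplexFrom_iff hΛ hc'Λ,
    Finset.disjoint_left, simplexFace, Finset.mem_filter, corner_simplexFrom hd hΛ hb hneg,
    mem_simplexFrom_iff hΛ hb]
  constructor
  · rintro ⟨h1, h2⟩ x hx q
    have h3 := h1 hx q
    by_cases hq : q = p
    · subst hq
      have : x.1 q ≠ b q := fun h => h2 ⟨fun r => (hbc r).trans (h1 hx r), h⟩ hx
      simp; omega
    · simpa [hq] using h3
  · intro h
    refine ⟨fun x hx q => ?_, fun x hx hxT => ?_⟩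
    · have h1 := h hx q
      have h2 : (0 : ℤ) ≤ (Pi.single p 1 : Fin (d + 1) → ℤ) q :=
        (Pi.single_nonneg (α := fun _ => ℤ)).2 zero_le_one q
      simp only [Pi.add_apply] at h1
      omega
    · have h1 := h hxT p
      simp only [Pi.add_apply, Pi.single_eq_same] at h1
      omega

theorem targetDiff_outerFaces {E : Type*} [AddCommGroup E] (hd : 1 ≤ d) (hΛ : IsSimplex Λ)
    (F : Finset (Finset (SimplicialLattice d)) → E) {a b : Fin (d + 1) → ℤ}
    (hb : corner Λ ≤ b) (hneg : ∑ p, b p < 0) :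
    targetDiff F (outerFaces Λ a b) (simplicesFrom Λ b) =
      boxDiff a (List.finRange (d + 1)) (fun c => F (simplicesFrom Λ c)) b := by
  have key (ps : List (Fin (d + 1))) (hps : ps.Nodup) (c : Fin (d + 1) → ℤ) (hbc : b ≤ c)
      (hc : ∀ p ∈ ps, c p = b p) :
      targetDiff F ((ps.filter fun p => b p < a p).map (simplexFace (simplexFrom Λ b)))
        (simplicesFrom Λ c) = boxDiff a ps (fun c => F (simplicesFrom Λ c)) c := by
    induction ps generalizing c with
    | nil => rfl
    | cons p ps ih =>
      obtain ⟨hp, hps⟩ := List.nodup_cons.1 hps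
      have hcp := hc p (by simp)
      have hc' : ∀ q ∈ ps, c q = b q := fun q hq => hc q (by simp [hq])
      rw [boxDiff, hcp]
      by_cases h : b p < a p
      · rw [List.filter_cons_of_pos (by simpa using h), List.map_cons, targetDiff_cons,
          avoiding_simplexFace hd hΛ hb hneg hbc hcp, if_pos h, ih hps c hbc hc',
          ih hps _ (hbc.trans (by simp [Pi.single_nonneg])) fun q hq => ?_]
        have : q ≠ p := fun h => hp (h ▸ hq)
        simpa [this] using hc' q hq
      · rw [List.filter_cons_of_neg (by simpa using h), if_neg h, sub_zero, ih hps c hbc hc']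
  exact key _ (List.nodup_finRange _) b le_rfl fun _ _ => rfl

theorem sum_targetDiff_outerFaces {E : Type*} [AddCommGroup E] (hd : 1 ≤ d) (hΛ : IsSimplex Λ)
    (F : Finset (Finset (SimplicialLattice d)) → E) {S : Finset (SimplicialLattice d)}
    (hS : S ∈ simplices Λ) :
    ∑ b ∈ Finset.Icc (corner Λ) (corner S),
      targetDiff F (outerFaces Λ (corner S) b) (simplicesFrom Λ b) = F (simplices Λ) := by
  obtain ⟨hSΛ, hS⟩ := mem_simplices.1 hS
  have h : ∀ b ∈ Finset.Icc (corner Λ) (corner S),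
      targetDiff F (outerFaces Λ (corner S) b) (simplicesFrom Λ b) =
      boxDiff (corner S) (List.finRange (d + 1)) (fun c => F (simplicesFrom Λ c)) b := by
    intro b hb
    obtain ⟨h1, h2⟩ := Finset.mem_Icc.1 hb
    exact targetDiff_outerFaces hd hΛ F h1
      ((Finset.sum_le_sum fun p _ => h2 p).trans_lt (sum_corner_neg hS))
  rw [Finset.sum_congr rfl h, sum_boxDiff _ _ (corner_le_corner hd hΛ hS hSΛ) _ _
    (List.nodup_finRange _) (by simp)]
  congr 1
  rw [simplicesFrom, simplexFrom_corner (mem_simplices.2 ⟨subset_rfl, hΛ⟩), Finset.filter_true_of_mem]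
  exact fun T hT => (mem_simplices.1 hT).1

end Geometry

theorem evolve_evolve_neg {𝔄 : Type*} [CStarAlgebra 𝔄] (G : 𝔄) (s : ℝ) (X : 𝔄) :
    evolve G s (evolve (-G) s X) = X := by
  let +nondep : NormedAlgebra ℚ 𝔄 := .restrictScalars ℚ ℂ 𝔄
  have h (Y : 𝔄) : NormedSpace.exp Y * NormedSpace.exp (-Y) = 1 := by
    rw [← NormedSpace.exp_add_of_commute (Commute.refl Y).neg_right, add_neg_cancel,
      NormedSpace.exp_zero]
  have h1 := h (s • (Complex.I • G))
  simp only [evolve, smul_neg, neg_smul, neg_neg]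
  calc _ = (NormedSpace.exp (s • Complex.I • G) * NormedSpace.exp (-(s • Complex.I • G))) * X *
        (NormedSpace.exp (s • Complex.I • G) * NormedSpace.exp (-(s • Complex.I • G))) := by
        simp only [mul_assoc]
    _ = X := by rw [h1, one_mul, mul_one]

/-! ### Supports of operators, and the Heisenberg evolution as a conjugation. -/

section Support

variable {d : ℕ} {Λ : Finset (SimplicialLattice d)} {q : Λ → ℕ}

theorem commute_of_supportedIn {S T : Finset (SimplicialLattice d)} (h : Disjoint S T)
    {A C : LatticeOp Λ q} (hA : SupportedIn S A) (hC : SupportedIn T C) : Commute A C := by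
  classical
  obtain ⟨a, ha⟩ := hA
  obtain ⟨c, hc⟩ := hC
  have hdis {i : SimplicialLattice d} (hi : i ∈ S) : i ∉ T := Finset.disjoint_left.1 h hi
  have hA0 {x y : Config Λ q} (h : A x y ≠ 0) (i : Λ) (hi : i.1 ∉ S) : x i = y i := by
    rw [ha] at h
    split_ifs at h with h'
    · exact h' i hi
    · exact absurd rfl h
  have hC0 {x y : Config Λ q} (h : C x y ≠ 0) (i : Λ) (hi : i.1 ∉ T) : x i = y i := by
    rw [hc] at h
    split_ifs at h with h'
    · exact h' i hi
    · exact absurd rfl h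
  ext x z
  -- Only one intermediate configuration contributes to each product: `y₀` takes its values from `z`
  -- on `S` and from `x` elsewhere, `y₁` the reverse.
  set y₀ : Config Λ q := fun i => if i.1 ∈ S then z i else x i with hy₀
  set y₁ : Config Λ q := fun i => if i.1 ∈ S then x i else z i with hy₁
  have h0 : (A * C) x z = A x y₀ * C y₀ z := by
    rw [Matrix.mul_apply]
    refine Finset.sum_eq_single y₀ (fun y _ hy => ?_) (by simp)
    by_contra hne
    refine hy (funext fun i => ?_)
    by_cases hi : i.1 ∈ S
    · simpa [hy₀, hi] using hC0 (right_ne_zero_of_mul hne) i (hdis hi)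
    · simpa [hy₀, hi] using (hA0 (left_ne_zero_of_mul hne) i hi).symm
  have h1 : (C * A) x z = C x y₁ * A y₁ z := by
    rw [Matrix.mul_apply]
    refine Finset.sum_eq_single y₁ (fun y _ hy => ?_) (by simp)
    by_contra hne
    refine hy (funext fun i => ?_)
    by_cases hi : i.1 ∈ S
    · simpa [hy₁, hi] using (hC0 (left_ne_zero_of_mul hne) i (hdis hi)).symm
    · simpa [hy₁, hi] using hA0 (right_ne_zero_of_mul hne) i hi
  have e1 : A x y₀ = A y₁ z := by
    rw [ha, ha, if_pos (fun i hi => by simp [hy₀, hi]), if_pos (fun i hi => by simp [hy₁, hi])]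
    congr 1 <;> funext i <;> simp [hy₀, hy₁, i.2]
  have e2 : C y₀ z = C x y₁ := by
    rw [hc, hc]
    have hcond : (∀ i : Λ, i.1 ∉ T → y₀ i = z i) ↔ ∀ i : Λ, i.1 ∉ T → x i = y₁ i := by
      refine forall₂_congr fun i _ => ?_
      by_cases hi : i.1 ∈ S <;> simp [hy₀, hy₁, hi]
    have hT (i : {i : Λ // i.1 ∈ T}) : i.1.1 ∉ S := fun h => hdis h i.2
    simp only [hcond]
    congr 2 <;> funext i <;> simp [hy₀, hy₁, hT i]
  rw [h0, h1, e1, e2, mul_comm]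

/-- A commutant theorem for the tensor factorisation. In this form the operators supported in `S`
are visibly an algebra, monotone in `S` and stable under evolution. -/
theorem supportedIn_iff_forall_commute {S : Finset (SimplicialLattice d)} {A : LatticeOp Λ q} :
    SupportedIn S A ↔ ∀ C : LatticeOp Λ q, SupportedIn (Λ \ S) C → Commute A C := by
  classical
  refine ⟨fun h C hC => commute_of_supportedIn Finset.disjoint_sdiff h hC, fun h => ?_⟩
  have hout (i : Λ) (hi : i.1 ∉ S) : i.1 ∈ Λ \ S := Finset.mem_sdiff.2 ⟨i.2, hi⟩
  have hzero (x y : Config Λ q) (i : Λ) (hi : i.1 ∉ S) (hxy : x i ≠ y i) : A x y = 0 := by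
    -- Commuting with the projection onto the value `x i` at an outer site `i` forces `A` to be
    -- diagonal at that site.
    have hcomm := h (Matrix.diagonal fun u : Config Λ q => if u i = x i then 1 else 0)
      ⟨Matrix.diagonal fun u => if u ⟨i, hout i hi⟩ = x i then 1 else 0, fun u v => by
        simp only [Matrix.diagonal_apply]
        by_cases huv : u = v
        · subst huv; simp
        · rw [if_neg huv]
          split_ifs with h1 h2 <;> try rfl
          refine absurd (funext fun j => ?_) huv
          by_cases hj : j.1 ∈ Λ \ S
          · exact congrFun h2 ⟨j, hj⟩
          · exact h1 j hj⟩
    have := congrFun (congrFun hcomm.eq x) y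
    rw [Matrix.mul_diagonal, Matrix.diagonal_mul] at this
    simpa [hxy.symm] using this.symm
  have hinv (x y x' y' : Config Λ q) (h1 : ∀ i : Λ, i.1 ∉ S → x i = y i)
      (h2 : ∀ i : Λ, i.1 ∉ S → x' i = y' i) (h3 : ∀ i : Λ, i.1 ∈ S → x i = x' i)
      (h4 : ∀ i : Λ, i.1 ∈ S → y i = y' i) : A x y = A x' y' := by
    -- A matrix unit on the sites outside `S`, taking the values of `x` to those of `x'`. Commuting
    -- with it makes the entries of `A` independent of the outer values.
    have hcomm := h (Matrix.of fun u v : Config Λ q =>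
        if (∀ i : Λ, i.1 ∈ S → u i = v i) ∧ (∀ i : Λ, i.1 ∉ S → u i = x' i) ∧
          ∀ i : Λ, i.1 ∉ S → v i = x i then 1 else 0)
      ⟨Matrix.of fun u v => if (∀ i, u i = x' i.1) ∧ ∀ i, v i = x i.1 then 1 else 0,
        fun u v => by
          have e1 (i : Λ) : i.1 ∉ Λ \ S ↔ i.1 ∈ S := by simp
          have e2 (w w' : Config Λ q) : (∀ i : {i : Λ // i.1 ∈ Λ \ S}, w i.1 = w' i.1) ↔
              ∀ i : Λ, i.1 ∉ S → w i = w' i :=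
            ⟨fun h i hi => h ⟨i, hout i hi⟩, fun h i => h i.1 (Finset.mem_sdiff.1 i.2).2⟩
          simp only [Matrix.of_apply, e1, e2, ite_and]⟩
    have := congrFun (congrFun hcomm.eq x') y
    rw [Matrix.mul_apply, Matrix.mul_apply, Finset.sum_eq_single y' (fun v _ hv => ?_) (fun h => absurd (Finset.mem_univ _) h),
      Finset.sum_eq_single x (fun v _ hv => ?_) (fun h => absurd (Finset.mem_univ _) h)] at this
    · simp only [Matrix.of_apply] at this
      rw [if_pos ⟨fun i hi => (h4 i hi).symm, fun i hi => (h2 i hi).symm, fun i hi => (h1 i hi).symm⟩,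
        if_pos ⟨fun i hi => (h3 i hi).symm, fun _ _ => trivial, fun _ _ => trivial⟩] at this
      simpa using this.symm
    · rw [Matrix.of_apply, if_neg, zero_mul]
      rintro ⟨g1, g2, g3⟩
      refine hv (funext fun i => ?_)
      by_cases hi : i.1 ∈ S
      · rw [← g1 i hi, h3 i hi]
      · rw [g3 i hi]
    · rw [Matrix.of_apply, if_neg, mul_zero]
      rintro ⟨g1, g2, g3⟩
      refine hv (funext fun i => ?_)
      by_cases hi : i.1 ∈ S
      · rw [g1 i hi, h4 i hi]
      · rw [g2 i hi, h2 i hi]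
  rcases isEmpty_or_nonempty (Config Λ q) with hemp | ⟨⟨z⟩⟩
  · exact ⟨0, fun x => (hemp.false x).elim⟩
  refine ⟨Matrix.of fun u v => A (fun i => if hi : i.1 ∈ S then u ⟨i, hi⟩ else z i)
    (fun i => if hi : i.1 ∈ S then v ⟨i, hi⟩ else z i), fun x y => ?_⟩
  split_ifs with hxy
  · exact hinv _ _ _ _ hxy (fun i hi => by simp [hi]) (fun i hi => by simp [hi])
      (fun i hi => by simp [hi])
  · push Not at hxy
    obtain ⟨i, hi, hne⟩ := hxy
    exact hzero x y i hi hne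

theorem SupportedIn.mono {S S' : Finset (SimplicialLattice d)} (h : S ⊆ S') {A : LatticeOp Λ q}
    (hA : SupportedIn S A) : SupportedIn S' A :=
  supportedIn_iff_forall_commute.2 fun _ hC =>
    commute_of_supportedIn (Finset.disjoint_sdiff.mono_left h) hA hC

/-- The algebra of operators supported inside `S`. -/
noncomputable def supportedAlgebra (q : Λ → ℕ) (S : Finset (SimplicialLattice d)) :
    Subalgebra ℂ (LatticeOp Λ q) :=
  Subalgebra.centralizer ℂ {C | SupportedIn (Λ \ S) C}

theorem mem_supportedAlgebra {S : Finset (SimplicialLattice d)} {A : LatticeOp Λ q} :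
    A ∈ supportedAlgebra q S ↔ SupportedIn S A := by
  rw [supportedAlgebra, Subalgebra.mem_centralizer_iff, supportedIn_iff_forall_commute]
  exact forall₂_congr fun C _ => ⟨fun h => h.symm, fun h => h.eq.symm⟩

theorem supportedIn_evolve {S : Finset (SimplicialLattice d)} {G X : LatticeOp Λ q}
    (hG : SupportedIn S G) (hX : SupportedIn S X) (s : ℝ) : SupportedIn S (evolve G s X) :=
  supportedIn_iff_forall_commute.2 fun C hC =>
    (commute_evolve (supportedIn_iff_forall_commute.1 hG C hC).symm
      (supportedIn_iff_forall_commute.1 hX C hC).symm s).symm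

theorem SupportedIn.conjTranspose {S : Finset (SimplicialLattice d)} {A : LatticeOp Λ q}
    (hA : SupportedIn S A) : SupportedIn S A.conjTranspose := by
  obtain ⟨B, hB⟩ := hA
  refine ⟨B.conjTranspose, fun x y => ?_⟩
  rw [Matrix.conjTranspose_apply, hB, Matrix.conjTranspose_apply]
  simp only [eq_comm (a := y _)]
  split_ifs <;> simp

/-- Both sides solve the same linear equation; the left one, pulled back by the inverse conjugation,
has derivative zero. -/
theorem heisenberg_eq_evolve (H : LatticeOp Λ q) (t : ℝ) (A : LatticeOp Λ q) :
    heisenberg H t A = evolve ((t : ℂ) • H) 1 A := by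
  let L := liouvillian H
  have h1 (s : ℝ) : HasDerivAt (fun r : ℝ => NormedSpace.exp (r • ((t : ℂ) • L)) A)
      (((t : ℂ) • L) (NormedSpace.exp (s • ((t : ℂ) • L)) A)) s :=
    ((ContinuousLinearMap.apply ℂ (LatticeOp Λ q) A).restrictScalars ℝ).hasFDerivAt.comp_hasDerivAt s
      (hasDerivAt_exp_smul_const' (𝕂 := ℝ) ((t : ℂ) • L) s)
  have h2 (s : ℝ) : HasDerivAt (fun r : ℝ => evolve (-((t : ℂ) • H)) r
      (NormedSpace.exp (r • ((t : ℂ) • L)) A)) 0 s := by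
    refine (hasDerivAt_evolve_comp _ (h1 s)).congr_deriv ?_
    have e : ((t : ℂ) • L) (NormedSpace.exp (s • ((t : ℂ) • L)) A) =
        adjointAction ((t : ℂ) • H) (NormedSpace.exp (s • ((t : ℂ) • L)) A) := by
      simp only [adjointAction, smul_apply, L, liouvillian_apply,
        smul_mul_assoc, mul_smul_comm, ← smul_sub]
      rw [smul_comm]
    rw [e, adjointAction_evolve_neg]
  have h3 : evolve (-((t : ℂ) • H)) 1 (NormedSpace.exp ((1 : ℝ) • ((t : ℂ) • L)) A) =
      evolve (-((t : ℂ) • H)) 0 (NormedSpace.exp ((0 : ℝ) • ((t : ℂ) • L)) A) :=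
    is_const_of_deriv_eq_zero (fun s => (h2 s).differentiableAt) (fun s => (h2 s).deriv) 1 0
  have h4 : (0 : ℝ) • ((t : ℂ) • L) = 0 :=
    ContinuousLinearMap.ext fun X => zero_smul ℝ (((t : ℂ) • L) X)
  have h5 : (1 : ℝ) • ((t : ℂ) • L) = (t : ℂ) • L :=
    ContinuousLinearMap.ext fun X => one_smul ℝ (((t : ℂ) • L) X)
  rw [evolve_zero, h4, h5, NormedSpace.exp_zero] at h3
  rw [← evolve_evolve_neg ((t : ℂ) • H) 1 (heisenberg H t A)]
  exact congrArg _ h3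

end Support

/-! ### Stretched exponentials and sums with decay on a length scale `E`. -/

section Decay

/-- A stretched exponential decays faster than any power. -/
theorem exists_exp_neg_rpow_mul_pow_le {α : ℝ} (hα : 0 < α) (N : ℕ) :
    ∃ K : ℝ, 1 ≤ K ∧ ∀ y : ℝ, 0 ≤ y → Real.exp (-(y ^ α / 2)) * (1 + y) ^ N ≤ K := by
  -- For `y ≥ 1` this gives `y ^ N ≤ (y ^ α) ^ k`, which the `k`-th Taylor term of the exponential
  -- controls.
  obtain ⟨k, hk⟩ := exists_nat_ge ((N : ℝ) / α)
  rw [div_le_iff₀ hα] at hk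
  have h2N : (1 : ℝ) ≤ 2 ^ N := one_le_pow₀ one_le_two
  have hkf : (1 : ℝ) ≤ 2 ^ k * k.factorial :=
    one_le_mul_of_one_le_of_one_le (one_le_pow₀ one_le_two)
      (by exact_mod_cast k.factorial_pos)
  refine ⟨2 ^ N * (2 ^ k * k.factorial), one_le_mul_of_one_le_of_one_le h2N hkf, fun y hy => ?_⟩
  have hz : 0 ≤ y ^ α / 2 := by positivity
  rcases le_total y 1 with h1 | h1
  · calc Real.exp (-(y ^ α / 2)) * (1 + y) ^ N ≤ 1 * 2 ^ N := by
          gcongr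
          · exact Real.exp_le_one_iff.2 (by linarith)
          · linarith
      _ ≤ _ := by nlinarith
  · have h3 : y ^ N ≤ 2 ^ k * k.factorial * Real.exp (y ^ α / 2) := by
      have h4 := Real.pow_div_factorial_le_exp _ hz k
      rw [div_le_iff₀ (by positivity), div_pow, div_le_iff₀ (by positivity)] at h4
      calc y ^ N = y ^ (N : ℝ) := (Real.rpow_natCast y N).symm
        _ ≤ y ^ (k * α) := Real.rpow_le_rpow_of_exponent_le h1 hk
        _ = (y ^ α) ^ k := by rw [mul_comm, Real.rpow_mul hy, Real.rpow_natCast]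
        _ ≤ _ := by linarith
    calc Real.exp (-(y ^ α / 2)) * (1 + y) ^ N ≤ Real.exp (-(y ^ α / 2)) * (2 * y) ^ N := by
          gcongr; linarith
      _ = 2 ^ N * (Real.exp (-(y ^ α / 2)) * y ^ N) := by rw [mul_pow]; ring
      _ ≤ 2 ^ N * (Real.exp (-(y ^ α / 2)) * (2 ^ k * k.factorial * Real.exp (y ^ α / 2))) := by
          gcongr
      _ = 2 ^ N * (2 ^ k * k.factorial) * (Real.exp (-(y ^ α / 2)) * Real.exp (y ^ α / 2)) := by
          ring
      _ = _ := by rw [← Real.exp_add]; simp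

/-- Replacing one of the two factors `1 + (k + 1) / E` by `1 + k / E` makes the sum telescope. -/
theorem sum_range_inv_sq_le {E : ℝ} (hE : 1 ≤ E) (n : ℕ) :
    ∑ k ∈ Finset.range n, ((1 + ((k + 1 : ℕ) : ℝ) / E) ^ 2)⁻¹ ≤ E - E / (1 + n / E) := by
  have hE0 : 0 < E := by linarith
  induction n with
  | zero => simp
  | succ n ih =>
    rw [Finset.sum_range_succ]
    have h1 : 0 < 1 + (n : ℝ) / E := by positivity
    have h2 : 0 < 1 + ((n + 1 : ℕ) : ℝ) / E := by positivity
    have h3 : E / (1 + n / E) - E / (1 + ((n + 1 : ℕ) : ℝ) / E) =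
        ((1 + n / E) * (1 + ((n + 1 : ℕ) : ℝ) / E))⁻¹ := by
      push_cast at h2 ⊢
      field_simp
      ring
    have h4 : ((1 + ((n + 1 : ℕ) : ℝ) / E) ^ 2)⁻¹ ≤
        ((1 + n / E) * (1 + ((n + 1 : ℕ) : ℝ) / E))⁻¹ := by
      rw [sq]
      gcongr
      simp
    linarith

theorem sum_comp_le_of_injOn {β : Type*} (A : Finset β) (φ : β → ℕ) (hφ : Set.InjOn φ A)
    (f : ℕ → ℝ) (hf : ∀ n, 0 ≤ f n) (c : ℝ) (hc : ∀ n, ∑ k ∈ Finset.range n, f k ≤ c) :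
    ∑ x ∈ A, f (φ x) ≤ c := by
  classical
  rw [← Finset.sum_image (f := f) hφ]
  obtain ⟨n, hn⟩ := Finset.exists_nat_subset_range (A.image φ)
  exact (Finset.sum_le_sum_of_subset_of_nonneg hn fun _ _ _ => hf _).trans (hc n)

theorem sum_int_inv_sq_le {E : ℝ} (hE : 1 ≤ E) (A : Finset ℤ) (c : ℤ) :
    ∑ k ∈ A, ((1 + ((k - c).natAbs : ℝ) / E) ^ 2)⁻¹ ≤ 3 * E := by
  have hE0 : 0 < E := by linarith
  have h0 (n : ℕ) : ∑ k ∈ Finset.range n, ((1 + ((k + 1 : ℕ) : ℝ) / E) ^ 2)⁻¹ ≤ E :=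
    (sum_range_inv_sq_le hE n).trans (sub_le_self _ (by positivity))
  rw [← Finset.sum_filter_add_sum_filter_not A (fun k => c ≤ k)]
  -- The point `k = c` accounts for the extra `1`; in the end `1 + 2 * E ≤ 3 * E`.
  have h1 : ∑ k ∈ A with c ≤ k, ((1 + ((k - c).natAbs : ℝ) / E) ^ 2)⁻¹ ≤ 1 + E := by
    refine sum_comp_le_of_injOn _ (fun k : ℤ => (k - c).natAbs) (fun x hx y hy h => ?_)
      (fun n => ((1 + (n : ℝ) / E) ^ 2)⁻¹) (fun n => by positivity) _ fun n => ?_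
    · have hx := (Finset.mem_filter.1 hx).2
      have hy := (Finset.mem_filter.1 hy).2
      dsimp only at h
      omega
    · refine (Finset.sum_le_sum_of_subset_of_nonneg (Finset.range_mono (Nat.le_succ n))
        fun _ _ _ => by positivity).trans ?_
      rw [Finset.sum_range_succ']
      have := h0 n
      simp only [Nat.cast_zero, zero_div, add_zero, one_pow, inv_one]
      linarith
  have h2 : ∑ k ∈ A with ¬ c ≤ k, ((1 + ((k - c).natAbs : ℝ) / E) ^ 2)⁻¹ ≤ E := by
    refine le_trans (le_of_eq (Finset.sum_congr rfl fun k hk => ?_))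
      (sum_comp_le_of_injOn _ (fun k : ℤ => (k - c).natAbs - 1) (fun x hx y hy h => ?_)
      (fun n => ((1 + ((n + 1 : ℕ) : ℝ) / E) ^ 2)⁻¹) (fun n => by positivity) _ h0)
    · have hk := (Finset.mem_filter.1 hk).2
      rw [Nat.sub_add_cancel (by omega)]
    · have hx := (Finset.mem_filter.1 hx).2
      have hy := (Finset.mem_filter.1 hy).2
      dsimp only at h
      omega
  linarith

theorem sum_prod_inv_sq_le {β ι : Type*} [Fintype ι] [DecidableEq ι] {E : ℝ} (hE : 1 ≤ E) (Y : Finset β)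
    (φ : β → ι → ℤ) (hφ : Set.InjOn φ Y) (c : ι → ℤ) :
    ∑ y ∈ Y, ∏ q, ((1 + ((φ y q - c q).natAbs : ℝ) / E) ^ 2)⁻¹ ≤ (3 * E) ^ Fintype.card ι := by
  classical
  have hE0 : 0 < E := by linarith
  have hpos (x : ι → ℤ) : 0 ≤ ∏ q, ((1 + ((x q - c q).natAbs : ℝ) / E) ^ 2)⁻¹ :=
    Finset.prod_nonneg fun _ _ => by positivity
  rw [← Finset.sum_image (f := fun x : ι → ℤ => ∏ q, ((1 + ((x q - c q).natAbs : ℝ) / E) ^ 2)⁻¹) hφ]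
  calc _ ≤ ∑ x ∈ Fintype.piFinset fun q => (Y.image φ).image fun x => x q,
          ∏ q, ((1 + ((x q - c q).natAbs : ℝ) / E) ^ 2)⁻¹ := by
        refine Finset.sum_le_sum_of_subset_of_nonneg (fun x hx => ?_) fun x _ _ => hpos x
        rw [Fintype.mem_piFinset]
        exact fun q => Finset.mem_image_of_mem _ hx
    _ = ∏ q, ∑ k ∈ (Y.image φ).image fun x => x q, ((1 + ((k - c q).natAbs : ℝ) / E) ^ 2)⁻¹ :=
        (Finset.prod_univ_sum (fun q => (Y.image φ).image fun x => x q) fun q k => ((1 + ((k - c q).natAbs : ℝ) / E) ^ 2)⁻¹).symm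
    _ ≤ ∏ _q : ι, 3 * E :=
        Finset.prod_le_prod (fun _ _ => Finset.sum_nonneg fun _ _ => by positivity)
          fun q _ => sum_int_inv_sq_le hE _ _
    _ = _ := by simp

/-- Summing `(1 + m / E) ^ (-2 n)` over points of `ℤ ^ n` within distance `m` of a fixed one. -/
theorem sum_inv_pow_le {β ι : Type*} [Fintype ι] [DecidableEq ι] {E : ℝ} (hE : 1 ≤ E) (Y : Finset β)
    (φ : β → ι → ℤ) (hφ : Set.InjOn φ Y) (c : ι → ℤ) (m : β → ℕ)
    (hm : ∀ y ∈ Y, ∀ q, (φ y q - c q).natAbs ≤ m y) :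
    ∑ y ∈ Y, ((1 + (m y : ℝ) / E) ^ (2 * Fintype.card ι))⁻¹ ≤ (3 * E) ^ Fintype.card ι := by
  have hE0 : 0 < E := by linarith
  -- The exponent provides one inverse square for each coordinate.
  refine (Finset.sum_le_sum fun y hy => ?_).trans (sum_prod_inv_sq_le hE Y φ hφ c)
  rw [pow_mul, ← inv_pow, ← Finset.card_univ, ← Finset.prod_const]
  refine Finset.prod_le_prod (fun _ _ => by positivity) fun q _ => ?_
  have := hm y hy q
  gcongr

/-- As `E ≥ 1`, `m + 1 ≤ E * (1 + m / E)`: each power of the diameter is traded for a power of `E`.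
-/
theorem mul_pow_mul_pow_le {E K ω : ℝ} (hE : 1 ≤ E) {N : ℕ} {m : ℕ} (hω : 0 ≤ ω)
    (hK : ω * (1 + m / E) ^ N ≤ K) {k j : ℕ} (hkj : k + j ≤ N) :
    ω * ((m : ℝ) + 1) ^ k * (1 + m / E) ^ j ≤ K * E ^ k := by
  have hE0 : 0 < E := by linarith
  have h1 : (1 : ℝ) ≤ 1 + m / E := le_add_of_nonneg_right (by positivity)
  have h2 : (m : ℝ) + 1 ≤ E * (1 + m / E) := by field_simp; linarith
  calc ω * ((m : ℝ) + 1) ^ k * (1 + m / E) ^ j ≤ ω * (E * (1 + m / E)) ^ k * (1 + m / E) ^ j := by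
        gcongr
    _ = E ^ k * (ω * (1 + m / E) ^ (k + j)) := by rw [mul_pow, pow_add]; ring
    _ ≤ E ^ k * (ω * (1 + m / E) ^ N) := by gcongr
    _ ≤ E ^ k * K := by gcongr
    _ = _ := mul_comm _ _

end Decay

/-! ### The simplices containing `S`, and the faces through which they exceed it. -/

section Growth

variable {d : ℕ} {Λ : Finset (SimplicialLattice d)}

/-- The faces of `R` through which `R` extends beyond `S`. -/
noncomputable def growthFaces (S R : Finset (SimplicialLattice d)) :
    List (Finset (SimplicialLattice d)) :=
  ((List.finRange (d + 1)).filter fun p => corner R p < corner S p).map (simplexFace R)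

theorem mem_growthFaces {S R X : Finset (SimplicialLattice d)} :
    X ∈ growthFaces S R ↔ ∃ p, corner R p < corner S p ∧ simplexFace R p = X := by
  simp [growthFaces]

theorem length_growthFaces_le (S R : Finset (SimplicialLattice d)) :
    (growthFaces S R).length ≤ d + 1 := by
  rw [growthFaces, List.length_map]
  exact (List.length_filter_le _ _).trans_eq (by simp)

theorem growthFaces_self (S : Finset (SimplicialLattice d)) : growthFaces S S = [] := by
  simp [growthFaces]

theorem growthFaces_ne_nil (hd : 1 ≤ d) {S R : Finset (SimplicialLattice d)} (hS : IsSimplex S)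
    (hR : IsSimplex R) (h : ¬ R ⊆ S) : growthFaces S R ≠ [] := by
  rw [subset_iff_corner_le hd hS hR, Pi.le_def] at h
  push Not at h
  obtain ⟨p, hp⟩ := h
  exact List.ne_nil_of_mem (mem_growthFaces.2 ⟨p, hp, rfl⟩)

theorem simplicesFrom_eq_simplices (b : Fin (d + 1) → ℤ) :
    simplicesFrom Λ b = simplices (simplexFrom Λ b) := by
  ext T
  simp only [simplicesFrom, Finset.mem_filter, mem_simplices]
  refine ⟨fun h => ⟨h.2, h.1.2⟩, fun h => ⟨⟨h.1.trans (Finset.filter_subset _ _), h.2⟩, h.1⟩⟩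

/-- Inclusion-exclusion over the simplices that contain `S`. -/
theorem sum_targetDiff_growthFaces {E : Type*} [AddCommGroup E] (hd : 1 ≤ d) (hΛ : IsSimplex Λ)
    (F : Finset (Finset (SimplicialLattice d)) → E) {S : Finset (SimplicialLattice d)}
    (hS : S ∈ simplices Λ) :
    ∑ R ∈ simplices Λ with S ⊆ R, targetDiff F (growthFaces S R) (simplices R) =
      F (simplices Λ) := by
  rw [← sum_targetDiff_outerFaces hd hΛ F hS]
  have hS' := (mem_simplices.1 hS).2
  have hneg {b : Fin (d + 1) → ℤ} (h : b ≤ corner S) : ∑ p, b p < 0 :=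
    (Finset.sum_le_sum fun p _ => h p).trans_lt (sum_corner_neg hS')
  refine Finset.sum_bij' (fun R _ => corner R) (fun b _ => simplexFrom Λ b) ?_ ?_ ?_ ?_ ?_
  · intro R hR
    obtain ⟨hR, hSR⟩ := Finset.mem_filter.1 hR
    obtain ⟨hRΛ, hR⟩ := mem_simplices.1 hR
    exact Finset.mem_Icc.2 ⟨corner_le_corner hd hΛ hR hRΛ, corner_le_corner hd hR hS' hSR⟩
  · intro b hb
    obtain ⟨h1, h2⟩ := Finset.mem_Icc.1 hb
    refine Finset.mem_filter.2 ⟨simplexFrom_mem_simplices hΛ h1 (hneg h2), fun x hx => ?_⟩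
    exact (mem_simplexFrom_iff hΛ h1 x).2 fun p => (h2 p).trans ((mem_iff_corner_le hS').1 hx p)
  · intro R hR
    exact simplexFrom_corner (Finset.mem_filter.1 hR).1
  · intro b hb
    obtain ⟨h1, h2⟩ := Finset.mem_Icc.1 hb
    exact corner_simplexFrom hd hΛ h1 (hneg h2)
  · intro R hR
    have hR := (Finset.mem_filter.1 hR).1
    rw [simplicesFrom_eq_simplices, outerFaces, growthFaces, simplexFrom_corner hR]

end Growth

/-! ### Summing histories over the simplices through a given site. -/

section LatticeSums

variable {d : ℕ} {Λ : Finset (SimplicialLattice d)}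

theorem nonempty_of_mem_simplices {T : Finset (SimplicialLattice d)} (h : T ∈ simplices Λ) :
    T.Nonempty :=
  (mem_simplices.1 h).2.nonempty

theorem simplices_mono {R : Finset (SimplicialLattice d)} (h : R ⊆ Λ) :
    simplices R ⊆ simplices Λ := fun _ hT =>
  mem_simplices.2 ⟨(mem_simplices.1 hT).1.trans h, (mem_simplices.1 hT).2⟩

theorem sum_simplices_le (hd : 1 ≤ d) {g : Finset (SimplicialLattice d) → ℝ} (hg : ∀ T, 0 ≤ g T)
    {τ : ℝ} (hτ : ∀ x, ∑ T ∈ simplices Λ with x ∈ T, g T ≤ τ) (hτ0 : 0 ≤ τ)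
    {R : Finset (SimplicialLattice d)} (hR : R ∈ simplices Λ) :
    ∑ T ∈ simplices R, g T ≤ ((latticeDiam R : ℝ) + 1) ^ d * τ := by
  obtain ⟨hRΛ, hR⟩ := mem_simplices.1 hR
  have h1 : ∑ T ∈ simplices R, g T ≤ ∑ T ∈ simplices Λ with ¬ Disjoint R T, g T := by
    refine Finset.sum_le_sum_of_subset_of_nonneg (fun T hT => ?_) fun _ _ _ => hg _
    refine Finset.mem_filter.2 ⟨simplices_mono hRΛ hT, ?_⟩
    obtain ⟨x, hx⟩ := nonempty_of_mem_simplices hT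
    exact Finset.not_disjoint_iff.2 ⟨x, (mem_simplices.1 hT).1 hx, hx⟩
  have h2 : (R.card : ℝ) ≤ ((latticeDiam R : ℝ) + 1) ^ d := by
    exact_mod_cast card_simplex_le hd hR
  exact (h1.trans (sum_not_disjoint_le _ g hg R τ fun x _ => hτ x)).trans
    (mul_le_mul_of_nonneg_right h2 hτ0)

/-- Used for the terms that do not spread: every term inside `R` may act, at most `(diam R + 1) ^ d`
points count them, and the decay converts this volume into `E ^ d`. -/
theorem sum_decay_mul_sum_simplices_le (hd : 1 ≤ d) {g o : Finset (SimplicialLattice d) → ℝ}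
    (hg : ∀ T, 0 ≤ g T) (ho : ∀ S, 0 ≤ o S) {τ b E K : ℝ} (hE : 1 ≤ E)
    (hτ : ∀ x, ∑ T ∈ simplices Λ with x ∈ T, g T ≤ τ) (hτ0 : 0 ≤ τ)
    (hb : ∀ x, ∑ S ∈ simplices Λ with x ∈ S, o S ≤ b) (hK0 : 0 ≤ K)
    {ω : ℕ → ℝ} (hω : ∀ m, 0 ≤ ω m) {N : ℕ} (hK : ∀ m : ℕ, ω m * (1 + m / E) ^ N ≤ K)
    (hN : d ≤ N) (i : SimplicialLattice d) :
    ∑ R ∈ simplices Λ with i ∈ R, ω (latticeDiam R) * o R * ∑ T ∈ simplices R, g T ≤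
      K * E ^ d * τ * b := by
  calc _ ≤ ∑ R ∈ simplices Λ with i ∈ R, K * E ^ d * τ * o R := by
        refine Finset.sum_le_sum fun R hR => ?_
        have h1 := sum_simplices_le hd hg hτ hτ0 (Finset.mem_filter.1 hR).1
        have h2 := mul_pow_mul_pow_le hE (hω _) (hK (latticeDiam R)) (k := d) (j := 0) (by omega)
        rw [pow_zero, mul_one] at h2
        calc _ ≤ ω (latticeDiam R) * o R * (((latticeDiam R : ℝ) + 1) ^ d * τ) :=
              mul_le_mul_of_nonneg_left h1 (mul_nonneg (hω _) (ho _))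
          _ = ω (latticeDiam R) * ((latticeDiam R : ℝ) + 1) ^ d * (τ * o R) := by ring
          _ ≤ K * E ^ d * (τ * o R) := mul_le_mul_of_nonneg_right h2 (mul_nonneg hτ0 (ho R))
          _ = _ := by ring
    _ ≤ _ := by
        rw [← Finset.mul_sum]
        exact mul_le_mul_of_nonneg_left (hb i) (by positivity)

theorem sum_ite_le_of_unique {β : Type*} [DecidableEq β] (A : Finset β) (p : β → Prop) [DecidablePred p] (f : β → ℝ)
    (c : ℝ) (hc : 0 ≤ c) (x₀ : β) (h : ∀ x ∈ A, p x → x = x₀) (hf : ∀ x ∈ A, p x → f x ≤ c) :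
    ∑ x ∈ A with p x, f x ≤ c := by
  have hsub : A.filter p ⊆ {x₀} := fun x hx => by
    obtain ⟨h1, h2⟩ := Finset.mem_filter.1 hx
    exact Finset.mem_singleton.2 (h x h1 h2)
  rcases Finset.subset_singleton_iff.1 hsub with h0 | h0
  · simpa [h0] using hc
  · have hx : x₀ ∈ A.filter p := by simp [h0]
    obtain ⟨h1, h2⟩ := Finset.mem_filter.1 hx
    simpa [h0] using hf x₀ h1 h2

/-- Summing over all simplices, each weighed by the distance of one of its points from `i`. -/
theorem sum_mul_inv_pow_le {o : Finset (SimplicialLattice d) → ℝ} (ho : ∀ S, 0 ≤ o S) {b E : ℝ}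
    (hE : 1 ≤ E) (hb0 : 0 ≤ b) (hb : ∀ x, ∑ S ∈ simplices Λ with x ∈ S, o S ≤ b)
    (j : Finset (SimplicialLattice d) → SimplicialLattice d)
    (hj : ∀ S ∈ simplices Λ, j S ∈ S) (i : SimplicialLattice d) :
    ∑ S ∈ simplices Λ, o S * ((1 + ((Finset.univ.sup fun q : Fin (d + 1) =>
        ((j S).1 q - i.1 q).natAbs : ℕ) : ℝ) / E) ^ (2 * d))⁻¹ ≤ (3 * E) ^ d * b := by
  have hE0 : 0 < E := by linarith
  set D : SimplicialLattice d → ℕ := fun x =>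
    Finset.univ.sup fun q : Fin (d + 1) => (x.1 q - i.1 q).natAbs with hD
  have hpos (x : SimplicialLattice d) : 0 ≤ ((1 + (D x : ℝ) / E) ^ (2 * d))⁻¹ := by positivity
  calc ∑ S ∈ simplices Λ, o S * ((1 + (D (j S) : ℝ) / E) ^ (2 * d))⁻¹
      ≤ ∑ S ∈ simplices Λ, ∑ x ∈ Λ, if x ∈ S then o S * ((1 + (D x : ℝ) / E) ^ (2 * d))⁻¹ else 0 := by
        refine Finset.sum_le_sum fun S hS => ?_
        have h1 := Finset.single_le_sum
          (f := fun x => if x ∈ S then o S * ((1 + (D x : ℝ) / E) ^ (2 * d))⁻¹ else 0)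
          (fun x _ => by split_ifs; exacts [mul_nonneg (ho S) (hpos x), le_rfl])
          ((mem_simplices.1 hS).1 (hj S hS))
        simpa [hj S hS] using h1
    _ = ∑ x ∈ Λ, ((1 + (D x : ℝ) / E) ^ (2 * d))⁻¹ * ∑ S ∈ simplices Λ with x ∈ S, o S := by
        rw [Finset.sum_comm]
        refine Finset.sum_congr rfl fun x _ => ?_
        rw [Finset.mul_sum, Finset.sum_filter]
        exact Finset.sum_congr rfl fun S _ => by split_ifs <;> ring
    _ ≤ ∑ x ∈ Λ, ((1 + (D x : ℝ) / E) ^ (2 * d))⁻¹ * b :=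
        Finset.sum_le_sum fun x _ => mul_le_mul_of_nonneg_left (hb x) (hpos x)
    _ ≤ _ := by
        rw [← Finset.sum_mul]
        refine mul_le_mul_of_nonneg_right ?_ hb0
        -- A lattice point is fixed by its first `d` coordinates, so the sum over positions costs `E
        -- ^ d` and not `E ^ (d + 1)`.
        have := sum_inv_pow_le hE Λ (fun x (q : Fin d) => x.1 q.castSucc)
          (fun x _ y _ h => eq_of_apply_eq_of_ne (Fin.last d) fun p hp => by
            have := congrFun h (p.castPred hp)
            simpa using this) (fun q => i.1 q.castSucc) D
          (fun x _ q => Finset.le_sup (f := fun q : Fin (d + 1) => (x.1 q - i.1 q).natAbs)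
            (Finset.mem_univ q.castSucc))
        simpa using this

/-- Contribution of the histories with a single step. -/
theorem sum_historySum_one_le (hd : 1 ≤ d)
    {w o : Finset (SimplicialLattice d) → ℝ}
    (hw : ∀ T, 0 ≤ w T) (ho : ∀ S, 0 ≤ o S) {τ b E K : ℝ} (hE : 1 ≤ E)
    (hτ : ∀ x, ∑ T ∈ simplices Λ with x ∈ T, w T ≤ τ) (hτ0 : 0 ≤ τ) (hb0 : 0 ≤ b)
    (hb : ∀ x, ∑ S ∈ simplices Λ with x ∈ S, o S ≤ b) (hK0 : 0 ≤ K)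
    {ω : ℕ → ℝ} (hω : ∀ m, 0 ≤ ω m) {N : ℕ} (hK : ∀ m : ℕ, ω m * (1 + m / E) ^ N ≤ K)
    (hN : 3 * d - 1 ≤ N) (i : SimplicialLattice d) :
    ∑ R ∈ simplices Λ with i ∈ R, ∑ S ∈ simplices R with S ≠ R, ω (latticeDiam R) * (o S *
      historySum (simplices R) w S (fun Q => if Q = [] then 1 else 0) 1 (growthFaces S R)) ≤
      K * (d + 1) * 3 ^ d * E ^ (2 * d - 1) * τ * b := by
  classical
  have hE0 : 0 < E := by linarith
  have : Nonempty (SimplicialLattice d) := ⟨i⟩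
  choose! j hj using fun S (hS : S ∈ simplices Λ) => nonempty_of_mem_simplices hS
  set D : Finset (SimplicialLattice d) → ℕ := fun S =>
    Finset.univ.sup fun q : Fin (d + 1) => ((j S).1 q - i.1 q).natAbs with hD
  -- The triples in which the single step `T` takes `S` to `R`. Then `R` is the join of `S` and `T`,
  -- so the sum over `R` collapses; and `T` meets the boundary of `S`, which saves one power of the
  -- diameter.
  let C (R S T : Finset (SimplicialLattice d)) : Prop :=
    i ∈ R ∧ S ⊆ R ∧ S ≠ R ∧ T ⊆ R ∧ ¬ Disjoint T S ∧ ∀ X ∈ growthFaces S R, ¬ Disjoint X T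
  have hC {R S T : Finset (SimplicialLattice d)} (hR : R ∈ simplices Λ) (hS : S ∈ simplices Λ)
      (hT : T ∈ simplices Λ) (h : C R S T) :
      R = simplexFrom Λ (corner S ⊓ corner T) ∧
        ¬ Disjoint (Finset.univ.biUnion (simplexFace S)) T := by
    obtain ⟨-, hSR, hne, hTR, hTS, hX⟩ := h
    have hR' := (mem_simplices.1 hR).2
    have hS' := (mem_simplices.1 hS).2
    have hT' := (mem_simplices.1 hT).2
    have hcS := corner_le_corner hd hR' hS' hSR
    have hcT := corner_le_corner hd hR' hT' hTR
    have hcorner : corner R = corner S ⊓ corner T := by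
      refine le_antisymm (le_inf hcS hcT) fun p => ?_
      rcases (hcS p).lt_or_eq with hp | hp
      · obtain ⟨x, hxX, hxT⟩ := Finset.not_disjoint_iff.1
          (hX _ (mem_growthFaces.2 ⟨p, hp, rfl⟩))
        rw [← (Finset.mem_filter.1 hxX).2]
        exact inf_le_right.trans ((mem_iff_corner_le hT').1 hxT p)
      · rw [hp]; exact inf_le_left
    have hRe : R = simplexFrom Λ (corner S ⊓ corner T) := by
      rw [← hcorner, simplexFrom_corner hR]
    refine ⟨hRe, exists_mem_simplexFace hd hS' hT' (fun h => hTS h.symm) fun hTS' => hne ?_⟩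
    rw [hRe, inf_eq_left.2 (corner_le_corner hd hS' hT' hTS'), simplexFrom_corner hS]
  -- Since `R` contains both `S` and `i`, its decay controls the diameter of `S` and the distance of
  -- `j S` from `i` at once.
  have hbound {R S T : Finset (SimplicialLattice d)} (hR : R ∈ simplices Λ) (hS : S ∈ simplices Λ)
      (h : C R S T) : ω (latticeDiam R) ≤
        K * E ^ (d - 1) * ((((latticeDiam S : ℝ) + 1) ^ (d - 1))⁻¹ *
          ((1 + (D S : ℝ) / E) ^ (2 * d))⁻¹) := by
    obtain ⟨hi, hSR, -⟩ := h
    have h1 := mul_pow_mul_pow_le hE (hω _) (hK (latticeDiam R)) (k := d - 1) (j := 2 * d)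
      (by omega)
    have h2 : latticeDiam S ≤ latticeDiam R :=
      latticeDiam_mono hd (mem_simplices.1 hR).2 (mem_simplices.1 hS).2 hSR
    have h3 : D S ≤ latticeDiam R := Finset.sup_le fun q _ => by
      have := abs_le.1 (apply_sub_le hd (mem_simplices.1 hR).2 (hSR (hj S hS)) hi q)
      omega
    have h2' : (latticeDiam S : ℝ) ≤ latticeDiam R := by exact_mod_cast h2
    have h3' : (D S : ℝ) ≤ latticeDiam R := by exact_mod_cast h3
    rw [← mul_inv, ← div_eq_mul_inv, le_div_iff₀ (by positivity)]
    refine le_trans ?_ h1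
    rw [mul_assoc]
    refine mul_le_mul_of_nonneg_left ?_ (hω _)
    gcongr
  calc _ ≤ ∑ R ∈ simplices Λ, ∑ S ∈ simplices Λ, ∑ T ∈ simplices Λ,
        if C R S T then ω (latticeDiam R) * (o S * w T) else 0 := by
        rw [Finset.sum_filter]
        refine Finset.sum_le_sum fun R hR => ?_
        have hnn (S T : Finset (SimplicialLattice d)) :
            0 ≤ if C R S T then ω (latticeDiam R) * (o S * w T) else 0 := by
          split_ifs
          exacts [mul_nonneg (hω _) (mul_nonneg (ho S) (hw T)), le_rfl]
        split_ifs with hi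
        · refine (Finset.sum_le_sum fun S hS => ?_).trans (Finset.sum_le_sum_of_subset_of_nonneg
            ((Finset.filter_subset (· ≠ R) (simplices R)).trans (simplices_mono (mem_simplices.1 hR).1))
            fun S _ _ => Finset.sum_nonneg fun T _ => hnn S T)
          obtain ⟨hS, hSR⟩ := Finset.mem_filter.1 hS
          calc _ ≤ ω (latticeDiam R) * (o S * ∑ T ∈ simplices R with
                ¬ Disjoint T S ∧ ∀ X ∈ growthFaces S R, ¬ Disjoint X T, w T) :=
                mul_le_mul_of_nonneg_left (mul_le_mul_of_nonneg_left
                  (historySum_one_le _ w hw S _) (ho S)) (hω _)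
            _ = ∑ T ∈ simplices R, if C R S T then ω (latticeDiam R) * (o S * w T) else 0 := by
                rw [Finset.sum_filter, Finset.mul_sum, Finset.mul_sum]
                refine Finset.sum_congr rfl fun T hT => ?_
                simp only [C, hi, (mem_simplices.1 hS).1, hSR, (mem_simplices.1 hT).1, true_and,
                  ne_eq, not_false_iff]
                split_ifs <;> simp
            _ ≤ _ := Finset.sum_le_sum_of_subset_of_nonneg
                (simplices_mono (mem_simplices.1 hR).1) fun T _ _ => hnn S T
        · exact Finset.sum_nonneg fun S _ => Finset.sum_nonneg fun T _ => hnn S T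
    _ = ∑ S ∈ simplices Λ, ∑ T ∈ simplices Λ, ∑ R ∈ simplices Λ,
        if C R S T then ω (latticeDiam R) * (o S * w T) else 0 := by
        rw [Finset.sum_comm]
        exact Finset.sum_congr rfl fun S _ => Finset.sum_comm
    _ ≤ ∑ S ∈ simplices Λ, ∑ T ∈ simplices Λ,
        if ¬ Disjoint (Finset.univ.biUnion (simplexFace S)) T then
          K * E ^ (d - 1) * ((((latticeDiam S : ℝ) + 1) ^ (d - 1))⁻¹ *
          ((1 + (D S : ℝ) / E) ^ (2 * d))⁻¹) * (o S * w T) else 0 := by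
        refine Finset.sum_le_sum fun S hS => Finset.sum_le_sum fun T hT => ?_
        rw [← Finset.sum_filter]
        have hnn : 0 ≤ K * E ^ (d - 1) * ((((latticeDiam S : ℝ) + 1) ^ (d - 1))⁻¹ *
          ((1 + (D S : ℝ) / E) ^ (2 * d))⁻¹) * (o S * w T) :=
          mul_nonneg (by positivity) (mul_nonneg (ho S) (hw T))
        by_cases hdis : Disjoint (Finset.univ.biUnion (simplexFace S)) T
        · rw [if_neg (not_not.2 hdis), Finset.filter_false_of_mem, Finset.sum_empty]
          exact fun R hR h => (hC hR hS hT h).2 hdis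
        · rw [if_pos hdis]
          refine sum_ite_le_of_unique _ _ _ _ hnn (simplexFrom Λ (corner S ⊓ corner T))
            (fun R hR h => (hC hR hS hT h).1) fun R hR h => ?_
          exact mul_le_mul_of_nonneg_right (hbound hR hS h) (mul_nonneg (ho S) (hw T))
    _ ≤ ∑ S ∈ simplices Λ, K * (d + 1) * E ^ (d - 1) * τ *
        (o S * ((1 + (D S : ℝ) / E) ^ (2 * d))⁻¹) := by
        refine Finset.sum_le_sum fun S hS => ?_
        rw [← Finset.sum_filter]
        have h1 := sum_not_disjoint_le (simplices Λ) w hw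
          (Finset.univ.biUnion (simplexFace S)) τ fun x _ => hτ x
        have h2 : ((Finset.univ.biUnion (simplexFace S)).card : ℝ) ≤
            (d + 1) * ((latticeDiam S : ℝ) + 1) ^ (d - 1) := by
          exact_mod_cast card_boundary_le hd (mem_simplices.1 hS).2
        have h3 := h1.trans (mul_le_mul_of_nonneg_right h2 hτ0)
        simp only [← Finset.mul_sum]
        have h4 : 0 < ((latticeDiam S : ℝ) + 1) ^ (d - 1) := by positivity
        calc _ ≤ K * E ^ (d - 1) * ((((latticeDiam S : ℝ) + 1) ^ (d - 1))⁻¹ *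
            ((1 + (D S : ℝ) / E) ^ (2 * d))⁻¹) *
            (o S * ((d + 1) * ((latticeDiam S : ℝ) + 1) ^ (d - 1) * τ)) :=
              mul_le_mul_of_nonneg_left (mul_le_mul_of_nonneg_left h3 (ho S)) (by positivity)
          _ = _ := by field_simp
    _ ≤ K * (d + 1) * E ^ (d - 1) * τ * ((3 * E) ^ d * b) := by
        rw [← Finset.mul_sum]
        exact mul_le_mul_of_nonneg_left (sum_mul_inv_pow_le ho hE hb0 hb j hj i) (by positivity)
    _ = _ := by
        rw [show 2 * d - 1 = (d - 1) + d by omega, pow_add, mul_pow]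
        ring

/-- The targets depend on `S` only through the set `P` of directions of growth; summing over all `2
^ (d + 1)` sets `P` decouples them from `S`. A face has at most `(diam R + 1) ^ (d - 1)` points, and
this factor is paid once per step or once per face, whichever is cheaper. -/
theorem sum_historySum_growthFaces_le (hd : 1 ≤ d) {w o : Finset (SimplicialLattice d) → ℝ}
    (hw : ∀ T, 0 ≤ w T) (ho : ∀ S, 0 ≤ o S) {u b : ℝ}
    (hu : ∀ x, ∑ T ∈ simplices Λ with x ∈ T, w T * T.card ≤ u) (hu0 : 0 ≤ u) (hb0 : 0 ≤ b)
    (hb : ∀ x, ∑ S ∈ simplices Λ with x ∈ S, o S ≤ b) {R : Finset (SimplicialLattice d)}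
    (hR : R ∈ simplices Λ) (n : ℕ) :
    ∑ S ∈ simplices R, o S * historySum (simplices R) w S (fun Q => if Q = [] then 1 else 0) (n + 1)
        (growthFaces S R) ≤
      2 ^ (d + 1) * (b * (2 * (d + 1) * u) ^ (n + 1) *
        (((latticeDiam R : ℝ) + 1) ^ (d - 1)) ^ min (n + 1) (d + 1)) := by
  classical
  obtain ⟨hRΛ, hR⟩ := mem_simplices.1 hR
  let L (P : Finset (Fin (d + 1))) : List (Finset (SimplicialLattice d)) :=
    ((List.finRange (d + 1)).filter fun p => p ∈ P).map (simplexFace R)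
  have hL (P : Finset (Fin (d + 1))) : (L P).length ≤ d + 1 := by
    rw [List.length_map]
    exact (List.length_filter_le _ _).trans_eq (by simp)
  set F : ℝ := ((latticeDiam R : ℝ) + 1) ^ (d - 1) with hFdef
  have hF : 1 ≤ F := one_le_pow₀ (by linarith [(Nat.cast_nonneg (latticeDiam R) : (0 : ℝ) ≤ _)])
  have hfilter {v : Finset (SimplicialLattice d) → ℝ} (hv : ∀ T, 0 ≤ v T)
      (x : SimplicialLattice d) : ∑ T ∈ simplices R with x ∈ T, v T ≤
        ∑ T ∈ simplices Λ with x ∈ T, v T :=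
    Finset.sum_le_sum_of_subset_of_nonneg (Finset.filter_subset_filter _ (simplices_mono hRΛ))
      fun _ _ _ => hv _
  have hu' (x : SimplicialLattice d) : ∑ T ∈ simplices R with x ∈ T, w T * T.card ≤ u :=
    (hfilter (fun T => mul_nonneg (hw T) (Nat.cast_nonneg _)) x).trans (hu x)
  have hb' (x : SimplicialLattice d) : ∑ S ∈ simplices R with x ∈ S, o S ≤ b :=
    (hfilter ho x).trans (hb x)
  have hface (P : Finset (Fin (d + 1))) : ∀ X ∈ L P, (X.card : ℝ) ≤ F := by
    intro X hX
    obtain ⟨p, -, rfl⟩ := List.mem_map.1 hX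
    rw [hFdef]
    exact_mod_cast card_simplexFace_le hd hR p
  have hprod (c : Finset (SimplicialLattice d) → ℝ) (C : ℝ) (hC : 1 ≤ C) (hc : ∀ X, 1 ≤ c X)
      (l : List (Finset (SimplicialLattice d))) (h : ∀ X ∈ l, c X ≤ C) :
      (l.map c).prod ≤ C ^ l.length := by
    induction l with
    | nil => simp
    | cons X l ih =>
      rw [List.map_cons, List.prod_cons, List.length_cons, pow_succ']
      have h1 := ih fun Y hY => h Y (List.mem_cons_of_mem _ hY)
      have h0 : 0 ≤ (l.map c).prod := List.prod_nonneg fun y hy => by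
        obtain ⟨Y, -, rfl⟩ := List.mem_map.1 hy
        linarith [hc Y]
      exact mul_le_mul (h X (by simp)) h1 h0 (by linarith)
  have hP (P : Finset (Fin (d + 1))) :
      ∑ S ∈ simplices R, o S * historySum (simplices R) w S (fun Q => if Q = [] then 1 else 0)
        (n + 1) (L P) ≤ b * (2 * (d + 1) * u) ^ (n + 1) * F ^ min (n + 1) (d + 1) := by
    have key {F' : ℝ} (hF' : 1 ≤ F') := sum_mul_historySum_le (simplices R) (simplices R) w o hw ho
      hF' hb0 (fun T hT => nonempty_of_mem_simplices hT) hu' hu0 hb' n (L P) (hL P)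
    push_cast at key
    rcases min_choice (n + 1) (d + 1) with h | h <;> rw [h]
    · refine (key hF).trans ?_
      have h1 := hprod (fun X => max 1 (X.card / F)) 1 le_rfl (fun X => le_max_left _ _) (L P)
        fun X hX => max_le le_rfl (div_le_one_of_le₀ (hface P X hX) (by linarith))
      rw [one_pow] at h1
      calc _ ≤ b * (2 * (d + 1) * F * u) ^ (n + 1) * 1 := by gcongr
        _ = b * (2 * (d + 1) * u * F) ^ (n + 1) := by ring
        _ = _ := by rw [mul_pow _ F, ← mul_assoc]
    · refine (key le_rfl).trans ?_
      have h1 := hprod (fun X => max 1 (X.card / 1)) F hF (fun X => le_max_left _ _) (L P)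
        fun X hX => max_le hF (by rw [div_one]; exact hface P X hX)
      rw [mul_one]
      have h2 := h1.trans (pow_le_pow_right₀ hF (hL P))
      gcongr
  have hnn (S : Finset (SimplicialLattice d)) (Q : List (Finset (SimplicialLattice d))) :
      0 ≤ o S * historySum (simplices R) w S (fun Q => if Q = [] then 1 else 0) (n + 1) Q :=
    mul_nonneg (ho S) (historySum_nonneg hw (fun Q => by split_ifs <;> norm_num) _ _)
  calc _ ≤ ∑ S ∈ simplices R, ∑ P : Finset (Fin (d + 1)), o S *
        historySum (simplices R) w S (fun Q => if Q = [] then 1 else 0) (n + 1) (L P) := by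
        refine Finset.sum_le_sum fun S _ => ?_
        have h1 : growthFaces S R = L (Finset.univ.filter fun p => corner R p < corner S p) := by
          simp [growthFaces, L]
        rw [h1]
        exact Finset.single_le_sum (f := fun P => o S * historySum (simplices R) w S
          (fun Q => if Q = [] then 1 else 0) (n + 1) (L P)) (fun P _ => hnn S (L P))
          (Finset.mem_univ _)
    _ = ∑ P : Finset (Fin (d + 1)), ∑ S ∈ simplices R, o S *
        historySum (simplices R) w S (fun Q => if Q = [] then 1 else 0) (n + 1) (L P) :=
        Finset.sum_comm
    _ ≤ ∑ P : Finset (Fin (d + 1)), b * (2 * (d + 1) * u) ^ (n + 1) * F ^ min (n + 1) (d + 1) :=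
        Finset.sum_le_sum fun P _ => hP P
    _ = _ := by simp

/-- Contribution of the histories with `n + 1` steps. -/
theorem sum_historySum_succ_le (hd : 1 ≤ d) {w o : Finset (SimplicialLattice d) → ℝ}
    (hw : ∀ T, 0 ≤ w T) (ho : ∀ S, 0 ≤ o S) {u b E K : ℝ} (hE : 1 ≤ E)
    (hu : ∀ x, ∑ T ∈ simplices Λ with x ∈ T, w T * T.card ≤ u) (hu0 : 0 ≤ u) (hb0 : 0 ≤ b)
    (hb : ∀ x, ∑ S ∈ simplices Λ with x ∈ S, o S ≤ b) (hK0 : 0 ≤ K)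
    {ω : ℕ → ℝ} (hω : ∀ m, 0 ≤ ω m) {N : ℕ} (hK : ∀ m : ℕ, ω m * (1 + m / E) ^ N ≤ K)
    (hN : (d - 1) * (d + 1) + 2 * (d + 1) ≤ N) (i : SimplicialLattice d) (n : ℕ) :
    ∑ R ∈ simplices Λ with i ∈ R, ∑ S ∈ simplices R, ω (latticeDiam R) * (o S *
      historySum (simplices R) w S (fun Q => if Q = [] then 1 else 0) (n + 1) (growthFaces S R)) ≤
      K * 6 ^ (d + 1) * b * (2 * (d + 1) * u) ^ (n + 1) * E ^ ((d - 1) * (n + 1) + (d + 1)) := by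
  have hE0 : 0 < E := by linarith
  calc _ ≤ ∑ R ∈ simplices Λ with i ∈ R, 2 ^ (d + 1) * (b * (2 * (d + 1) * u) ^ (n + 1)) *
        (K * E ^ ((d - 1) * (n + 1))) * ((1 + (latticeDiam R : ℝ) / E) ^ (2 * (d + 1)))⁻¹ := by
        refine Finset.sum_le_sum fun R hR => ?_
        rw [← Finset.mul_sum]
        have hm1 := min_le_left (n + 1) (d + 1)
        have hm2 := min_le_right (n + 1) (d + 1)
        have h1 := sum_historySum_growthFaces_le hd hw ho hu hu0 hb0 hb (Finset.mem_filter.1 hR).1 n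
        generalize min (n + 1) (d + 1) = k at h1 hm1 hm2
        have h2 := mul_pow_mul_pow_le hE (hω _) (hK (latticeDiam R)) (k := (d - 1) * k)
          (j := 2 * (d + 1)) (le_trans (by gcongr) hN)
        have h3 : K * E ^ ((d - 1) * k) ≤ K * E ^ ((d - 1) * (n + 1)) := by gcongr
        have h4 := h2.trans h3
        rw [← le_div_iff₀ (by positivity), div_eq_mul_inv, pow_mul] at h4
        calc _ ≤ ω (latticeDiam R) * (2 ^ (d + 1) * (b * (2 * (d + 1) * u) ^ (n + 1) *
              (((latticeDiam R : ℝ) + 1) ^ (d - 1)) ^ k)) := mul_le_mul_of_nonneg_left h1 (hω _)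
          _ = 2 ^ (d + 1) * (b * (2 * (d + 1) * u) ^ (n + 1)) * (ω (latticeDiam R) *
              (((latticeDiam R : ℝ) + 1) ^ (d - 1)) ^ k) := by ring
          _ ≤ _ := by
              rw [mul_assoc _ (K * _)]
              exact mul_le_mul_of_nonneg_left h4 (by positivity)
    _ ≤ 2 ^ (d + 1) * (b * (2 * (d + 1) * u) ^ (n + 1)) * (K * E ^ ((d - 1) * (n + 1))) *
        (3 * E) ^ (d + 1) := by
        rw [← Finset.mul_sum]
        refine mul_le_mul_of_nonneg_left ?_ (by positivity)
        -- A simplex is fixed by its `d + 1` lower bounds, each within its diameter of the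
        -- coordinates of `i`.
        have := sum_inv_pow_le hE ((simplices Λ).filter fun R => i ∈ R) corner
          (fun R hR R' hR' h => by
            rw [← simplexFrom_corner (Finset.mem_filter.1 hR).1, h,
              simplexFrom_corner (Finset.mem_filter.1 hR').1]) i.1 latticeDiam
          (fun R hR q => by
            obtain ⟨hR, hi⟩ := Finset.mem_filter.1 hR
            have h1 := (mem_iff_corner_le (mem_simplices.1 hR).2).1 hi q
            have h2 := apply_le_corner_add hd (mem_simplices.1 hR).2 hi q
            omega)
        simpa using this
    _ = _ := by
        rw [show (6 : ℝ) = 2 * 3 by norm_num, mul_pow 2 3, mul_pow 3 E, pow_add E]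
        ring

end LatticeSums

/-! ### The decomposition of the evolved operator and the bound on its pieces. -/

section Assembly

variable {d : ℕ} {Λ : Finset (SimplicialLattice d)} {q : Λ → ℕ}

theorem simplices_eq_filter {R : Finset (SimplicialLattice d)} (hR : R ⊆ Λ) :
    simplices R = (simplices Λ).filter fun S => S ⊆ R := by
  ext S
  simp only [Finset.mem_filter, mem_simplices]
  exact ⟨fun h => ⟨⟨h.1.trans hR, h.2⟩, h.1⟩, fun h => ⟨h.2, h.1.2⟩⟩

/-- The part of the evolution of `X`, supported inside `S`, that spreads exactly to `R`. -/
noncomputable def spreadPart (G : Finset (SimplicialLattice d) → LatticeOp Λ q)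
    (X : LatticeOp Λ q) (S R : Finset (SimplicialLattice d)) : LatticeOp Λ q :=
  targetDiff (truncatedEvolution G X 1) (growthFaces S R) (simplices R)

theorem supportedIn_spreadPart {G : Finset (SimplicialLattice d) → LatticeOp Λ q}
    (hG : ∀ T ∈ simplices Λ, SupportedIn T (G T)) {X : LatticeOp Λ q}
    {S R : Finset (SimplicialLattice d)} (hX : SupportedIn S X) (hSR : S ⊆ R) (hR : R ⊆ Λ) :
    SupportedIn R (spreadPart G X S R) := by
  rw [← mem_supportedAlgebra]
  refine targetDiff_mem (supportedAlgebra q R) _ _ _ fun B hB => ?_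
  rw [mem_supportedAlgebra]
  refine supportedIn_evolve ?_ (hX.mono hSR) 1
  rw [← mem_supportedAlgebra]
  refine sum_mem fun T hT => ?_
  rw [mem_supportedAlgebra]
  exact (hG T (simplices_mono hR (hB hT))).mono (mem_simplices.1 (hB hT)).1

/-- The decomposition of `e^{𝓛} O - O` by the simplices to which the terms of `O` spread. -/
noncomputable def spreadDecomposition (G O : Finset (SimplicialLattice d) → LatticeOp Λ q)
    (R : Finset (SimplicialLattice d)) : LatticeOp Λ q :=
  ∑ S ∈ simplices R, (spreadPart G (O S) S R - if S = R then O S else 0)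

theorem isLocalDecomposition_spreadDecomposition (hd : 1 ≤ d) (hΛ : IsSimplex Λ)
    {G O : Finset (SimplicialLattice d) → LatticeOp Λ q}
    (hG : ∀ T ∈ simplices Λ, SupportedIn T (G T)) (hO : ∀ T ∈ simplices Λ, SupportedIn T (O T)) :
    IsLocalDecomposition (evolve (∑ T ∈ simplices Λ, G T) 1 (∑ S ∈ simplices Λ, O S) -
      ∑ S ∈ simplices Λ, O S) (spreadDecomposition G O) := by
  refine ⟨fun R hR => ?_, ?_⟩
  · have hRΛ := (mem_simplices.1 hR).1
    rw [← mem_supportedAlgebra]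
    refine sum_mem fun S hS => sub_mem ?_ ?_
    · rw [mem_supportedAlgebra]
      exact supportedIn_spreadPart hG (hO S (simplices_mono hRΛ hS)) (mem_simplices.1 hS).1 hRΛ
    · split_ifs with h
      · subst h
        exact mem_supportedAlgebra.2 (hO S hR)
      · exact zero_mem _
  · have h1 : ∑ R ∈ simplices Λ, spreadDecomposition G O R =
        ∑ S ∈ simplices Λ, ∑ R ∈ simplices Λ with S ⊆ R,
          (spreadPart G (O S) S R - if S = R then O S else 0) := by
      simp only [spreadDecomposition, Finset.sum_filter]
      rw [Finset.sum_comm]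
      refine Finset.sum_congr rfl fun R hR => ?_
      rw [simplices_eq_filter (mem_simplices.1 hR).1, Finset.sum_filter]
    have h2 : evolve (∑ T ∈ simplices Λ, G T) 1 (∑ S ∈ simplices Λ, O S) =
        ∑ S ∈ simplices Λ, evolve (∑ T ∈ simplices Λ, G T) 1 (O S) := by
      simp only [evolve, Finset.mul_sum, Finset.sum_mul]
    rw [h1, h2, ← Finset.sum_sub_distrib]
    refine Finset.sum_congr rfl fun S hS => ?_
    rw [Finset.sum_sub_distrib]
    congr 1
    · exact sum_targetDiff_growthFaces hd hΛ (truncatedEvolution G (O S) 1) hS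
    · rw [Finset.sum_ite_eq, if_pos (by simp [hS])]

/-- For `S = R` there are no targets, and the first-order Duhamel bound suffices. -/
theorem norm_spreadPart_self_sub_le {G : Finset (SimplicialLattice d) → LatticeOp Λ q}
    (hG : ∀ T, IsSelfAdjoint (G T)) (X : LatticeOp Λ q) (R : Finset (SimplicialLattice d)) :
    ‖spreadPart G X R R - X‖ ≤ (∑ T ∈ simplices R, 2 * ‖G T‖) * ‖X‖ := by
  rw [spreadPart, growthFaces_self]
  refine (norm_evolve_one_sub_le (isSelfAdjoint_sum _ fun T _ => hG T) X).trans ?_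
  rw [adjointAction_sum, Finset.sum_mul]
  exact (norm_sum_le _ _).trans (Finset.sum_le_sum fun T _ => norm_adjointAction_le _ _)

/-- The part that spreads to `R`, bounded by sums over histories with the decay shared out. -/
theorem exp_mul_norm_spreadPart_le (hd : 1 ≤ d) (hΛ : IsSimplex Λ)
    {G : Finset (SimplicialLattice d) → LatticeOp Λ q}
    (hG : ∀ T, IsSelfAdjoint (G T)) (hGs : ∀ T ∈ simplices Λ, SupportedIn T (G T))
    {X : LatticeOp Λ q} {S R : Finset (SimplicialLattice d)} (hR : R ∈ simplices Λ)
    (hS : S ∈ simplices R) (hX : SupportedIn S X) {α κ κ' : ℝ} (hα0 : 0 < α) (hα1 : α ≤ 1)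
    (hκ : 0 ≤ κ) (N : ℕ) :
    Real.exp (κ' * (latticeDiam R : ℝ) ^ α) * ‖spreadPart G X S R‖ ≤
      ∑ n ∈ Finset.range N, ((n.factorial : ℝ))⁻¹ *
        (Real.exp ((κ' - κ) * (latticeDiam R : ℝ) ^ α) *
          (Real.exp (κ * (latticeDiam S : ℝ) ^ α) * ‖X‖ *
            historySum (simplices R) (fun T => 2 * ‖G T‖ * Real.exp (κ * (latticeDiam T : ℝ) ^ α)) S
              (fun Q => if Q = [] then 1 else 0) n (growthFaces S R))) +
      (((d + 1 : ℕ) : ℝ) * ∑ T ∈ simplices Λ, 2 * ‖G T‖) ^ N / N.factorial *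
        (2 ^ (d + 1) * (Real.exp (κ' * (latticeDiam R : ℝ) ^ α) * ‖X‖)) := by
  obtain ⟨hRΛ, hR'⟩ := mem_simplices.1 hR
  obtain ⟨hSR, hS'⟩ := mem_simplices.1 hS
  have hw (T : Finset (SimplicialLattice d)) : 0 ≤ 2 * ‖G T‖ := by positivity
  have h1 := norm_targetDiff_truncatedEvolution_le G hG (simplices R) S X
    (fun T hT h => commute_of_supportedIn h (hGs T (simplices_mono hRΛ hT)) hX)
    (fun T hT T' hT' h => commute_of_supportedIn h (hGs T (simplices_mono hRΛ hT))
      (hGs T' (simplices_mono hRΛ hT')))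
    N (growthFaces S R) (simplices R) subset_rfl zero_le_one
  simp only [one_pow, one_div] at h1
  have h2 : historySum (simplices R) (fun T => 2 * ‖G T‖) S (fun Q => 2 ^ Q.length) N
      (growthFaces S R) ≤
      (((d + 1 : ℕ) : ℝ) * ∑ T ∈ simplices Λ, 2 * ‖G T‖) ^ N * 2 ^ (d + 1) := by
    refine (historySum_le_pow hw (by positivity) (l := d + 1)
      (fun Q hQ => pow_le_pow_right₀ one_le_two hQ) N _ (length_growthFaces_le S R)).trans ?_
    have : ∑ T ∈ simplices R, 2 * ‖G T‖ ≤ ∑ T ∈ simplices Λ, 2 * ‖G T‖ :=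
      Finset.sum_le_sum_of_subset_of_nonneg (simplices_mono hRΛ) fun T _ _ => hw T
    gcongr
  have h3 (n : ℕ) : Real.exp (κ * (latticeDiam R : ℝ) ^ α) *
      historySum (simplices R) (fun T => 2 * ‖G T‖) S (fun Q => if Q = [] then 1 else 0) n
        (growthFaces S R) ≤ Real.exp (κ * (latticeDiam S : ℝ) ^ α) *
      historySum (simplices R) (fun T => 2 * ‖G T‖ * Real.exp (κ * (latticeDiam T : ℝ) ^ α)) S
        (fun Q => if Q = [] then 1 else 0) n (growthFaces S R) := by
    refine exp_mul_historySum_le (P := fun J => J ∈ simplices Λ) (fun J T hJ hT h => ?_) hα0 hα1 hκ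
      hw (simplices_mono hRΛ hS) n _ _ fun J hJ hSJ hX => ?_
    · obtain ⟨g1, g2, g3, g4⟩ := exists_join hd hΛ hJ (simplices_mono hRΛ hT) fun h' => h h'.symm
      exact ⟨_, g1, g2, g3, g4⟩
    · have hJ' := (mem_simplices.1 hJ).2
      have g1 := latticeDiam_eq hd hR'
      have g2 := latticeDiam_eq hd hJ'
      -- A simplex that contains `S` and meets every growth face has all its lower bounds at most
      -- those of `R`, hence at least the diameter of `R`.
      have g3 : ∑ p, corner J p ≤ ∑ p, corner R p := by
        refine Finset.sum_le_sum fun p _ => ?_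
        rcases (corner_le_corner hd hR' hS' hSR p).lt_or_eq with hp | hp
        · obtain ⟨x, hxX, hxJ⟩ := Finset.not_disjoint_iff.1
            (hX _ (mem_growthFaces.2 ⟨p, hp, rfl⟩))
          rw [← (Finset.mem_filter.1 hxX).2]
          exact (mem_iff_corner_le hJ').1 hxJ p
        · rw [hp]; exact corner_le_corner hd hJ' hS' hSJ p
      omega
  set W := fun n => historySum (simplices R) (fun T => 2 * ‖G T‖) S
    (fun Q => if Q = [] then 1 else 0) n (growthFaces S R) with hW
  calc _ ≤ Real.exp (κ' * (latticeDiam R : ℝ) ^ α) *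
        ((∑ n ∈ Finset.range N, ((n.factorial : ℝ))⁻¹ * W n + ((N.factorial : ℝ))⁻¹ *
          ((((d + 1 : ℕ) : ℝ) * ∑ T ∈ simplices Λ, 2 * ‖G T‖) ^ N * 2 ^ (d + 1))) * ‖X‖) := by
        refine mul_le_mul_of_nonneg_left (h1.trans ?_) (Real.exp_nonneg _)
        gcongr
    _ = ∑ n ∈ Finset.range N, ((n.factorial : ℝ))⁻¹ *
          (Real.exp ((κ' - κ) * (latticeDiam R : ℝ) ^ α) *
            (‖X‖ * (Real.exp (κ * (latticeDiam R : ℝ) ^ α) * W n))) +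
        (((d + 1 : ℕ) : ℝ) * ∑ T ∈ simplices Λ, 2 * ‖G T‖) ^ N / N.factorial *
        (2 ^ (d + 1) * (Real.exp (κ' * (latticeDiam R : ℝ) ^ α) * ‖X‖)) := by
        have e : Real.exp (κ' * (latticeDiam R : ℝ) ^ α) =
            Real.exp ((κ' - κ) * (latticeDiam R : ℝ) ^ α) *
              Real.exp (κ * (latticeDiam R : ℝ) ^ α) := by
          rw [← Real.exp_add]; congr 1; ring
        rw [add_mul, mul_add, Finset.sum_mul, Finset.mul_sum]
        congr 1
        · refine Finset.sum_congr rfl fun n _ => ?_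
          rw [e]; ring
        · ring
    _ ≤ _ := by
        refine add_le_add_left (Finset.sum_le_sum fun n _ => ?_) _
        refine mul_le_mul_of_nonneg_left (mul_le_mul_of_nonneg_left ?_ (Real.exp_nonneg _))
          (by positivity)
        calc _ ≤ ‖X‖ * _ := mul_le_mul_of_nonneg_left (h3 n) (norm_nonneg X)
          _ = _ := by ring

end Assembly

/-! ### Power counting and summation of the series. -/

section Bound

/-- With `n + 2` steps, one factor `τ` is kept and the other `n + 1` absorb `E ^ (3 * d + 1)` each.
The tightest case is two steps, where `5 * d - 1` powers of `E` are compared with `5 * d`. -/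
theorem pow_mul_pow_le_of_mul_pow_le {d : ℕ} (hd : 1 ≤ d) {τ E C : ℝ} (hτ : 0 ≤ τ) (hE : 1 ≤ E)
    (hC : 1 ≤ C) (h : τ * E ^ (3 * d + 1) ≤ C) (n : ℕ) :
    (E ^ d * τ) ^ (n + 2) * E ^ ((d - 1) * (n + 2) + (d + 1)) ≤
      τ * E ^ (2 * d - 1) * C ^ (n + 2) := by
  have hE0 : 0 < E := by linarith
  obtain ⟨e, rfl⟩ : ∃ e, d = e + 1 := ⟨d - 1, by omega⟩
  have hexp : (e + 1) * (n + 2) + ((e + 1 - 1) * (n + 2) + (e + 1 + 1)) ≤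
      (3 * (e + 1) + 1) * (n + 1) + (2 * (e + 1) - 1) := by
    have : 2 * (e + 1) - 1 = 2 * e + 1 := by omega
    rw [this, Nat.add_sub_cancel]
    nlinarith [Nat.zero_le (e * n), Nat.zero_le n]
  calc _ = τ * τ ^ (n + 1) * E ^ ((e + 1) * (n + 2) + ((e + 1 - 1) * (n + 2) + (e + 1 + 1))) := by
        rw [mul_pow, ← pow_mul, pow_add E ((e + 1) * (n + 2))]; ring
    _ ≤ τ * τ ^ (n + 1) * E ^ ((3 * (e + 1) + 1) * (n + 1) + (2 * (e + 1) - 1)) := by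
        gcongr
    _ = τ * E ^ (2 * (e + 1) - 1) * (τ * E ^ (3 * (e + 1) + 1)) ^ (n + 1) := by
        rw [mul_pow, ← pow_mul, pow_add]; ring
    _ ≤ τ * E ^ (2 * (e + 1) - 1) * C ^ (n + 1) := by gcongr
    _ ≤ _ := by
        gcongr
        omega

variable {d : ℕ} {Λ : Finset (SimplicialLattice d)} {q : Λ → ℕ}

/-- The norm bound for given decompositions of the generator and of the operator. -/
theorem kappaNorm_evolve_sub_le (hd : 1 ≤ d) (hΛ : IsSimplex Λ) {α κ δ E K τ b C : ℝ}
    (hα0 : 0 < α) (hα1 : α ≤ 1) (hδ : 0 < δ) (hδκ : δ ≤ κ) (hE : 1 ≤ E) (hK0 : 0 ≤ K)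
    (hK : ∀ m : ℕ, Real.exp (-(δ / 2) * (m : ℝ) ^ α) * (1 + m / E) ^ ((d + 1) ^ 2) ≤ K)
    {G O : Finset (SimplicialLattice d) → LatticeOp Λ q} (hG : ∀ T, IsSelfAdjoint (G T))
    (hGs : ∀ T ∈ simplices Λ, SupportedIn T (G T)) (hOs : ∀ T ∈ simplices Λ, SupportedIn T (O T))
    (hτ : ∀ x, ∑ T ∈ simplices Λ with x ∈ T,
      Real.exp (κ * (latticeDiam T : ℝ) ^ α) * ‖G T‖ ≤ τ)
    (hb : ∀ x, ∑ T ∈ simplices Λ with x ∈ T,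
      Real.exp (κ * (latticeDiam T : ℝ) ^ α) * ‖O T‖ ≤ b)
    (hτ0 : 0 ≤ τ) (hb0 : 0 ≤ b) (hC : 1 ≤ C) (hτC : τ * E ^ (3 * d + 1) ≤ C) :
    kappaNorm α (κ - δ) (evolve (∑ T ∈ simplices Λ, G T) 1 (∑ S ∈ simplices Λ, O S) -
      ∑ S ∈ simplices Λ, O S) ≤
      (2 * K + 2 * K * (d + 1) * 3 ^ d + K * 6 ^ (d + 1) * Real.exp (4 * (d + 1) * K * C)) *
        E ^ (2 * d - 1) * τ * b := by
  have hE0 : 0 < E := by linarith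
  have hκ : 0 ≤ κ - δ / 2 := by linarith
  -- The loss `δ` is spent in two halves: from `κ` to `κ - δ / 2` on the cardinalities of the terms,
  -- from there to `κ - δ` on the sums over `R`.
  set ω : ℕ → ℝ := fun m => Real.exp (-(δ / 2) * (m : ℝ) ^ α) with hωdef
  have hω (m : ℕ) : 0 ≤ ω m := Real.exp_nonneg _
  set o : Finset (SimplicialLattice d) → ℝ :=
    fun S => Real.exp ((κ - δ / 2) * (latticeDiam S : ℝ) ^ α) * ‖O S‖ with ho'
  set w : Finset (SimplicialLattice d) → ℝ :=
    fun T => 2 * ‖G T‖ * Real.exp ((κ - δ / 2) * (latticeDiam T : ℝ) ^ α) with hw'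
  have ho (S : Finset (SimplicialLattice d)) : 0 ≤ o S := by positivity
  have hw (S : Finset (SimplicialLattice d)) : 0 ≤ w S := by positivity
  have hle (m : ℕ) : Real.exp ((κ - δ / 2) * (m : ℝ) ^ α) ≤ Real.exp (κ * (m : ℝ) ^ α) := by
    have : (κ - δ / 2) * (m : ℝ) ^ α ≤ κ * (m : ℝ) ^ α := by gcongr; linarith
    exact Real.exp_le_exp.2 this
  have hsplit (m : ℕ) : Real.exp ((κ - δ / 2) * (m : ℝ) ^ α) = ω m * Real.exp (κ * (m : ℝ) ^ α) := by
    rw [hωdef, ← Real.exp_add]; congr 1; ring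
  have hsplit' (m : ℕ) : Real.exp ((κ - δ) * (m : ℝ) ^ α) =
      ω m * Real.exp ((κ - δ / 2) * (m : ℝ) ^ α) := by
    rw [hωdef, ← Real.exp_add]; congr 1; ring
  have hob (x : SimplicialLattice d) : ∑ S ∈ simplices Λ with x ∈ S, o S ≤ b :=
    (Finset.sum_le_sum fun S _ => mul_le_mul_of_nonneg_right (hle _) (norm_nonneg _)).trans (hb x)
  have hwτ (x : SimplicialLattice d) : ∑ T ∈ simplices Λ with x ∈ T, w T ≤ 2 * τ := by
    refine le_trans ?_ (mul_le_mul_of_nonneg_left (hτ x) two_pos.le)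
    rw [Finset.mul_sum]
    refine Finset.sum_le_sum fun T _ => ?_
    calc w T ≤ 2 * ‖G T‖ * Real.exp (κ * (latticeDiam T : ℝ) ^ α) :=
          mul_le_mul_of_nonneg_left (hle _) (by positivity)
      _ = _ := by ring
  have hgτ (x : SimplicialLattice d) : ∑ T ∈ simplices Λ with x ∈ T, 2 * ‖G T‖ ≤ 2 * τ := by
    refine (Finset.sum_le_sum fun T _ => ?_).trans (hwτ x)
    exact le_mul_of_one_le_right (by positivity) (Real.one_le_exp (by positivity))
  have hu (x : SimplicialLattice d) : ∑ T ∈ simplices Λ with x ∈ T, w T * T.card ≤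
      2 * K * E ^ d * τ := by
    refine le_trans ?_ (mul_le_mul_of_nonneg_left (hτ x) (by positivity))
    rw [Finset.mul_sum]
    refine Finset.sum_le_sum fun T hT => ?_
    have h1 := mul_pow_mul_pow_le hE (hω _) (hK (latticeDiam T)) (k := d) (j := 0) (by nlinarith)
    rw [pow_zero, mul_one] at h1
    have h2 : (T.card : ℝ) ≤ ((latticeDiam T : ℝ) + 1) ^ d := by
      exact_mod_cast card_simplex_le hd (mem_simplices.1 (Finset.mem_filter.1 hT).1).2
    calc w T * T.card ≤ w T * ((latticeDiam T : ℝ) + 1) ^ d := mul_le_mul_of_nonneg_left h2 (hw T)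
      _ = ω (latticeDiam T) * ((latticeDiam T : ℝ) + 1) ^ d *
          (2 * (Real.exp (κ * (latticeDiam T : ℝ) ^ α) * ‖G T‖)) := by
          simp only [hw', hsplit]; ring
      _ ≤ K * E ^ d * (2 * (Real.exp (κ * (latticeDiam T : ℝ) ^ α) * ‖G T‖)) :=
          mul_le_mul_of_nonneg_right h1 (by positivity)
      _ = _ := by ring
  have hN1 : 3 * d - 1 ≤ (d + 1) ^ 2 := by
    have : 3 * d ≤ (d + 1) ^ 2 := by nlinarith
    omega
  have hN2 : (d - 1) * (d + 1) + 2 * (d + 1) ≤ (d + 1) ^ 2 := by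
    rw [← add_mul, sq]
    exact Nat.mul_le_mul_right _ (by omega)
  -- The constants `c` and `M` depend on the lattice and the decompositions, but occur only in the
  -- remainder, which vanishes as the number of expanded steps grows.
  set c : ℝ := 2 ^ (d + 1) * ∑ R ∈ simplices Λ, ∑ S ∈ simplices R,
    Real.exp ((κ - δ) * (latticeDiam R : ℝ) ^ α) * ‖O S‖ with hc
  set M : ℝ := ((d + 1 : ℕ) : ℝ) * ∑ T ∈ simplices Λ, 2 * ‖G T‖ with hM
  have hM0 : 0 ≤ M := mul_nonneg (Nat.cast_nonneg _) (Finset.sum_nonneg fun _ _ => by positivity)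
  set x : ℝ := 4 * (d + 1) * K * C with hx
  have hx0 : 0 ≤ x := by positivity
  have key (i : SimplicialLattice d) (k : ℕ) :
      ∑ R ∈ simplices Λ with i ∈ R, Real.exp ((κ - δ) * (latticeDiam R : ℝ) ^ α) *
        ‖spreadDecomposition G O R‖ ≤
      (2 * K + 2 * K * (d + 1) * 3 ^ d + K * 6 ^ (d + 1) * Real.exp x) *
        E ^ (2 * d - 1) * τ * b + M ^ (k + 2) / (k + 2).factorial * c := by
    let a : ℕ → ℝ := fun n => ∑ R ∈ simplices Λ with i ∈ R, ∑ S ∈ simplices R with S ≠ R,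
      ω (latticeDiam R) * (o S *
        historySum (simplices R) w S (fun Q => if Q = [] then 1 else 0) n (growthFaces S R))
    have ha0 : a 0 = 0 := by
      refine Finset.sum_eq_zero fun R hR => Finset.sum_eq_zero fun S hS => ?_
      obtain ⟨hS, hSR⟩ := Finset.mem_filter.1 hS
      have hne : growthFaces S R ≠ [] := growthFaces_ne_nil hd (mem_simplices.1 hS).2
        (mem_simplices.1 (Finset.mem_filter.1 hR).1).2
        fun h => hSR ((mem_simplices.1 hS).1.antisymm h)
      simp [historySum, hne]
    have ha1 : a 1 ≤ K * (d + 1) * 3 ^ d * E ^ (2 * d - 1) * (2 * τ) * b :=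
      sum_historySum_one_le hd hw ho hE hwτ (by positivity) hb0 hob hK0 hω hK hN1 i
    have ha (n : ℕ) : a (n + 2) ≤ K * 6 ^ (d + 1) * b * (τ * E ^ (2 * d - 1)) * x ^ (n + 2) := by
      have h1 := sum_historySum_succ_le hd hw ho hE hu (by positivity) hb0 hob hK0 hω hK hN2 i (n + 1)
      have h2 := pow_mul_pow_le_of_mul_pow_le hd hτ0 hE hC hτC n
      calc a (n + 2) ≤ ∑ R ∈ simplices Λ with i ∈ R, ∑ S ∈ simplices R, ω (latticeDiam R) * (o S *
            historySum (simplices R) w S (fun Q => if Q = [] then 1 else 0) (n + 1 + 1)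
              (growthFaces S R)) := by
            refine Finset.sum_le_sum fun R _ => Finset.sum_le_sum_of_subset_of_nonneg
              (Finset.filter_subset _ _) fun S _ _ => ?_
            exact mul_nonneg (hω _) (mul_nonneg (ho S)
              (historySum_nonneg hw (fun Q => by split_ifs <;> norm_num) _ _))
        _ ≤ _ := h1
        _ = K * 6 ^ (d + 1) * b * (4 * (d + 1) * K) ^ (n + 2) *
            ((E ^ d * τ) ^ (n + 2) * E ^ ((d - 1) * (n + 2) + (d + 1))) := by
            rw [show 2 * ((d : ℝ) + 1) * (2 * K * E ^ d * τ) = 4 * (d + 1) * K * (E ^ d * τ) by ring,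
              mul_pow _ (E ^ d * τ)]
            ring
        _ ≤ K * 6 ^ (d + 1) * b * (4 * (d + 1) * K) ^ (n + 2) *
            (τ * E ^ (2 * d - 1) * C ^ (n + 2)) := mul_le_mul_of_nonneg_left h2 (by positivity)
        _ = _ := by rw [hx, mul_pow _ C]; ring
    have hseries : ∑ n ∈ Finset.range (k + 2), ((n.factorial : ℝ))⁻¹ * a n ≤
        K * (d + 1) * 3 ^ d * E ^ (2 * d - 1) * (2 * τ) * b +
          K * 6 ^ (d + 1) * b * (τ * E ^ (2 * d - 1)) * Real.exp x := by
      rw [Finset.sum_range_succ', Finset.sum_range_succ', ha0, mul_zero, add_zero, add_comm]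
      refine add_le_add (by simpa using ha1) ?_
      have h1 := Real.sum_le_exp_of_nonneg hx0 (k + 2)
      rw [Finset.sum_range_succ', Finset.sum_range_succ'] at h1
      have h2 : ∑ n ∈ Finset.range k, x ^ (n + 2) / (n + 2).factorial ≤ Real.exp x := by
        refine le_trans ?_ h1
        rw [add_assoc]
        exact le_add_of_nonneg_right (by positivity)
      refine le_trans (Finset.sum_le_sum fun n _ =>
        mul_le_mul_of_nonneg_left (ha n) (by positivity)) ?_
      refine le_trans (le_of_eq ?_) (mul_le_mul_of_nonneg_left h2
        (by positivity : 0 ≤ K * 6 ^ (d + 1) * b * (τ * E ^ (2 * d - 1))))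
      rw [Finset.mul_sum]
      exact Finset.sum_congr rfl fun n _ => by ring
    have hself : ∑ R ∈ simplices Λ with i ∈ R, Real.exp ((κ - δ) * (latticeDiam R : ℝ) ^ α) *
        ‖spreadPart G (O R) R R - O R‖ ≤ K * E ^ d * (2 * τ) * b := by
      refine (Finset.sum_le_sum fun R _ => ?_).trans (sum_decay_mul_sum_simplices_le hd
        (g := fun T => 2 * ‖G T‖) (fun T => by positivity) ho hE hgτ (by positivity) hob hK0 hω hK
        (by nlinarith) i)
      rw [hsplit']
      calc _ ≤ ω (latticeDiam R) * Real.exp ((κ - δ / 2) * (latticeDiam R : ℝ) ^ α) *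
            ((∑ T ∈ simplices R, 2 * ‖G T‖) * ‖O R‖) :=
            mul_le_mul_of_nonneg_left (norm_spreadPart_self_sub_le hG (O R) R)
              (mul_nonneg (hω _) (Real.exp_nonneg _))
        _ = _ := by simp only [ho']; ring
    have hspread (R : Finset (SimplicialLattice d)) (hR : R ∈ simplices Λ) :
        ‖spreadDecomposition G O R‖ ≤ ‖spreadPart G (O R) R R - O R‖ +
          ∑ S ∈ simplices R with S ≠ R, ‖spreadPart G (O S) S R‖ := by
      have hRR : R ∈ simplices R := mem_simplices.2 ⟨subset_rfl, (mem_simplices.1 hR).2⟩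
      rw [spreadDecomposition, ← Finset.add_sum_erase _ _ hRR, if_pos rfl, Finset.filter_ne']
      refine (norm_add_le _ _).trans (add_le_add_right ((norm_sum_le _ _).trans_eq ?_) _)
      refine Finset.sum_congr rfl fun S hS => ?_
      rw [if_neg (Finset.ne_of_mem_erase hS), sub_zero]
    have hterm (R : Finset (SimplicialLattice d)) (hR : R ∈ simplices Λ)
        (S : Finset (SimplicialLattice d)) (hS : S ∈ simplices R) :
        Real.exp ((κ - δ) * (latticeDiam R : ℝ) ^ α) * ‖spreadPart G (O S) S R‖ ≤
        ∑ n ∈ Finset.range (k + 2), ((n.factorial : ℝ))⁻¹ * (ω (latticeDiam R) * (o S *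
          historySum (simplices R) w S (fun Q => if Q = [] then 1 else 0) n (growthFaces S R))) +
        M ^ (k + 2) / (k + 2).factorial * (2 ^ (d + 1) *
          (Real.exp ((κ - δ) * (latticeDiam R : ℝ) ^ α) * ‖O S‖)) := by
      have h1 := exp_mul_norm_spreadPart_le hd hΛ hG hGs hR hS
        (hOs S (simplices_mono (mem_simplices.1 hR).1 hS)) hα0 hα1 hκ (κ' := κ - δ) (k + 2)
      rwa [show κ - δ - (κ - δ / 2) = -(δ / 2) by ring] at h1
    have hrest : ∑ R ∈ simplices Λ with i ∈ R, ∑ S ∈ simplices R with S ≠ R,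
        Real.exp ((κ - δ) * (latticeDiam R : ℝ) ^ α) * ‖spreadPart G (O S) S R‖ ≤
        ∑ n ∈ Finset.range (k + 2), ((n.factorial : ℝ))⁻¹ * a n +
          M ^ (k + 2) / (k + 2).factorial * c := by
      calc _ ≤ ∑ R ∈ simplices Λ with i ∈ R, ∑ S ∈ simplices R with S ≠ R,
            (∑ n ∈ Finset.range (k + 2), ((n.factorial : ℝ))⁻¹ * (ω (latticeDiam R) * (o S *
              historySum (simplices R) w S (fun Q => if Q = [] then 1 else 0) n (growthFaces S R))) +
            M ^ (k + 2) / (k + 2).factorial * (2 ^ (d + 1) *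
              (Real.exp ((κ - δ) * (latticeDiam R : ℝ) ^ α) * ‖O S‖))) :=
            Finset.sum_le_sum fun R hR => Finset.sum_le_sum fun S hS =>
              hterm R (Finset.mem_filter.1 hR).1 S (Finset.mem_filter.1 hS).1
        _ = ∑ n ∈ Finset.range (k + 2), ((n.factorial : ℝ))⁻¹ * a n +
            M ^ (k + 2) / (k + 2).factorial * (2 ^ (d + 1) *
            ∑ R ∈ simplices Λ with i ∈ R, ∑ S ∈ simplices R with S ≠ R,
              (Real.exp ((κ - δ) * (latticeDiam R : ℝ) ^ α) * ‖O S‖)) := by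
            simp only [Finset.sum_add_distrib, a, Finset.mul_sum]
            congr 1
            rw [Finset.sum_comm]
            conv_rhs => rw [Finset.sum_comm]
            rw [Finset.sum_comm]
            exact Finset.sum_congr rfl fun R _ => Finset.sum_comm
        _ ≤ _ := by
            refine add_le_add_right (mul_le_mul_of_nonneg_left
              (mul_le_mul_of_nonneg_left ?_ (by positivity)) (by positivity)) _
            refine (Finset.sum_le_sum fun R _ => Finset.sum_le_sum_of_subset_of_nonneg
              (Finset.filter_subset _ _) fun S _ _ => by positivity).trans ?_
            exact Finset.sum_le_sum_of_subset_of_nonneg (Finset.filter_subset _ _)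
              fun R _ _ => Finset.sum_nonneg fun S _ => by positivity
    have hpow : E ^ d ≤ E ^ (2 * d - 1) := pow_le_pow_right₀ hE (by omega)
    calc _ ≤ ∑ R ∈ simplices Λ with i ∈ R, (Real.exp ((κ - δ) * (latticeDiam R : ℝ) ^ α) *
          ‖spreadPart G (O R) R R - O R‖ + ∑ S ∈ simplices R with S ≠ R,
            Real.exp ((κ - δ) * (latticeDiam R : ℝ) ^ α) * ‖spreadPart G (O S) S R‖) := by
          refine Finset.sum_le_sum fun R hR => ?_
          rw [← Finset.mul_sum, ← mul_add]
          exact mul_le_mul_of_nonneg_left (hspread R (Finset.mem_filter.1 hR).1) (Real.exp_nonneg _)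
      _ ≤ K * E ^ d * (2 * τ) * b + (K * (d + 1) * 3 ^ d * E ^ (2 * d - 1) * (2 * τ) * b +
          K * 6 ^ (d + 1) * b * (τ * E ^ (2 * d - 1)) * Real.exp x +
          M ^ (k + 2) / (k + 2).factorial * c) := by
          rw [Finset.sum_add_distrib]
          exact add_le_add hself (hrest.trans (add_le_add_left hseries _))
      _ ≤ K * E ^ (2 * d - 1) * (2 * τ) * b + (K * (d + 1) * 3 ^ d * E ^ (2 * d - 1) * (2 * τ) * b +
          K * 6 ^ (d + 1) * b * (τ * E ^ (2 * d - 1)) * Real.exp x +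
          M ^ (k + 2) / (k + 2).factorial * c) := by gcongr
      _ = _ := by ring
  have hbound : decompositionNorm α (κ - δ) (spreadDecomposition G O) ≤
      (2 * K + 2 * K * (d + 1) * 3 ^ d + K * 6 ^ (d + 1) * Real.exp x) *
        E ^ (2 * d - 1) * τ * b := by
    refine Real.iSup_le (fun i => ?_) (by positivity)
    have hlim : Filter.Tendsto (fun k : ℕ =>
        (2 * K + 2 * K * (d + 1) * 3 ^ d + K * 6 ^ (d + 1) * Real.exp x) *
        E ^ (2 * d - 1) * τ * b + M ^ (k + 2) / (k + 2).factorial * c) Filter.atTop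
        (nhds ((2 * K + 2 * K * (d + 1) * 3 ^ d + K * 6 ^ (d + 1) * Real.exp x) *
        E ^ (2 * d - 1) * τ * b + 0 * c)) :=
      (((FloorSemiring.tendsto_pow_div_factorial_atTop M).comp
        (Filter.tendsto_add_atTop_nat 2)).mul_const c).const_add _
    rw [zero_mul, add_zero] at hlim
    exact ge_of_tendsto' hlim (key i.1)
  refine le_trans (csInf_le ⟨0, ?_⟩ ⟨spreadDecomposition G O,
    isLocalDecomposition_spreadDecomposition hd hΛ hGs hOs, rfl⟩) hbound
  rintro _ ⟨f, -, rfl⟩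
  exact decompositionNorm_nonneg _ _ _

end Bound

/-! ### Nearly optimal decompositions, made Hermitian term by term. -/

section Approximation

variable {d : ℕ} {Λ : Finset (SimplicialLattice d)} {q : Λ → ℕ}

theorem exists_decompositionNorm_lt (hΛ : IsSimplex Λ) (α κ : ℝ) (A : LatticeOp Λ q) {η : ℝ}
    (hη : 0 < η) : ∃ f : Finset (SimplicialLattice d) → LatticeOp Λ q,
      IsLocalDecomposition A f ∧ decompositionNorm α κ f < kappaNorm α κ A + η := by
  obtain ⟨f₀, hf₀⟩ := exists_isLocalDecomposition hΛ A
  obtain ⟨_, ⟨f, hf, rfl⟩, h⟩ := exists_lt_of_csInf_lt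
    (s := {r : ℝ | ∃ f : Finset (SimplicialLattice d) → LatticeOp Λ q,
      IsLocalDecomposition A f ∧ r = decompositionNorm α κ f}) ⟨_, f₀, hf₀, rfl⟩
    (lt_add_of_pos_right (kappaNorm α κ A) hη)
  exact ⟨f, hf, h⟩

theorem kappaNorm_nonneg (α κ : ℝ) (A : LatticeOp Λ q) : 0 ≤ kappaNorm α κ A := by
  refine Real.sInf_nonneg ?_
  rintro _ ⟨f, -, rfl⟩
  exact decompositionNorm_nonneg α κ f

theorem sum_le_decompositionNorm (α κ : ℝ) (f : Finset (SimplicialLattice d) → LatticeOp Λ q)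
    (x : SimplicialLattice d) :
    ∑ T ∈ simplices Λ with x ∈ T, Real.exp (κ * (latticeDiam T : ℝ) ^ α) * ‖f T‖ ≤
      decompositionNorm α κ f := by
  by_cases hx : x ∈ Λ
  · exact le_ciSup (f := fun i : Λ => ∑ S ∈ (simplices Λ).filter (fun S => i.1 ∈ S),
      Real.exp (κ * (latticeDiam S : ℝ) ^ α) * ‖f S‖) (Set.finite_range _).bddAbove ⟨x, hx⟩
  · rw [Finset.filter_false_of_mem, Finset.sum_empty]
    · exact decompositionNorm_nonneg α κ f
    · intro T hT hxT
      simp only [simplices, Finset.mem_filter, Finset.mem_powerset] at hT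
      exact hx (hT.1 hxT)

/-- A decomposition of a Hermitian operator, made Hermitian term by term and scaled by `t`. -/
noncomputable def hermitianPart (t : ℝ) (f : Finset (SimplicialLattice d) → LatticeOp Λ q)
    (T : Finset (SimplicialLattice d)) : LatticeOp Λ q :=
  ((t / 2 : ℝ) : ℂ) • (f T + (f T).conjTranspose)

theorem isSelfAdjoint_hermitianPart (t : ℝ) (f : Finset (SimplicialLattice d) → LatticeOp Λ q)
    (T : Finset (SimplicialLattice d)) : IsSelfAdjoint (hermitianPart t f T) := by
  rw [isSelfAdjoint_iff, hermitianPart, star_smul, star_add, Matrix.star_eq_conjTranspose,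
    Matrix.star_eq_conjTranspose, Matrix.conjTranspose_conjTranspose, add_comm]
  congr 1
  exact Complex.conj_ofReal _

theorem norm_hermitianPart_le (t : ℝ) (f : Finset (SimplicialLattice d) → LatticeOp Λ q)
    (T : Finset (SimplicialLattice d)) : ‖hermitianPart t f T‖ ≤ |t| * ‖f T‖ := by
  have h : ‖f T + (f T).conjTranspose‖ ≤ 2 * ‖f T‖ := by
    refine (norm_add_le _ _).trans_eq ?_
    rw [Matrix.l2_opNorm_conjTranspose]; ring
  rw [hermitianPart, norm_smul, Complex.norm_real, Real.norm_eq_abs, abs_div, abs_two]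
  calc |t| / 2 * ‖f T + (f T).conjTranspose‖ ≤ |t| / 2 * (2 * ‖f T‖) := by gcongr
    _ = _ := by ring

theorem supportedIn_hermitianPart (t : ℝ) {f : Finset (SimplicialLattice d) → LatticeOp Λ q}
    {T : Finset (SimplicialLattice d)} (h : SupportedIn T (f T)) :
    SupportedIn T (hermitianPart t f T) :=
  mem_supportedAlgebra.1 <| Subalgebra.smul_mem _ (add_mem (mem_supportedAlgebra.2 h)
    (mem_supportedAlgebra.2 h.conjTranspose)) _

theorem sum_hermitianPart (t : ℝ) {f : Finset (SimplicialLattice d) → LatticeOp Λ q}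
    {H : LatticeOp Λ q} (hH : H.IsHermitian) (hf : ∑ T ∈ simplices Λ, f T = H) :
    ∑ T ∈ simplices Λ, hermitianPart t f T = (t : ℂ) • H := by
  simp only [hermitianPart]
  rw [← Finset.smul_sum, Finset.sum_add_distrib, ← Matrix.conjTranspose_sum, hf, hH.eq,
    ← two_smul ℂ H, smul_smul]
  congr 1
  push_cast
  ring

end Approximation

/-! ### Choice of the length scale and conclusion. -/

theorem exp_mul_one_add_div_pow_le {α δ ε E K : ℝ} {N : ℕ} (hα : 0 < α) (hδ : 0 < δ)
    (hε : ε = δ ^ (1 / α)) (hE : 1 ≤ E * ε) (hE0 : 0 < E)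
    (hK : ∀ y : ℝ, 0 ≤ y → Real.exp (-(y ^ α / 2)) * (1 + y) ^ N ≤ K) (m : ℕ) :
    Real.exp (-(δ / 2) * (m : ℝ) ^ α) * (1 + m / E) ^ N ≤ K := by
  have hε0 : 0 < ε := hε ▸ Real.rpow_pos_of_pos hδ _
  -- Substituting `y = ε * m` absorbs `δ`: the decay has length scale `ε⁻¹`.
  have hpow : (ε * m) ^ α = δ * (m : ℝ) ^ α := by
    rw [Real.mul_rpow hε0.le m.cast_nonneg, hε, ← Real.rpow_mul hδ.le, one_div_mul_cancel hα.ne',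
      Real.rpow_one]
  refine le_trans ?_ (hK (ε * m) (by positivity))
  rw [hpow, show -(δ * (m : ℝ) ^ α / 2) = -(δ / 2) * (m : ℝ) ^ α by ring]
  have : (m : ℝ) / E ≤ ε * m := by
    rw [div_le_iff₀ hE0]
    nlinarith [(m.cast_nonneg : (0 : ℝ) ≤ m)]
  gcongr

theorem mainTheorem3 (d : ℕ) (hd : 1 ≤ d) (α : ℝ) (hα0 : 0 < α) (hα1 : α < 1)
    (κ₁ : ℝ) (hκ₁ : 0 < κ₁) :
    ∃ c : ℝ, 0 < c ∧
      ∀ (Λ : Finset (SimplicialLattice d)), IsSimplex Λ →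
      ∀ (q : Λ → ℕ), (∀ i, 1 ≤ q i) →
      ∀ (κ δκ : ℝ), 0 < δκ → δκ ≤ κ → κ ≤ κ₁ →
      ∀ (H : LatticeOp Λ q), H.IsHermitian →
      ∀ (t : ℝ), |t| * kappaNorm α κ H ≤ δκ ^ ((3 * (d : ℝ) + 1) / α) →
      ∀ (O : LatticeOp Λ q),
        kappaNorm α (κ - δκ) (heisenberg H t O - O) ≤
          c * δκ ^ (-((2 * (d : ℝ) - 1) / α)) * |t| * kappaNorm α κ H * kappaNorm α κ O := by
  obtain ⟨K, hK1, hK⟩ := exists_exp_neg_rpow_mul_pow_le hα0 ((d + 1) ^ 2)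
  -- An upper bound for `δκ ^ (1 / α)` over the admissible range, so that `E = ε₁ / ε` is at least
  -- `1`. The constant depends on `κ₁` only through it.
  set ε₁ : ℝ := max 1 (κ₁ ^ (1 / α)) with hε₁
  have hε₁1 : 1 ≤ ε₁ := le_max_left _ _
  -- The factor `2` leaves room for the excess of a nearly optimal decomposition of `H`.
  set C : ℝ := 2 * ε₁ ^ (3 * d + 1) with hC
  have hC1 : 1 ≤ C := by
    have := one_le_pow₀ (n := 3 * d + 1) hε₁1
    linarith
  set c₀ : ℝ := 2 * K + 2 * K * (d + 1) * 3 ^ d +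
    K * 6 ^ (d + 1) * Real.exp (4 * (d + 1) * K * C) with hc₀
  have hc₀0 : 0 < c₀ := by positivity
  refine ⟨c₀ * ε₁ ^ (2 * d - 1), by positivity, ?_⟩
  intro Λ hΛ q _ κ δκ hδ hδκ hκ H hH t ht O
  set ε : ℝ := δκ ^ (1 / α) with hε
  have hε0 : 0 < ε := Real.rpow_pos_of_pos hδ _
  have hεε₁ : ε ≤ ε₁ := (Real.rpow_le_rpow hδ.le (hδκ.trans hκ) (by positivity)).trans
    (le_max_right _ _)
  have hpow (n : ℕ) (r : ℝ) (hr : r = n) : δκ ^ (r / α) = ε ^ n := by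
    rw [hr, hε, ← Real.rpow_natCast, ← Real.rpow_mul hδ.le]
    ring_nf
  rw [hpow (3 * d + 1) _ (by push_cast; ring)] at ht
  have h2d : ((2 * d - 1 : ℕ) : ℝ) = 2 * (d : ℝ) - 1 := by
    rw [Nat.cast_sub (by omega)]; push_cast; ring
  rw [Real.rpow_neg hδ.le, hpow (2 * d - 1) _ h2d.symm]
  set E : ℝ := ε₁ / ε with hEdef
  have hE : 1 ≤ E := (one_le_div hε0).2 hεε₁
  have hEε : E * ε = ε₁ := div_mul_cancel₀ _ hε0.ne'
  have hKm := exp_mul_one_add_div_pow_le hα0 hδ hε (hEε ▸ hε₁1) (by linarith) hK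
  -- Both decompositions are taken within `η` of the infimum; `η` tends to zero at the end.
  have key (η : ℝ) (hη : 0 < η) (htη : |t| * η ≤ ε ^ (3 * d + 1)) :
      kappaNorm α (κ - δκ) (heisenberg H t O - O) ≤ c₀ * E ^ (2 * d - 1) *
        (|t| * (kappaNorm α κ H + η)) * (kappaNorm α κ O + η) := by
    obtain ⟨f, ⟨hfs, hf⟩, hfη⟩ := exists_decompositionNorm_lt hΛ α κ H hη
    obtain ⟨g, ⟨hgs, hg⟩, hgη⟩ := exists_decompositionNorm_lt hΛ α κ O hη
    have hkH := kappaNorm_nonneg α κ H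
    have hkO := kappaNorm_nonneg α κ O
    have main := kappaNorm_evolve_sub_le hd hΛ hα0 hα1.le hδ hδκ hE (by linarith : 0 ≤ K) hKm
      (isSelfAdjoint_hermitianPart t f) (fun T hT => supportedIn_hermitianPart t (hfs T hT)) hgs
      (τ := |t| * (kappaNorm α κ H + η)) (b := kappaNorm α κ O + η) (C := C)
      (fun x => by
        refine le_trans ?_ (mul_le_mul_of_nonneg_left
          ((sum_le_decompositionNorm α κ f x).trans hfη.le) (abs_nonneg t))
        rw [Finset.mul_sum]
        refine Finset.sum_le_sum fun T _ => ?_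
        rw [mul_left_comm]
        exact mul_le_mul_of_nonneg_left (norm_hermitianPart_le t f T) (Real.exp_nonneg _))
      (fun x => (sum_le_decompositionNorm α κ g x).trans hgη.le)
      (by positivity) (by positivity) hC1
      (by
        rw [hC, ← hEε, mul_pow]
        have : |t| * (kappaNorm α κ H + η) ≤ 2 * ε ^ (3 * d + 1) := by rw [mul_add]; linarith
        have := mul_le_mul_of_nonneg_right this (by positivity : 0 ≤ E ^ (3 * d + 1))
        linarith)
    rwa [sum_hermitianPart t hH hf, hg, ← heisenberg_eq_evolve] at main
  have hlim : Filter.Tendsto (fun η : ℝ => c₀ * E ^ (2 * d - 1) *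
      (|t| * (kappaNorm α κ H + η)) * (kappaNorm α κ O + η)) (nhdsWithin 0 (Set.Ioi 0))
      (nhds (c₀ * E ^ (2 * d - 1) * (|t| * (kappaNorm α κ H + 0)) * (kappaNorm α κ O + 0))) :=
    tendsto_nhdsWithin_of_tendsto_nhds (Continuous.tendsto (by fun_prop) 0)
  have hev : ∀ᶠ η : ℝ in nhdsWithin 0 (Set.Ioi 0), |t| * η ≤ ε ^ (3 * d + 1) := by
    have : Filter.Tendsto (fun η : ℝ => |t| * η) (nhds 0) (nhds (|t| * 0)) :=
      Continuous.tendsto (by fun_prop) 0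
    rw [mul_zero] at this
    exact (tendsto_nhdsWithin_of_tendsto_nhds this).eventually_le_const (by positivity)
  refine (ge_of_tendsto hlim ?_).trans_eq ?_
  · filter_upwards [hev, self_mem_nhdsWithin] with η h1 h2 using key η h2 h1
  · rw [add_zero, add_zero, hEdef, div_pow, div_eq_mul_inv]
    ring
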